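/- **Theorem 3.1 (Tube formula for fractal sprays).** Let $d\ge 1$. For $A\subseteq\mathbb R^d$ and $\varepsilon\ge 0$ let $V_A(\varepsilon)$ be the Lebesgue measure of $\{x\in A: \operatorname{dist}(x,\partial A)\le\varepsilon\}$. *Generator.* Let $G\subseteq\mathbb R^d$ be a bounded open set with inradius $g=\sup\{\varepsilon>0:\exists x,\ B(x,\varepsilon)\subseteq G\}>0$ that is Steiner-like: $V_G(\varepsilon)=\sum_{k=0}^{d-1}\kappa_k(\varepsilon)\,\varepsilon^{d-k}$ for $0\le\varepsilon\le g$, where each $\kappa_k$ is bounded and locally integrable on $[0,g]$ and has a finite limit at $0^+$. Put $\kappa_d:=-\operatorname{vol}(G)$. *Spray.* Let $T\subseteq\mathbb R^d$ be a bounded open set that is the disjoint union of countably many open sets $T_n$, where $T_n$ is congruent to $r_nG$, $r_n>0$. Let $\eta=\sum_n\delta_{1/r_n}$. *Zeta functions.* For $\operatorname{Re}s>d$ let $\zeta_\eta(s)=\int_0^\infty x^{-s}\,d\eta(x)=\sum_n r_n^s$ and $$M(s)=\sum_{k=0}^{d-1}\int_0^g\kappa_k(t)\,t^{s-k-1}\,dt+\kappa_d\frac{g^{s-d}}{s-d}$$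 (if the $\kappa_k$ are constant, $M(s)=\sum_{k=0}^d \frac{g^{s-k}}{s-k}\kappa_k$). Let $f:\mathbb R\to\mathbb R$ be bounded and Lipschitz, $S=\{f(t)+it:t\in\mathbb R\}$ the screen, $\sup S=\sup f$, and $W=\{s:\operatorname{Re}s\ge f(\operatorname{Im}s)\}$ the window. Assume that $d\in W$, that $\zeta_\eta$ and $M$ have meromorphic continuations, denoted by the same letters, to an open neighbourhood of $W$, and that $$\zeta_T(\varepsilon,s)=\varepsilon^{d-s}\,\zeta_\eta(s)\,M(s)$$ has no pole on $S$. *Languidity.* Assume that $\zeta_T$ is languid: there are $\beta\in\mathbb R$, $C>0$ and reals $(\tau_n)_{n\in\mathbb Z}$ with $\tau_{-n}<0<\tau_n$ for $n\ge1$, $\tau_n\to\infty$, $\tau_{-n}\to-\infty$, $\tau_n/|\tau_{-n}|\to1$, such that $|\zeta_T(1,\sigma+i\tau_n)|\le C(|\tau_n|+1)^\beta$ for all $n\in\mathbb Z$ and $f(\tau_n)\le\sigma\le d$, and $|\zeta_T(1,f(t)+it)|\le C|t|^\beta$ for all $|t|\ge1$. *Complex dimensions.* Let $\mathcal D_T(W)$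 consist of the poles of $\zeta_\eta$ in $W$ (the visible scaling dimensions), the integers among $0,1,\dots,d-1$ that lie in $W$, and any further poles of $M$ in $W$ other than $d$. Then: 1. If the $\kappa_k$ are piecewise constant (in particular, if they are constant), $M$ has no such further poles: $\mathcal D_T(W)$ consists of the visible scaling dimensions and of the integers among $0,\dots,d-1$ in $W$. 2. As distributions on $(0,\infty)$, $$V_T(\varepsilon)=\sum_{\omega\in\mathcal D_T(W)}\operatorname{res}\bigl(\zeta_T(\varepsilon,s);s=\omega\bigr)+\mathcal R(\varepsilon),\qquad \mathcal R(\varepsilon)=\frac1{2\pi i}\int_S\zeta_T(\varepsilon,s)\,ds=O(\varepsilon^{d-\sup S})\quad(\varepsilon\to0^+).$$ That is, the identity holds after pairing with every $\varphi\in C_c^\infty((0,\infty))$, where $\langle\mathcal R,\varphi\rangle=\frac1{2\pi i}\int_S\langle\zeta_T(\cdot,s),\varphi\rangle\,ds$ converges absolutely; and $\langle\mathcal R,\varphi_a\rangle=O(a^{d-\sup S})$ as $a\to0^+$, where $\varphi_a(\varepsilon)=a^{-1}\varphi(\varepsilon/a)$. 3. If $\beta<-1$, the formula, with an absolutely convergent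 integral $\mathcal R(\varepsilon)$, holds for every single $\varepsilon>0$, and $\mathcal R(\varepsilon)=O(\varepsilon^{d-\sup S})$ as $\varepsilon\to0^+$ holds in the usual sense. In 2 and 3 the sum over $\mathcal D_T(W)$ is the limit, as $n\to\infty$, of the finite sums over $\{\omega\in\mathcal D_T(W):\tau_{-n}\le\operatorname{Im}\omega\le\tau_n\}$. -/

import Mathlib

open Set Filter Topology MeasureTheory
open scoped Pointwise

noncomputable section

/-! Geometry: inner neighbourhoods, inradius, Steiner-like generators, fractal sprays. -/

/-- The inner `ε`-neighbourhood of `A`: the points of `A` within distance `ε` of the boundary. -/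
def innerNhd {d : ℕ} (A : Set (EuclideanSpace ℝ (Fin d))) (ε : ℝ) :
    Set (EuclideanSpace ℝ (Fin d)) :=
  {x | x ∈ A ∧ Metric.infDist x (frontier A) ≤ ε}

/-- The inner tube volume `V_A(ε)`, the Lebesgue measure of the inner `ε`-neighbourhood. -/
def tubeVolume {d : ℕ} (A : Set (EuclideanSpace ℝ (Fin d))) (ε : ℝ) : ℝ :=
  volume.real (innerNhd A ε)

/-- The inradius of `A`: the supremum of the radii of open balls contained in `A`. -/
def inradius {d : ℕ} (A : Set (EuclideanSpace ℝ (Fin d))) : ℝ :=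
  sSup {ε : ℝ | 0 < ε ∧ ∃ x, Metric.ball x ε ⊆ A}

/-- The bounded open set `G` is Steiner-like, with coefficient functions `κ 0, …, κ (d - 1)`:
`V_G(ε) = ∑_{k<d} κ_k(ε) ε^{d-k}` for `0 ≤ ε ≤ g`, where `g` is the inradius of `G`, the `κ_k` are
bounded and locally integrable on `[0, g]`, and each has a finite limit at `0⁺`.
The limits may have any sign, and there is no term of degree `0` because `V_G(0⁺) = 0`. -/
structure IsSteinerLike {d : ℕ} (G : Set (EuclideanSpace ℝ (Fin d))) (κ : ℕ → ℝ → ℝ) : Prop where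
  isOpen : IsOpen G
  isBounded : Bornology.IsBounded G
  tube : ∀ ε ∈ Icc 0 (inradius G),
    tubeVolume G ε = ∑ k ∈ Finset.range d, κ k ε * ε ^ (d - k)
  bounded : ∀ k < d, ∃ B, ∀ ε ∈ Icc 0 (inradius G), |κ k ε| ≤ B
  locallyIntegrable : ∀ k < d, LocallyIntegrableOn (κ k) (Icc 0 (inradius G))
  limit : ∀ k < d, ∃ L, Tendsto (κ k) (𝓝[>] 0) (𝓝 L)

/-- The coefficient functions are piecewise constant on `[0, g]`: off a finite set `P` of
breakpoints they do not change on any interval that avoids `P`. If they are constant (the diphase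
case), `P = ∅` works. -/
def IsPluriphase {d : ℕ} (G : Set (EuclideanSpace ℝ (Fin d))) (κ : ℕ → ℝ → ℝ) : Prop :=
  ∃ P : Finset ℝ, ∀ k < d, ∀ x y : ℝ, 0 ≤ x → x ≤ y → y ≤ inradius G →
    (∀ p ∈ P, p ∉ Icc x y) → κ k x = κ k y

/-- `T` is a fractal spray on the generator `G` with scaling ratios `r n`: a bounded open set that
is the disjoint union of tiles, the `n`-th one being congruent to `r n • G`. -/
structure IsFractalSpray {d : ℕ} {ι : Type*} (G : Set (EuclideanSpace ℝ (Fin d))) (r : ι → ℝ)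
    (T : Set (EuclideanSpace ℝ (Fin d))) : Prop where
  isOpen : IsOpen T
  isBounded : Bornology.IsBounded T
  ratio_pos : ∀ n, 0 < r n
  tiles : ∃ tile : ι → Set (EuclideanSpace ℝ (Fin d)),
    T = ⋃ n, tile n ∧ Pairwise (Function.onFun Disjoint tile) ∧
    ∀ n, ∃ φ : EuclideanSpace ℝ (Fin d) ≃ᵢ EuclideanSpace ℝ (Fin d), tile n = φ '' (r n • G)

/-! Zeta functions. -/

/-- The measure `η = ∑ δ_{1 / r n}` of a string of scaling ratios. -/
def stringMeasure {ι : Type*} (r : ι → ℝ) : Measure ℝ :=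
  Measure.sum fun n => Measure.dirac (r n)⁻¹

/-- The scaling zeta function `ζ_η(s) = ∫_0^∞ x^{-s} dη(x)`, where this integral converges. -/
def scalingZeta {ι : Type*} (r : ι → ℝ) (s : ℂ) : ℂ :=
  ∫ x in Ioi (0 : ℝ), (x : ℂ) ^ (-s) ∂(stringMeasure r)

/-- The factor of the geometric zeta function that belongs to the generator, for `Re s > d`:
`∑_{k<d} ∫_0^g κ_k(t) t^{s-k-1} dt + κ_d g^{s-d} / (s - d)`, with `κ_d = -vol(G)`. -/
def generatorZeta {d : ℕ} (G : Set (EuclideanSpace ℝ (Fin d))) (κ : ℕ → ℝ → ℝ) (s : ℂ) : ℂ :=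
  (∑ k ∈ Finset.range d,
    ∫ t in (0 : ℝ)..inradius G, (κ k t : ℂ) * (t : ℂ) ^ (s - k - 1)) +
  (-(volume.real G : ℂ)) * (inradius G : ℂ) ^ (s - d) / (s - d)

/-- For constant coefficients this is `∑_{k≤d} κ_k g^{s-k} / (s - k)` with `κ_d = -vol(G)`. -/
theorem generatorZeta_of_const {d : ℕ} (G : Set (EuclideanSpace ℝ (Fin d))) (κ : ℕ → ℝ → ℝ)
    (c : ℕ → ℝ) (hg : 0 < inradius G) (hκ : ∀ k < d, ∀ t ∈ Icc 0 (inradius G), κ k t = c k)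
    (hc : c d = -volume.real G) (s : ℂ) (hs : (d : ℝ) < s.re) :
    generatorZeta G κ s =
      ∑ k ∈ Finset.range (d + 1), (inradius G : ℂ) ^ (s - k) / (s - k) * (c k : ℂ) := by
  rw [Finset.sum_range_succ, generatorZeta, hc]
  congr 1
  · refine Finset.sum_congr rfl fun k hk => ?_
    have hkd : k < d := Finset.mem_range.1 hk
    have hre : 0 < (s - k).re := by
      have : (k : ℝ) < d := by exact_mod_cast hkd
      simp only [Complex.sub_re, Complex.natCast_re]
      linarith
    have hne : s - (k : ℂ) ≠ 0 := fun h => by simp [h] at hre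
    have h1 : ∫ t in (0 : ℝ)..inradius G, (κ k t : ℂ) * (t : ℂ) ^ (s - k - 1) =
        ∫ t in (0 : ℝ)..inradius G, (c k : ℂ) * (t : ℂ) ^ (s - k - 1) := by
      refine intervalIntegral.integral_congr fun t ht => ?_
      rw [uIcc_of_le hg.le] at ht
      simp only [hκ k hkd t ht]
    rw [h1, intervalIntegral.integral_const_mul, integral_cpow (Or.inl (by
      simp only [Complex.sub_re, Complex.one_re] at hre ⊢; linarith))]
    simp only [sub_add_cancel, Complex.ofReal_zero, Complex.zero_cpow hne, sub_zero]
    ring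
  · push_cast
    ring

/-- `Z` is a meromorphic function on the open set `U` that continues the function `F`, given on
the half-plane `Re s > a`. -/
structure IsMeromorphicContinuation (F Z : ℂ → ℂ) (a : ℝ) (U : Set ℂ) : Prop where
  meromorphicOn : MeromorphicOn Z U
  eq : ∀ s ∈ U, a < s.re → Z s = F s

/-- The geometric zeta function `ζ_T(ε, s) = ε^{d-s} ζ_η(s) M(s)` of a fractal spray, where `Zη`
and `M` are (continuations of) the scaling zeta function and the factor of the generator. -/
def geometricZeta (d : ℕ) (Zη M : ℂ → ℂ) (ε : ℝ) (s : ℂ) : ℂ :=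
  (ε : ℂ) ^ ((d : ℂ) - s) * (Zη s * M s)

/-! Poles and residues. -/

/-- `F` has a pole at `w`: `|F(s)| → ∞` as `s → w`. -/
def HasPole (F : ℂ → ℂ) (w : ℂ) : Prop :=
  Tendsto (fun s => ‖F s‖) (𝓝[≠] w) atTop

/-- The residue of `F` at `w`: the value of `(2πi)⁻¹ ∮_{|s-w|=ρ} F(s) ds` for all small `ρ > 0`. -/
def residueAt (F : ℂ → ℂ) (w : ℂ) : ℂ :=
  limUnder (𝓝[>] (0 : ℝ)) fun ρ => (2 * Real.pi * Complex.I)⁻¹ * ∮ s in C(w, ρ), F s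

/-! Screen, window, growth conditions and complex dimensions. -/

/-- A function whose graph (axes interchanged) is a screen: bounded and Lipschitz. -/
structure IsScreen (f : ℝ → ℝ) : Prop where
  bounded : ∃ B, ∀ t, |f t| ≤ B
  lipschitz : ∃ K, LipschitzWith K f

/-- The point `f(t) + i t` of the screen. -/
def screenPoint (f : ℝ → ℝ) (t : ℝ) : ℂ := (f t : ℂ) + t * Complex.I

/-- The window: everything on or to the right of the screen. -/
def window (f : ℝ → ℝ) : Set ℂ := {s | f s.im ≤ s.re}

/-- The integrand of `∫_S F(s) ds` in the parametrization `t ↦ f(t) + i t` of the screen. -/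
def screenIntegrand (f : ℝ → ℝ) (F : ℂ → ℂ) (t : ℝ) : ℂ :=
  F (screenPoint f t) * (((deriv f t : ℝ) : ℂ) + Complex.I)

/-- `(2πi)⁻¹ ∫_S F(s) ds`. -/
def screenIntegral (f : ℝ → ℝ) (F : ℂ → ℂ) : ℂ :=
  (2 * Real.pi * Complex.I)⁻¹ * ∫ t : ℝ, screenIntegrand f F t

/-- `Z` is languid with exponent `β` along the heights `τ`: polynomial growth on horizontal
segments from the screen to the line `Re s = a`, and on the screen. -/
structure IsLanguid (Z : ℂ → ℂ) (f : ℝ → ℝ) (a β : ℝ) (τ : ℤ → ℝ) : Prop where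
  pos : ∀ n : ℤ, 0 < n → 0 < τ n
  neg : ∀ n : ℤ, n < 0 → τ n < 0
  top : Tendsto (fun n : ℕ => τ n) atTop atTop
  bot : Tendsto (fun n : ℕ => τ (-n)) atTop atBot
  ratio : Tendsto (fun n : ℕ => τ n / |τ (-n)|) atTop (𝓝 1)
  growth : ∃ C : ℝ, 0 < C ∧
    (∀ n : ℤ, ∀ σ : ℝ, f (τ n) ≤ σ → σ ≤ a →
      ‖Z ((σ : ℂ) + τ n * Complex.I)‖ ≤ C * (|τ n| + 1) ^ β) ∧
    (∀ t : ℝ, 1 ≤ |t| → ‖Z (screenPoint f t)‖ ≤ C * |t| ^ β)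

/-- The visible scaling dimensions together with the visible integers `0, …, d - 1`. -/
def scalingAndIntegerDims (d : ℕ) (f : ℝ → ℝ) (Zη : ℂ → ℂ) : Set ℂ :=
  {w | w ∈ window f ∧ (HasPole Zη w ∨ ∃ k < d, w = (k : ℂ))}

/-- The visible complex dimensions: the set above, together with the visible poles of the
generator factor `M` other than `d`, if there are any more. -/
def visibleDims (d : ℕ) (f : ℝ → ℝ) (Zη M : ℂ → ℂ) : Set ℂ :=
  scalingAndIntegerDims d f Zη ∪ {w | w ∈ window f ∧ HasPole M w ∧ w ≠ (d : ℂ)}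

/-- The part of `D` between the heights `τ (-n)` and `τ n`. -/
def truncDims (D : Set ℂ) (τ : ℤ → ℝ) (n : ℕ) : Set ℂ :=
  {w | w ∈ D ∧ τ (-n) ≤ w.im ∧ w.im ≤ τ n}

/-! The two senses of a tube formula with error term. -/

/-- For every `ε > 0`, `V(ε) = ∑_{w ∈ D} res(ζ(ε, s); s = w) + R(ε)`, the sum being the limit of
the sums over the parts of `D` between the heights `τ (-n)` and `τ n`, and
`R(ε) = (2πi)⁻¹ ∫_S ζ(ε, s) ds` is an absolutely convergent integral with
`R(ε) = O(ε^{d - sup S})` as `ε → 0⁺`. -/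
structure PointwiseTubeFormula (d : ℕ) (V : ℝ → ℝ) (ζ : ℝ → ℂ → ℂ) (D : Set ℂ) (f : ℝ → ℝ)
    (τ : ℤ → ℝ) : Prop where
  finite : ∀ n, (truncDims D τ n).Finite
  integrable : ∀ ε : ℝ, 0 < ε → Integrable (screenIntegrand f (ζ ε))
  formula : ∀ ε : ℝ, 0 < ε →
    Tendsto (fun n : ℕ => (∑ᶠ w ∈ truncDims D τ n, residueAt (ζ ε) w) + screenIntegral f (ζ ε))
      atTop (𝓝 (V ε : ℂ))
  error : (fun ε : ℝ => screenIntegral f (ζ ε)) =O[𝓝[>] 0] fun ε : ℝ => ε ^ ((d : ℝ) - ⨆ t, f t)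

/-- Smooth test functions with compact support in `(0, ∞)`. -/
structure IsTestFunction (φ : ℝ → ℂ) : Prop where
  smooth : ContDiff ℝ ((⊤ : ℕ∞) : WithTop ℕ∞) φ
  compact : HasCompactSupport φ
  support : tsupport φ ⊆ Ioi 0

/-- The pairing `⟨u, φ⟩ = ∫_0^∞ u(ε) φ(ε) dε`. -/
def pairing (u φ : ℝ → ℂ) : ℂ := ∫ ε in Ioi (0 : ℝ), u ε * φ ε

/-- The distribution `φ ↦ (2πi)⁻¹ ∫_S ⟨ζ(·, s), φ⟩ ds` given by the contour integral. -/
def distError (f : ℝ → ℝ) (ζ : ℝ → ℂ → ℂ) (φ : ℝ → ℂ) : ℂ :=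
  screenIntegral f fun s => pairing (fun ε => ζ ε s) φ

/-- The formula `V = ∑_{w ∈ D} res(ζ(ε, s); s = w) + R` as distributions on `(0, ∞)`. The error
estimate `R(ε) = O(ε^{d - sup S})` as `ε → 0⁺` means `⟨R, φ_a⟩ = O(a^{d - sup S})` as `a → 0⁺`
for every test function `φ`, where `φ_a(ε) = a⁻¹ φ(ε / a)`. -/
structure DistributionalTubeFormula (d : ℕ) (V : ℝ → ℝ) (ζ : ℝ → ℂ → ℂ) (D : Set ℂ) (f : ℝ → ℝ)
    (τ : ℤ → ℝ) : Prop where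
  finite : ∀ n, (truncDims D τ n).Finite
  integrable : ∀ φ, IsTestFunction φ →
    Integrable (screenIntegrand f fun s => pairing (fun ε => ζ ε s) φ)
  formula : ∀ φ, IsTestFunction φ →
    Tendsto (fun n : ℕ =>
        (∑ᶠ w ∈ truncDims D τ n, pairing (fun ε => residueAt (ζ ε) w) φ) + distError f ζ φ)
      atTop (𝓝 (pairing (fun ε => (V ε : ℂ)) φ))
  error : ∀ φ, IsTestFunction φ →
    (fun a : ℝ => distError f ζ fun ε => (a : ℂ)⁻¹ * φ (ε / a)) =O[𝓝[>] 0]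
      fun a : ℝ => a ^ ((d : ℝ) - ⨆ t, f t)

end

/-!
Let `δ(x) = dist(x, ∂T)` and `F_T(u) = ∫_T δ(x)^u dx`, the distance zeta function of `T`. For
`Re s > d` the geometric zeta function of the spray is a function of the set `T` alone:
`ζ_η(s) M(s) = -F_T(s - d) / (s - d)` (`scalingZeta_mul_generatorZeta`). For a single generator
this is the layer cake formula, with the Steiner-like expansion put in for `V_G`; and
`F_T(u) = ∑ r_n^{d+u} F_G(u)`, since within a tile the boundary of `T` is as far away as the
boundary of that tile.

Therefore `V_T(ε) - vol(T) = -vol {x ∈ T : δ(x) > ε}` is recovered from the zeta function by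
Perron's formula. On a line `Re s = c` to the right of `d` and of the screen, the truncated
integrals of `ε^{d-s} ζ_η(s) M(s)` are integrals over `x ∈ T` of truncated Perron integrals at
`log(δ(x) / ε)`. These are bounded uniformly as long as `ε` stays away from `0`, and they converge
except where `δ(x) = ε`, which is a null set (`volume_level_set_eq_zero`). Hence dominated
convergence applies, for fixed `ε` (`tendsto_integral_distanceZeta_div`) and after pairing with a
test function (`tendsto_integral_powerPairing_mul`). The heights `τ_n` and `τ_{-n}` are only
asymptotically symmetric, which changes a Perron integral by `O(|log(τ_n / |τ_{-n}|)|) = o(1)`.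

The line is then pushed to the screen by the residue theorem on the region between the screen, a
vertical line and two horizontal lines (`screenRegionIntegral_eq_sum_residueAt`). The screen is
only Lipschitz, so the theorem is proved by subtracting principal parts and using primitives along
absolutely continuous curves. Languidity kills the horizontal sides and makes the integral along
the screen converge; there are no poles on the horizontal sides because the function is bounded
along them. The residue at `d` is `-vol(T)`, which turns `V_T(ε) - vol(T)` into `V_T(ε)`; the other
residues are those at the complex dimensions. The pointwise and the distributional formula are the
same statement (`IsTubeZeta.tendsto_sum_residueAt`) for the entire weights `E(s) = ε^{d-s}` and
`E(s) = ⟨ε^{d-s}, φ⟩`. The second decays faster than any power of `Im s` on vertical strips, by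
integration by parts, and so no condition on `β` is needed.

If the coefficients `κ_k` are piecewise constant, they are constant near `0`, and what remains of
each of the integrals in `M` is an integral over a compact subset of `(0, ∞)`, an entire function
of `s`. So `M` agrees on the connected window with a function whose poles are among `0, …, d`
(`IsPluriphase.pole_eq_natCast`).
-/


/-! ### Line integrals along Lipschitz curves -/

/-- Fundamental theorem of calculus for complex-valued Lipschitz functions, which are only
differentiable almost everywhere. -/
lemma LipschitzOnWith.integral_eq_sub {g g' : ℝ → ℂ} {a b : ℝ} {K : NNReal}
    (hg : LipschitzOnWith K g (uIcc a b))
    (hd : ∀ᵐ t, t ∈ uIcc a b → HasDerivAt g (g' t) t) :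
    IntervalIntegrable g' volume a b ∧ ∫ t in a..b, g' t = g b - g a := by
  have hre : AbsolutelyContinuousOnInterval (fun t => (g t).re) a b :=
    (LipschitzOnWith.absolutelyContinuousOnInterval (K := K) (by
      intro x hx y hy
      refine le_trans ?_ (hg hx hy)
      rw [edist_dist, edist_dist, dist_eq_norm, dist_eq_norm, ← Complex.sub_re]
      exact ENNReal.ofReal_le_ofReal (Complex.abs_re_le_norm _)))
  have him : AbsolutelyContinuousOnInterval (fun t => (g t).im) a b :=
    (LipschitzOnWith.absolutelyContinuousOnInterval (K := K) (by
      intro x hx y hy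
      refine le_trans ?_ (hg hx hy)
      rw [edist_dist, edist_dist, dist_eq_norm, dist_eq_norm, ← Complex.sub_im]
      exact ENNReal.ofReal_le_ofReal (Complex.abs_im_le_norm _)))
  have e : ∀ᵐ t, t ∈ uIoc a b →
      ((deriv (fun t => (g t).re) t : ℝ) : ℂ) + (deriv (fun t => (g t).im) t : ℝ) * Complex.I
        = g' t := by
    filter_upwards [hd] with t ht hmem
    have h := ht (uIoc_subset_uIcc hmem)
    have h1 : HasDerivAt (fun t => (g t).re) (g' t).re t := by
      exact Complex.reCLM.hasFDerivAt.comp_hasDerivAt t h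
    have h2 : HasDerivAt (fun t => (g t).im) (g' t).im t := by
      exact Complex.imCLM.hasFDerivAt.comp_hasDerivAt t h
    rw [h1.deriv, h2.deriv, Complex.re_add_im]
  have ir : IntervalIntegrable (fun t => ((deriv (fun t => (g t).re) t : ℝ) : ℂ)) volume a b :=
    ⟨hre.intervalIntegrable_deriv.1.ofReal, hre.intervalIntegrable_deriv.2.ofReal⟩
  have ii : IntervalIntegrable (fun t => ((deriv (fun t => (g t).im) t : ℝ) : ℂ) * Complex.I)
      volume a b :=
    IntervalIntegrable.mul_const
      ⟨him.intervalIntegrable_deriv.1.ofReal, him.intervalIntegrable_deriv.2.ofReal⟩ _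
  constructor
  · exact (ir.add ii).congr_ae (by
      rw [Filter.EventuallyEq, ae_restrict_iff' measurableSet_uIoc]; exact e)
  · rw [← intervalIntegral.integral_congr_ae e, intervalIntegral.integral_add ir ii,
      intervalIntegral.integral_mul_const, intervalIntegral.integral_ofReal,
      intervalIntegral.integral_ofReal, hre.integral_deriv_eq_sub, him.integral_deriv_eq_sub]
    apply Complex.ext <;> simp

/-- A function with primitive `P` integrates along a Lipschitz curve to the difference of the values
of `P` at the end points. -/
lemma integral_deriv_comp_lipschitz {P p : ℂ → ℂ} {γ γ' : ℝ → ℂ} {a b : ℝ} {K : NNReal}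
    (hγ : LipschitzWith K γ) (hγ' : ∀ᵐ t, HasDerivAt γ (γ' t) t)
    (hP : ∀ t ∈ uIcc a b, HasStrictDerivAt P (p (γ t)) (γ t)) :
    IntervalIntegrable (fun t => p (γ t) * γ' t) volume a b ∧
      ∫ t in a..b, p (γ t) * γ' t = P (γ b) - P (γ a) := by
  have hloc : LocallyLipschitzOn (uIcc a b) (P ∘ γ) := by
    intro t ht
    obtain ⟨C, s, hs, hC⟩ := (hP t ht).hasStrictFDerivAt.exists_lipschitzOnWith
    refine ⟨C * K, γ ⁻¹' s, mem_nhdsWithin_of_mem_nhds (hγ.continuous.continuousAt hs), ?_⟩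
    exact hC.comp hγ.lipschitzOnWith (fun x hx => hx)
  obtain ⟨C, hC⟩ := hloc.exists_lipschitzOnWith_of_compact isCompact_uIcc
  refine hC.integral_eq_sub ?_
  filter_upwards [hγ'] with t ht hmem
  have := (hP t hmem).hasDerivAt.scomp t ht
  simpa [mul_comm] using this

/-! ### Boundary integrals of regions with a Lipschitz left side -/

/-- The region `f(Im s) ≤ Re s ≤ c`, `a ≤ Im s ≤ b` between the screen and a vertical line. -/
def screenRegion (f : ℝ → ℝ) (c a b : ℝ) : Set ℂ :=
  {s | a ≤ s.im ∧ s.im ≤ b ∧ f s.im ≤ s.re ∧ s.re ≤ c}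

/-- The boundary of `screenRegion f c a b`. -/
def screenRegionBoundary (f : ℝ → ℝ) (c a b : ℝ) : Set ℂ :=
  {s | s ∈ screenRegion f c a b ∧ (s.im = a ∨ s.im = b ∨ s.re = c ∨ s.re = f s.im)}

/-- `F` is integrable along the four sides of `screenRegion f c a b`. -/
structure ScreenRegionIntegrable (f : ℝ → ℝ) (c a b : ℝ) (F : ℂ → ℂ) : Prop where
  bottom : IntervalIntegrable (fun σ : ℝ => F (σ + a * Complex.I)) volume (f a) c
  right : IntervalIntegrable (fun t : ℝ => F (c + t * Complex.I)) volume a b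
  top : IntervalIntegrable (fun σ : ℝ => F (σ + b * Complex.I)) volume (f b) c
  left : IntervalIntegrable (screenIntegrand f F) volume a b

/-- The integral of `F` along the boundary of `screenRegion f c a b`, counterclockwise. -/
noncomputable def screenRegionIntegral (f : ℝ → ℝ) (c a b : ℝ) (F : ℂ → ℂ) : ℂ :=
  (∫ σ in (f a)..c, F (σ + a * Complex.I)) + Complex.I * (∫ t in a..b, F (c + t * Complex.I))
    - (∫ σ in (f b)..c, F (σ + b * Complex.I)) - ∫ t in a..b, screenIntegrand f F t

section ScreenRegion

variable {f : ℝ → ℝ} {c a b : ℝ} {K : NNReal}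

lemma screenPoint_re (t : ℝ) : (screenPoint f t).re = f t := by simp [screenPoint]
lemma screenPoint_im (t : ℝ) : (screenPoint f t).im = t := by simp [screenPoint]

lemma bottom_mem_boundary (hab : a ≤ b) (hfc : ∀ t, f t ≤ c) {σ : ℝ} (hσ : σ ∈ uIcc (f a) c) :
    (σ + a * Complex.I : ℂ) ∈ screenRegionBoundary f c a b := by
  rw [uIcc_of_le (hfc a)] at hσ
  simp [screenRegionBoundary, screenRegion, hab, hσ.1, hσ.2]

lemma top_mem_boundary (hab : a ≤ b) (hfc : ∀ t, f t ≤ c) {σ : ℝ} (hσ : σ ∈ uIcc (f b) c) :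
    (σ + b * Complex.I : ℂ) ∈ screenRegionBoundary f c a b := by
  rw [uIcc_of_le (hfc b)] at hσ
  simp [screenRegionBoundary, screenRegion, hab, hσ.1, hσ.2]

lemma right_mem_boundary (hab : a ≤ b) (hfc : ∀ t, f t ≤ c) {t : ℝ} (ht : t ∈ uIcc a b) :
    (c + t * Complex.I : ℂ) ∈ screenRegionBoundary f c a b := by
  rw [uIcc_of_le hab] at ht
  simp [screenRegionBoundary, screenRegion, hfc, ht.1, ht.2]

lemma left_mem_boundary (hab : a ≤ b) (hfc : ∀ t, f t ≤ c) {t : ℝ} (ht : t ∈ uIcc a b) :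
    screenPoint f t ∈ screenRegionBoundary f c a b := by
  rw [uIcc_of_le hab] at ht
  simp [screenRegionBoundary, screenRegion, screenPoint_re, screenPoint_im, hfc, ht.1, ht.2]

lemma lipschitzWith_horizontal (y : ℝ) :
    LipschitzWith 1 (fun σ : ℝ => (σ + y * Complex.I : ℂ)) :=
  LipschitzWith.of_dist_le_mul fun x x' => by
    rw [dist_add_right, Complex.dist_eq, ← Complex.ofReal_sub, Complex.norm_real,
      Real.dist_eq, Real.norm_eq_abs]
    simp

lemma lipschitzWith_vertical (x : ℝ) :
    LipschitzWith 1 (fun t : ℝ => (x + t * Complex.I : ℂ)) :=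
  LipschitzWith.of_dist_le_mul fun y y' => by
    rw [dist_add_left, Complex.dist_eq, ← sub_mul, ← Complex.ofReal_sub, norm_mul,
      Complex.norm_real, Real.dist_eq, Real.norm_eq_abs]
    simp

lemma lipschitzWith_screenPoint (hf : LipschitzWith K f) :
    LipschitzWith (K + 1) (screenPoint f) :=
  LipschitzWith.of_dist_le_mul fun y y' => by
    have h := hf.dist_le_mul y y'
    calc dist (screenPoint f y) (screenPoint f y')
        ≤ dist (f y : ℂ) (f y') + dist (y * Complex.I) (y' * Complex.I) := dist_add_add_le _ _ _ _
      _ ≤ K * dist y y' + dist y y' := by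
          gcongr
          · rw [Complex.dist_eq, ← Complex.ofReal_sub, Complex.norm_real]; exact h
          · rw [Complex.dist_eq, ← sub_mul, ← Complex.ofReal_sub, norm_mul,
              Complex.norm_real, Real.dist_eq, Real.norm_eq_abs]
            simp
      _ = _ := by push_cast; ring

lemma hasDerivAt_horizontal (y t : ℝ) :
    HasDerivAt (fun σ : ℝ => (σ + y * Complex.I : ℂ)) 1 t := by
  simpa using (Complex.ofRealCLM.hasDerivAt (x := t)).add_const (y * Complex.I)

lemma hasDerivAt_vertical (x t : ℝ) :
    HasDerivAt (fun t : ℝ => (x + t * Complex.I : ℂ)) Complex.I t := by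
  simpa using ((Complex.ofRealCLM.hasDerivAt (x := t)).mul_const Complex.I).const_add (x : ℂ)

lemma hasDerivAt_screenPoint (hf : LipschitzWith K f) :
    ∀ᵐ t, HasDerivAt (screenPoint f) ((deriv f t : ℝ) + Complex.I) t := by
  filter_upwards [hf.ae_differentiableAt_real] with t ht
  have := ht.hasDerivAt.ofReal_comp.add
    ((Complex.ofRealCLM.hasDerivAt (x := t)).mul_const Complex.I)
  simp at this
  exact this

lemma integral_horizontal_of_hasDerivAt {P p : ℂ → ℂ} {x₁ x₂ y : ℝ}
    (hP : ∀ σ ∈ uIcc x₁ x₂, HasStrictDerivAt P (p (σ + y * Complex.I)) (σ + y * Complex.I)) :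
    IntervalIntegrable (fun σ : ℝ => p (σ + y * Complex.I)) volume x₁ x₂ ∧
      ∫ σ in x₁..x₂, p (σ + y * Complex.I) = P (x₂ + y * Complex.I) - P (x₁ + y * Complex.I) := by
  simpa using integral_deriv_comp_lipschitz (γ' := fun _ => 1) (lipschitzWith_horizontal y)
    (Eventually.of_forall (hasDerivAt_horizontal y)) hP

lemma integral_vertical_of_hasDerivAt {P p : ℂ → ℂ} {x y₁ y₂ : ℝ}
    (hP : ∀ t ∈ uIcc y₁ y₂, HasStrictDerivAt P (p (x + t * Complex.I)) (x + t * Complex.I)) :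
    IntervalIntegrable (fun t : ℝ => p (x + t * Complex.I)) volume y₁ y₂ ∧
      Complex.I * ∫ t in y₁..y₂, p (x + t * Complex.I)
        = P (x + y₂ * Complex.I) - P (x + y₁ * Complex.I) := by
  obtain ⟨h1, h2⟩ := integral_deriv_comp_lipschitz (γ' := fun _ => Complex.I)
    (lipschitzWith_vertical x) (Eventually.of_forall (hasDerivAt_vertical x)) hP
  rw [← h2, intervalIntegral.integral_mul_const, mul_comm]
  refine ⟨?_, rfl⟩
  have := h1.mul_const (-Complex.I)
  simpa [mul_assoc] using this

lemma integral_screen_of_hasDerivAt (hf : LipschitzWith K f) {P p : ℂ → ℂ} {y₁ y₂ : ℝ}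
    (hP : ∀ t ∈ uIcc y₁ y₂, HasStrictDerivAt P (p (screenPoint f t)) (screenPoint f t)) :
    IntervalIntegrable (screenIntegrand f p) volume y₁ y₂ ∧
      ∫ t in y₁..y₂, screenIntegrand f p t = P (screenPoint f y₂) - P (screenPoint f y₁) :=
  integral_deriv_comp_lipschitz (lipschitzWith_screenPoint hf) (hasDerivAt_screenPoint hf) hP

lemma screenRegionIntegral_of_primitive (hf : LipschitzWith K f) (hab : a ≤ b)
    (hfc : ∀ t, f t ≤ c) {P p : ℂ → ℂ}
    (hP : ∀ s ∈ screenRegionBoundary f c a b, HasStrictDerivAt P (p s) s) :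
    ScreenRegionIntegrable f c a b p ∧ screenRegionIntegral f c a b p = 0 := by
  obtain ⟨i1, e1⟩ := integral_horizontal_of_hasDerivAt (p := p) (P := P)
    (fun σ hσ => hP _ (bottom_mem_boundary (a := a) hab hfc hσ))
  obtain ⟨i2, e2⟩ := integral_vertical_of_hasDerivAt (p := p) (P := P)
    (fun σ hσ => hP _ (right_mem_boundary hab hfc hσ))
  obtain ⟨i3, e3⟩ := integral_horizontal_of_hasDerivAt (p := p) (P := P)
    (fun σ hσ => hP _ (top_mem_boundary (b := b) hab hfc hσ))
  obtain ⟨i4, e4⟩ := integral_screen_of_hasDerivAt hf (p := p) (P := P)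
    (fun σ hσ => hP _ (left_mem_boundary hab hfc hσ))
  refine ⟨⟨i1, i2, i3, i4⟩, ?_⟩
  rw [screenRegionIntegral, e1, e2, e3, e4, screenPoint, screenPoint]
  ring

lemma ScreenRegionIntegrable.add {F G : ℂ → ℂ} (hF : ScreenRegionIntegrable f c a b F)
    (hG : ScreenRegionIntegrable f c a b G) :
    ScreenRegionIntegrable f c a b (fun s => F s + G s) where
  bottom := hF.bottom.add hG.bottom
  right := hF.right.add hG.right
  top := hF.top.add hG.top
  left := by
    have := hF.left.add hG.left
    refine this.congr_ae (Eventually.of_forall fun t => ?_)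
    simp [screenIntegrand, add_mul]

lemma screenRegionIntegral_add {F G : ℂ → ℂ} (hF : ScreenRegionIntegrable f c a b F)
    (hG : ScreenRegionIntegrable f c a b G) :
    screenRegionIntegral f c a b (fun s => F s + G s) =
      screenRegionIntegral f c a b F + screenRegionIntegral f c a b G := by
  have h : screenIntegrand f (fun s => F s + G s) =
      fun t => screenIntegrand f F t + screenIntegrand f G t := by
    funext t; simp [screenIntegrand, add_mul]
  rw [screenRegionIntegral, screenRegionIntegral, screenRegionIntegral, h,
    intervalIntegral.integral_add hF.bottom hG.bottom,
    intervalIntegral.integral_add hF.right hG.right,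
    intervalIntegral.integral_add hF.top hG.top,
    intervalIntegral.integral_add hF.left hG.left]
  ring

lemma ScreenRegionIntegrable.const_mul {F : ℂ → ℂ} (hF : ScreenRegionIntegrable f c a b F)
    (k : ℂ) : ScreenRegionIntegrable f c a b (fun s => k * F s) where
  bottom := hF.bottom.const_mul k
  right := hF.right.const_mul k
  top := hF.top.const_mul k
  left := by
    have := hF.left.const_mul k
    refine this.congr_ae (Eventually.of_forall fun t => ?_)
    simp [screenIntegrand, mul_assoc]

lemma screenRegionIntegral_const_mul (F : ℂ → ℂ) (k : ℂ) :
    screenRegionIntegral f c a b (fun s => k * F s) = k * screenRegionIntegral f c a b F := by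
  have h : screenIntegrand f (fun s => k * F s) = fun t => k * screenIntegrand f F t := by
    funext t; simp [screenIntegrand, mul_assoc]
  rw [screenRegionIntegral, screenRegionIntegral, h]
  simp only [intervalIntegral.integral_const_mul]
  ring

/-- Changing a function at finitely many points does not affect its boundary integral. -/
lemma screenRegionIntegral_congr_finite (hab : a ≤ b) (hfc : ∀ t, f t ≤ c) {F G : ℂ → ℂ}
    {S : Set ℂ} (hS : S.Finite)
    (hFG : ∀ s ∈ screenRegionBoundary f c a b, s ∉ S → F s = G s)
    (hF : ScreenRegionIntegrable f c a b F) :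
    ScreenRegionIntegrable f c a b G ∧
      screenRegionIntegral f c a b G = screenRegionIntegral f c a b F := by
  have null : ∀ γ : ℝ → ℂ, Function.Injective γ → ∀ᵐ t, γ t ∉ S := fun γ hγ =>
    (Set.Finite.preimage hγ.injOn hS).countable.ae_notMem volume
  have h1 : ∀ y : ℝ, Function.Injective fun σ : ℝ => (σ + y * Complex.I : ℂ) := fun y σ σ' h => by
    simpa using h
  have h2 : Function.Injective fun t : ℝ => (c + t * Complex.I : ℂ) := fun y σ h => by
    simpa using h
  have h3 : Function.Injective (screenPoint f) := fun y y' h => by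
    simpa [screenPoint_im] using congrArg Complex.im h
  have e1 : ∀ᵐ σ : ℝ, σ ∈ uIoc (f a) c → F (σ + a * Complex.I) = G (σ + a * Complex.I) := by
    filter_upwards [null _ (h1 a)] with t ht hm
    exact hFG _ (bottom_mem_boundary hab hfc (uIoc_subset_uIcc hm)) ht
  have e3 : ∀ᵐ σ : ℝ, σ ∈ uIoc (f b) c → F (σ + b * Complex.I) = G (σ + b * Complex.I) := by
    filter_upwards [null _ (h1 b)] with t ht hm
    exact hFG _ (top_mem_boundary hab hfc (uIoc_subset_uIcc hm)) ht
  have e2 : ∀ᵐ t : ℝ, t ∈ uIoc a b → F (c + t * Complex.I) = G (c + t * Complex.I) := by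
    filter_upwards [null _ h2] with t ht hm
    exact hFG _ (right_mem_boundary hab hfc (uIoc_subset_uIcc hm)) ht
  have e4 : ∀ᵐ t : ℝ, t ∈ uIoc a b → screenIntegrand f F t = screenIntegrand f G t := by
    filter_upwards [null _ h3] with t ht hm
    rw [screenIntegrand, screenIntegrand,
      hFG _ (left_mem_boundary hab hfc (uIoc_subset_uIcc hm)) ht]
  have conv : ∀ {u v : ℝ → ℂ} {x y : ℝ}, (∀ᵐ t : ℝ, t ∈ uIoc x y → u t = v t) →
      u =ᵐ[volume.restrict (uIoc x y)] v := fun h => by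
    rw [Filter.EventuallyEq, ae_restrict_iff' measurableSet_uIoc]; exact h
  refine ⟨⟨hF.bottom.congr_ae (conv e1), hF.right.congr_ae (conv e2), hF.top.congr_ae (conv e3),
    hF.left.congr_ae (conv e4)⟩, ?_⟩
  rw [screenRegionIntegral, screenRegionIntegral, intervalIntegral.integral_congr_ae e1,
    intervalIntegral.integral_congr_ae e2, intervalIntegral.integral_congr_ae e3,
    intervalIntegral.integral_congr_ae e4]

/-- Cauchy's theorem: a primitive on the region is obtained by integrating along the vertical side
and then along a horizontal segment. -/
lemma screenRegionIntegral_of_analytic (hf : LipschitzWith K f) (hab : a ≤ b)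
    (hfc : ∀ t, f t ≤ c) {H : ℂ → ℂ} (hH : ∀ s ∈ screenRegion f c a b, AnalyticAt ℂ H s) :
    ScreenRegionIntegrable f c a b H ∧ screenRegionIntegral f c a b H = 0 := by
  set P : ℂ → ℂ := fun z => Complex.I * (∫ y in a..z.im, H (c + y * Complex.I)) -
    ∫ x in z.re..c, H (x + z.im * Complex.I) with hPdef
  refine screenRegionIntegral_of_primitive hf hab hfc (P := P) fun z hz => ?_
  have hz := hz.1
  set V : Set ℂ := {s | AnalyticAt ℂ H s} with hV
  have hVo : IsOpen V := isOpen_analyticAt ℂ H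
  set seg : Set ℂ := (fun x : ℝ => (x + z.im * Complex.I : ℂ)) '' Icc z.re c with hseg
  have hsegc : IsCompact seg :=
    isCompact_Icc.image (lipschitzWith_horizontal z.im).continuous
  have hsegV : seg ⊆ V := by
    rintro _ ⟨x, hx, rfl⟩
    refine hH _ ⟨?_, ?_, ?_, ?_⟩ <;> simp [hz.1, hz.2.1, hx.2, hz.2.2.1.trans hx.1]
  obtain ⟨δ, hδ, hδV⟩ := hsegc.exists_thickening_subset_open hVo hsegV
  have hpt : ∀ x y : ℝ, x ∈ Icc z.re c → |y - z.im| < δ → (x + y * Complex.I : ℂ) ∈ V := by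
    intro x y hx hy
    refine hδV (Metric.mem_thickening_iff.2 ⟨_, mem_image_of_mem _ hx, ?_⟩)
    rw [dist_add_left, Complex.dist_eq, ← sub_mul, ← Complex.ofReal_sub, norm_mul,
      Complex.norm_real]
    simpa using hy
  have hzseg : z ∈ seg := ⟨z.re, ⟨le_rfl, hz.2.2.2⟩, Complex.re_add_im z⟩
  have hball : Metric.ball z δ ⊆ V := fun w hw =>
    hδV (Metric.mem_thickening_iff.2 ⟨z, hzseg, hw⟩)
  obtain ⟨p, hp⟩ := DifferentiableOn.isExactOn_ball (c := z) (r := δ) (f := H)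
    (fun s hs => (hball hs).differentiableAt.differentiableWithinAt)
  have hps : ∀ s ∈ Metric.ball z δ, HasStrictDerivAt p (H s) s := fun s hs =>
    hasStrictDerivAt_of_hasDerivAt_of_continuousAt
      (Filter.eventually_of_mem (Metric.isOpen_ball.mem_nhds hs) hp) (hball hs).continuousAt
  -- Near `z`, the function `P` differs by a constant from a primitive `p` on a disc, by Cauchy's
  -- theorem for the rectangle between the horizontal lines through `z` and `w`.
  have key : ∀ w ∈ Metric.ball z δ, P w = P z + (p w - p z) := by
    intro w hw
    have hwim : |w.im - z.im| < δ := by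
      have := Complex.abs_im_le_norm (w - z)
      rw [Metric.mem_ball, dist_eq_norm] at hw
      simpa using this.trans_lt hw
    have hyim : ∀ y ∈ uIcc z.im w.im, |y - z.im| < δ := fun y hy =>
      (abs_sub_left_of_mem_uIcc hy).trans_lt hwim
    set q : ℂ := z.re + w.im * Complex.I with hq
    have hqb : q ∈ Metric.ball z δ := by
      rw [Metric.mem_ball, Complex.dist_eq]
      have : q - z = (w.im - z.im : ℝ) * Complex.I := by
        apply Complex.ext <;> simp [hq]
      rw [this, norm_mul, Complex.norm_real]
      simpa using hwim
    have iv1 : IntervalIntegrable (fun y : ℝ => H (c + y * Complex.I)) volume a z.im := by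
      refine ContinuousOn.intervalIntegrable fun y hy => ?_
      rw [uIcc_of_le hz.1] at hy
      have : AnalyticAt ℂ H (c + y * Complex.I) := by
        refine hH _ ⟨?_, ?_, ?_, ?_⟩ <;> simp [hy.1, hy.2.trans hz.2.1, hfc]
      exact (ContinuousAt.comp (x := y) (g := H) (f := fun t : ℝ => (c + t * Complex.I : ℂ))
        this.continuousAt (lipschitzWith_vertical c).continuous.continuousAt).continuousWithinAt
    have iv2 : IntervalIntegrable (fun y : ℝ => H (c + y * Complex.I)) volume z.im w.im := by
      refine ContinuousOn.intervalIntegrable fun y hy => ?_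
      have : AnalyticAt ℂ H (c + y * Complex.I) := hpt c y ⟨hz.2.2.2, le_rfl⟩ (hyim y hy)
      exact (ContinuousAt.comp (x := y) (g := H) (f := fun t : ℝ => (c + t * Complex.I : ℂ))
        this.continuousAt (lipschitzWith_vertical c).continuous.continuousAt).continuousWithinAt
    -- the horizontal segment from `q` to `w` and the vertical one from `z` to `q`
    have hor := integral_horizontal_of_hasDerivAt (P := p) (p := H) (x₁ := z.re) (x₂ := w.re)
      (y := w.im) (fun x hx => hps _ (by
        have : (x + w.im * Complex.I : ℂ) ∈ segment ℝ q w := by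
          rw [← segment_eq_uIcc] at hx
          obtain ⟨u, v, hu, hv, huv, rfl⟩ := hx
          refine ⟨u, v, hu, hv, huv, ?_⟩
          apply Complex.ext
          · simp [hq]
          · simp [hq, ← add_mul, huv]
        exact (convex_ball z δ).segment_subset hqb hw this))
    have ver := integral_vertical_of_hasDerivAt (P := p) (p := H) (x := z.re) (y₁ := z.im)
      (y₂ := w.im) (fun y hy => hps _ (by
        rw [Metric.mem_ball, Complex.dist_eq]
        have : (z.re + y * Complex.I : ℂ) - z = (y - z.im : ℝ) * Complex.I := by
          apply Complex.ext <;> simp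
        rw [this, norm_mul, Complex.norm_real]
        simpa using hyim y hy))
    have ih : IntervalIntegrable (fun x : ℝ => H (x + w.im * Complex.I)) volume z.re c := by
      refine ContinuousOn.intervalIntegrable fun x hx => ?_
      rw [uIcc_of_le hz.2.2.2] at hx
      have : AnalyticAt ℂ H (x + w.im * Complex.I) := hpt x w.im hx hwim
      exact (ContinuousAt.comp (x := x) (g := H) (f := fun t : ℝ => (t + w.im * Complex.I : ℂ))
        this.continuousAt (lipschitzWith_horizontal w.im).continuous.continuousAt).continuousWithinAt
    have rect := Complex.integral_boundary_rect_eq_zero_of_differentiableOn H z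
      (c + w.im * Complex.I) (by
        intro s hs
        rw [Complex.mem_reProdIm] at hs
        simp only [Complex.add_re, Complex.ofReal_re, Complex.mul_re, Complex.I_re, mul_zero,
          Complex.ofReal_im, Complex.I_im, mul_one, sub_self, add_zero, Complex.add_im,
          Complex.mul_im, zero_add, uIcc_of_le hz.2.2.2] at hs
        have := hpt s.re s.im hs.1 (hyim _ hs.2)
        rw [Complex.re_add_im] at this
        exact AnalyticAt.differentiableAt this |>.differentiableWithinAt)
    simp only [Complex.add_re, Complex.ofReal_re, Complex.mul_re, Complex.I_re, mul_zero,
      Complex.ofReal_im, Complex.I_im, mul_one, sub_self, add_zero, Complex.add_im,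
      Complex.mul_im, zero_add, smul_eq_mul] at rect
    have hsplit := intervalIntegral.integral_add_adjacent_intervals iv1 iv2
    have hsplit2 := intervalIntegral.integral_add_adjacent_intervals hor.1
      (hor.1.symm.trans ih)
    have e1 := hor.2
    have e2 := ver.2
    simp only [Complex.re_add_im] at e1 e2
    simp only [hPdef, ← hsplit]
    linear_combination rect - hsplit2 + e1 + e2
  have : HasStrictDerivAt (fun w => P z + (p w - p z)) (H z) z :=
    ((hps z (Metric.mem_ball_self hδ)).sub_const _).const_add _
  refine this.congr_of_eventuallyEq ?_
  filter_upwards [Metric.ball_mem_nhds z hδ] with w hw using (key w hw).symm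

/-- The winding number of the boundary around an interior point is `1`. -/
lemma screenRegionIntegral_inv (hf : LipschitzWith K f) {w : ℂ}
    (ha : a < w.im) (hb : w.im < b) (hfw : f w.im < w.re) (hwc : w.re < c) :
    ScreenRegionIntegrable f c a b (fun s => (s - w)⁻¹) ∧
      screenRegionIntegral f c a b (fun s => (s - w)⁻¹) = 2 * Real.pi * Complex.I := by
  -- On the screen, use the branch of the logarithm with cut to the right of `w`; on the other
  -- three sides, the one with cut to the left of `w`.
  have hlog : ∀ s : ℂ, s - w ∈ Complex.slitPlane →
      HasStrictDerivAt (fun s => Complex.log (s - w)) ((s - w)⁻¹) s := fun s hs => by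
    have h : HasStrictDerivAt (fun s => s - w) 1 s := (hasStrictDerivAt_id s).sub_const w
    simpa using HasStrictDerivAt.clog h hs
  have hlog' : ∀ s : ℂ, w - s ∈ Complex.slitPlane →
      HasStrictDerivAt (fun s => Complex.log (w - s)) ((s - w)⁻¹) s := fun s hs => by
    have h : HasStrictDerivAt (fun s => w - s) (-1) s := (hasStrictDerivAt_id s).const_sub w
    have := HasStrictDerivAt.clog h hs
    rwa [neg_div, ← div_neg, neg_sub, one_div] at this
  obtain ⟨i1, e1⟩ := integral_horizontal_of_hasDerivAt (p := fun s => (s - w)⁻¹)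
    (x₁ := f a) (x₂ := c) (y := a)
    (fun σ _ => hlog (σ + a * Complex.I) (Or.inr (by simpa [sub_eq_zero] using ha.ne)))
  obtain ⟨i2, e2⟩ := integral_vertical_of_hasDerivAt (p := fun s => (s - w)⁻¹)
    (x := c) (y₁ := a) (y₂ := b)
    (fun t _ => hlog (c + t * Complex.I) (Or.inl (by simpa using hwc)))
  obtain ⟨i3, e3⟩ := integral_horizontal_of_hasDerivAt (p := fun s => (s - w)⁻¹)
    (x₁ := f b) (x₂ := c) (y := b)
    (fun σ _ => hlog (σ + b * Complex.I) (Or.inr (by simpa [sub_eq_zero] using hb.ne')))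
  obtain ⟨i4, e4⟩ := integral_screen_of_hasDerivAt (p := fun s => (s - w)⁻¹) hf (y₁ := a) (y₂ := b)
    (fun t _ => hlog' (screenPoint f t) (by
      by_cases h : t = w.im
      · left; simp [screenPoint_re, h, hfw]
      · right; simpa [screenPoint_im, sub_eq_zero] using Ne.symm h))
  refine ⟨⟨i1, i2, i3, i4⟩, ?_⟩
  rw [screenRegionIntegral, e1, e2, e3, e4]
  have l1 : Complex.log (f b + b * Complex.I - w) - Complex.log (w - screenPoint f b)
      = Real.pi * Complex.I := by
    have : (0 : ℝ) < (f b + b * Complex.I - w : ℂ).im := by simpa using hb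
    rw [← neg_sub (screenPoint f b) w, screenPoint, Complex.log, Complex.log, norm_neg,
      Complex.arg_neg_eq_arg_sub_pi_of_im_pos this]
    push_cast; ring
  have l2 : Complex.log (f a + a * Complex.I - w) - Complex.log (w - screenPoint f a)
      = - (Real.pi * Complex.I) := by
    have : (f a + a * Complex.I - w : ℂ).im < 0 := by simpa using ha
    rw [← neg_sub (screenPoint f a) w, screenPoint, Complex.log, Complex.log, norm_neg,
      Complex.arg_neg_eq_arg_add_pi_of_im_neg this]
    push_cast; ring
  linear_combination l1 - l2

lemma screenRegionIntegral_inv_pow (hf : LipschitzWith K f) (hab : a ≤ b) (hfc : ∀ t, f t ≤ c)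
    {w : ℂ} (hw : w ∉ screenRegionBoundary f c a b) (n : ℕ) :
    ScreenRegionIntegrable f c a b (fun s => ((s - w) ^ (n + 2))⁻¹) ∧
      screenRegionIntegral f c a b (fun s => ((s - w) ^ (n + 2))⁻¹) = 0 := by
  refine screenRegionIntegral_of_primitive hf hab hfc
    (P := fun s => -((n : ℂ) + 1)⁻¹ * ((s - w) ^ (n + 1))⁻¹) fun s hs => ?_
  have hsw : s - w ≠ 0 := fun h => hw (by rw [← sub_eq_zero.1 h]; exact hs)
  have h0 : HasStrictDerivAt (fun s => s - w) 1 s := (hasStrictDerivAt_id s).sub_const w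
  have h := HasStrictDerivAt.comp (h := fun s => (s - w) ^ (n + 1)) (h₂ := fun z => z⁻¹) s
    (hasStrictDerivAt_inv (pow_ne_zero (n + 1) hsw))
    (HasStrictDerivAt.fun_pow h0 (n + 1))
  refine HasStrictDerivAt.congr_deriv (HasStrictDerivAt.const_mul (-((n : ℂ) + 1)⁻¹) h) ?_
  have hn : (n : ℂ) + 1 ≠ 0 := by exact_mod_cast n.succ_ne_zero
  push_cast
  field_simp
  ring

end ScreenRegion

/-! ### Poles and residues of meromorphic functions -/

lemma hasPole_iff_meromorphicOrderAt_neg {F : ℂ → ℂ} {w : ℂ} (hF : MeromorphicAt F w) :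
    HasPole F w ↔ meromorphicOrderAt F w < 0 := by
  rw [← tendsto_cobounded_iff_meromorphicOrderAt_neg hF, HasPole, tendsto_norm_atTop_iff_cobounded]

/-- A meromorphic function that stays bounded along a filter approaching `w` has no pole there. -/
lemma meromorphicOrderAt_nonneg_of_bounded {F : ℂ → ℂ} {w : ℂ} (hF : MeromorphicAt F w)
    {l : Filter ℂ} [l.NeBot] (hl : l ≤ 𝓝[≠] w) {B : ℝ} (hB : ∀ᶠ s in l, ‖F s‖ ≤ B) :
    0 ≤ meromorphicOrderAt F w := by
  by_contra h
  rw [not_le, ← hasPole_iff_meromorphicOrderAt_neg hF] at h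
  obtain ⟨s, h1, h2⟩ := (hB.and ((h.mono_left hl).eventually_gt_atTop B)).exists
  exact absurd h1 (not_le.2 h2)

lemma meromorphicOrderAt_sub_nonneg {F G : ℂ → ℂ} {w : ℂ} (hF : MeromorphicAt F w)
    (hG : MeromorphicAt G w) (h1 : 0 ≤ meromorphicOrderAt F w) (h2 : 0 ≤ meromorphicOrderAt G w) :
    0 ≤ meromorphicOrderAt (fun s => F s - G s) w := by
  obtain ⟨x, hx⟩ := tendsto_nhds_of_meromorphicOrderAt_nonneg hF h1
  obtain ⟨y, hy⟩ := tendsto_nhds_of_meromorphicOrderAt_nonneg hG h2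
  exact (tendsto_nhds_iff_meromorphicOrderAt_nonneg (hF.sub hG)).1 ⟨x - y, hx.sub hy⟩

lemma meromorphicOrderAt_mul_nonneg {F G : ℂ → ℂ} {w : ℂ} (hF : MeromorphicAt F w)
    (hG : MeromorphicAt G w) (h1 : 0 ≤ meromorphicOrderAt F w) (h2 : 0 ≤ meromorphicOrderAt G w) :
    0 ≤ meromorphicOrderAt (fun s => F s * G s) w := by
  obtain ⟨x, hx⟩ := tendsto_nhds_of_meromorphicOrderAt_nonneg hF h1
  obtain ⟨y, hy⟩ := tendsto_nhds_of_meromorphicOrderAt_nonneg hG h2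
  exact (tendsto_nhds_iff_meromorphicOrderAt_nonneg (hF.mul hG)).1 ⟨x * y, hx.mul hy⟩

lemma finite_poles_of_isCompact {F : ℂ → ℂ} {k : Set ℂ} (hk : IsCompact k)
    (hF : ∀ s ∈ k, MeromorphicAt F s) : {s | s ∈ k ∧ meromorphicOrderAt F s < 0}.Finite := by
  have h := hk.finite_sdiff_of_mem_codiscreteWithin
    (MeromorphicOn.analyticAt_mem_codiscreteWithin (U := k) (f := F) hF)
  refine h.subset fun s hs => ⟨hs.1, fun ha => ?_⟩
  exact absurd (AnalyticAt.meromorphicOrderAt_nonneg ha) (not_le.2 hs.2)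

lemma residueAt_eq_of_eventually {F : ℂ → ℂ} {w x : ℂ}
    (h : ∀ᶠ ρ in 𝓝[>] (0 : ℝ), (2 * Real.pi * Complex.I)⁻¹ * (∮ s in C(w, ρ), F s) = x) :
    residueAt F w = x :=
  (tendsto_const_nhds.congr' (h.mono fun _ h => h.symm)).limUnder_eq

/-- For a function differentiable in a punctured disc, the limit in the definition of the residue is
that of a constant function. -/
lemma residueAt_eq_circleIntegral {F : ℂ → ℂ} {w : ℂ} {R : ℝ} (hR : 0 < R)
    (hF : ∀ s, s ≠ w → ‖s - w‖ ≤ R → DifferentiableAt ℂ F s) :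
    residueAt F w = (2 * Real.pi * Complex.I)⁻¹ * ∮ s in C(w, R), F s := by
  refine residueAt_eq_of_eventually ?_
  filter_upwards [Ioc_mem_nhdsGT hR] with ρ hρ
  have hne : ∀ s, s ∉ Metric.ball w ρ → s ≠ w := fun s hs h =>
    hs (by rw [h]; exact Metric.mem_ball_self hρ.1)
  rw [Complex.circleIntegral_eq_of_differentiable_on_annulus_off_countable hρ.1 hρ.2
    countable_empty]
  · intro s hs
    exact (hF s (hne s hs.2) (by
      simpa [dist_eq_norm] using hs.1)).continuousAt.continuousWithinAt
  · intro s hs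
    refine hF s (hne s fun h => hs.1.2 (Metric.ball_subset_closedBall h)) ?_
    have := Metric.ball_subset_closedBall hs.1.1
    simpa [dist_eq_norm] using this

lemma exists_punctured_analytic {F : ℂ → ℂ} {w : ℂ} (hF : MeromorphicAt F w) :
    ∃ R > 0, ∀ s, s ≠ w → ‖s - w‖ ≤ R → AnalyticAt ℂ F s := by
  obtain ⟨R, hR, h⟩ := Metric.eventually_nhds_iff.1
    (eventually_nhdsWithin_iff.1 hF.eventually_analyticAt)
  refine ⟨R / 2, half_pos hR, fun s hs hsR => h ?_ hs⟩
  rw [dist_eq_norm]; linarith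

lemma circleIntegrable_of_punctured {F : ℂ → ℂ} {w : ℂ} {R ρ : ℝ}
    (hF : ∀ s, s ≠ w → ‖s - w‖ ≤ R → AnalyticAt ℂ F s) (h0 : 0 < ρ) (hρ : ρ ≤ R) :
    CircleIntegrable F w ρ := by
  refine ContinuousOn.circleIntegrable h0.le fun s hs => ?_
  have : ‖s - w‖ = ρ := by simpa using hs
  refine (hF s (fun h => ?_) (this.trans_le hρ)).continuousAt.continuousWithinAt
  rw [h, sub_self, norm_zero] at this
  exact h0.ne this

lemma eventually_circleIntegral_eq_residueAt {F : ℂ → ℂ} {w : ℂ} (hF : MeromorphicAt F w) :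
    ∀ᶠ ρ in 𝓝[>] (0 : ℝ), CircleIntegrable F w ρ ∧
      (2 * Real.pi * Complex.I)⁻¹ * (∮ s in C(w, ρ), F s) = residueAt F w := by
  obtain ⟨R, hR, h⟩ := exists_punctured_analytic hF
  filter_upwards [Ioc_mem_nhdsGT hR] with ρ hρ
  refine ⟨circleIntegrable_of_punctured h hρ.1 hρ.2, ?_⟩
  rw [residueAt_eq_circleIntegral hρ.1 fun s h1 h2 =>
    (h s h1 (h2.trans hρ.2)).differentiableAt]

lemma residueAt_add {F G : ℂ → ℂ} {w : ℂ} (hF : MeromorphicAt F w) (hG : MeromorphicAt G w) :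
    residueAt (fun s => F s + G s) w = residueAt F w + residueAt G w := by
  refine residueAt_eq_of_eventually ?_
  filter_upwards [eventually_circleIntegral_eq_residueAt hF,
    eventually_circleIntegral_eq_residueAt hG] with ρ h1 h2
  rw [← h1.2, ← h2.2, circleIntegral.integral_add h1.1 h2.1, mul_add]

lemma residueAt_congr {F G : ℂ → ℂ} {w : ℂ} (h : F =ᶠ[𝓝[≠] w] G) :
    residueAt F w = residueAt G w := by
  have : (fun ρ : ℝ => (2 * Real.pi * Complex.I)⁻¹ * ∮ s in C(w, ρ), F s) =ᶠ[𝓝[>] 0]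
      fun ρ : ℝ => (2 * Real.pi * Complex.I)⁻¹ * ∮ s in C(w, ρ), G s := by
    obtain ⟨R, hR, h⟩ := Metric.eventually_nhds_iff.1 (eventually_nhdsWithin_iff.1 h)
    filter_upwards [Ioo_mem_nhdsGT hR] with ρ hρ
    congr 1
    refine circleIntegral.integral_congr hρ.1.le fun s hs => h ?_ ?_
    · rw [Metric.mem_sphere.1 hs]; exact hρ.2
    · rintro rfl
      exact hρ.1.ne (by simpa using hs)
  rw [residueAt, residueAt, limUnder, limUnder, map_congr this]

lemma residueAt_of_analyticAt {F : ℂ → ℂ} {w : ℂ} (hF : AnalyticAt ℂ F w) :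
    residueAt F w = 0 := by
  refine residueAt_eq_of_eventually ?_
  obtain ⟨R, hR, h⟩ := Metric.eventually_nhds_iff.1 hF.eventually_analyticAt
  filter_upwards [Ioo_mem_nhdsGT hR] with ρ hρ
  rw [Complex.circleIntegral_eq_zero_of_differentiable_on_off_countable hρ.1.le countable_empty,
    mul_zero]
  · exact fun s hs => (h ((Metric.mem_closedBall.1 hs).trans_lt hρ.2)).continuousAt.continuousWithinAt
  · exact fun s hs => (h ((Metric.mem_ball.1 hs.1).trans hρ.2)).differentiableAt

lemma exists_analyticAt_of_meromorphicOrderAt_nonneg {F : ℂ → ℂ} {w : ℂ} (hF : MeromorphicAt F w)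
    (h : 0 ≤ meromorphicOrderAt F w) : ∃ G, AnalyticAt ℂ G w ∧ F =ᶠ[𝓝[≠] w] G :=
  ⟨toMeromorphicNFAt F w, (hF.meromorphicOrderAt_nonneg_iff_analyticAt_toMeromorphicNFAt).1 h,
    hF.eq_nhdsNE_toMeromorphicNFAt⟩

lemma residueAt_eq_zero {F : ℂ → ℂ} {w : ℂ} (hF : MeromorphicAt F w)
    (h : 0 ≤ meromorphicOrderAt F w) : residueAt F w = 0 := by
  obtain ⟨G, hG, hFG⟩ := exists_analyticAt_of_meromorphicOrderAt_nonneg hF h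
  rw [residueAt_congr hFG, residueAt_of_analyticAt hG]

/-- The polynomial in `1 / (s - w)` without constant term and with the given coefficients. -/
noncomputable def principalPart (w : ℂ) (n : ℕ) (coeff : ℕ → ℂ) (s : ℂ) : ℂ :=
  ∑ j ∈ Finset.range n, coeff j * ((s - w) ^ (j + 1))⁻¹

lemma analyticAt_principalPart {w s : ℂ} (n : ℕ) (coeff : ℕ → ℂ) (hs : s ≠ w) :
    AnalyticAt ℂ (principalPart w n coeff) s := by
  refine Finset.analyticAt_fun_sum _ fun j _ => analyticAt_const.mul (AnalyticAt.inv ?_ ?_)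
  · fun_prop
  · exact pow_ne_zero _ (sub_ne_zero.2 hs)

lemma meromorphicAt_principalPart (w s : ℂ) (n : ℕ) (coeff : ℕ → ℂ) :
    MeromorphicAt (principalPart w n coeff) s := by
  unfold principalPart
  fun_prop

/-- Every meromorphic function has a principal part, by expanding `(s - w)^n F(s)` step by step at
`w`. -/
lemma exists_principalPart {F : ℂ → ℂ} {w : ℂ} (hF : MeromorphicAt F w) :
    ∃ (n : ℕ) (coeff : ℕ → ℂ), 0 ≤ meromorphicOrderAt (fun s => F s - principalPart w n coeff s) w
      := by
  have key : ∀ (n : ℕ) (g : ℂ → ℂ), AnalyticAt ℂ g w → ∃ (coeff : ℕ → ℂ) (k : ℂ → ℂ),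
      AnalyticAt ℂ k w ∧ ∀ᶠ s in 𝓝[≠] w,
        g s * ((s - w) ^ n)⁻¹ = principalPart w n coeff s + k s := by
    intro n
    induction n with
    | zero => exact fun g hg => ⟨0, g, hg, Eventually.of_forall fun s => by simp [principalPart]⟩
    | succ n ih =>
      intro g hg
      obtain ⟨p, hp⟩ := hg
      obtain ⟨c, k, hk, hck⟩ := ih (dslope g w) ⟨_, hp.has_fpower_series_dslope_fslope⟩
      refine ⟨Function.update c n (g w), k, hk, ?_⟩
      filter_upwards [hck, self_mem_nhdsWithin] with s hs hsw
      have hne : s - w ≠ 0 := sub_ne_zero.2 hsw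
      have e : principalPart w (n + 1) (Function.update c n (g w)) s =
          principalPart w n c s + g w * ((s - w) ^ (n + 1))⁻¹ := by
        rw [principalPart, Finset.sum_range_succ, Function.update_self, principalPart]
        congr 1
        refine Finset.sum_congr rfl fun j hj => ?_
        rw [Function.update_of_ne (Finset.mem_range.1 hj).ne]
      have hd : dslope g w s = (g s - g w) * (s - w)⁻¹ := by
        rw [dslope_of_ne _ hsw, slope_def_field, div_eq_mul_inv]
      rw [e, add_right_comm, ← hs, hd]
      field_simp
      ring
  obtain ⟨n, hn⟩ := hF
  obtain ⟨c, k, hk, h⟩ := key n _ hn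
  refine ⟨n, c, ?_⟩
  have : (fun s => F s - principalPart w n c s) =ᶠ[𝓝[≠] w] k := by
    filter_upwards [h, self_mem_nhdsWithin] with s hs hsw
    have hne : s - w ≠ 0 := sub_ne_zero.2 hsw
    rw [smul_eq_mul, mul_comm, inv_mul_cancel_left₀ (pow_ne_zero _ hne)] at hs
    rw [hs]; ring
  rw [meromorphicOrderAt_congr this]
  exact hk.meromorphicOrderAt_nonneg

lemma residueAt_principalPart (w : ℂ) (n : ℕ) (coeff : ℕ → ℂ) :
    residueAt (principalPart w (n + 1) coeff) w = coeff 0 := by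
  refine residueAt_eq_of_eventually ?_
  filter_upwards [self_mem_nhdsWithin] with ρ hρ
  have hρ : 0 < ρ := hρ
  have hci : ∀ j, CircleIntegrable (fun s => coeff j * ((s - w) ^ (j + 1))⁻¹) w ρ := fun j => by
    refine ContinuousOn.circleIntegrable hρ.le (continuousOn_const.mul
      (ContinuousOn.inv₀ (by fun_prop) fun s hs => ?_))
    have : ‖s - w‖ = ρ := by simpa using hs
    exact pow_ne_zero _ (norm_pos_iff.1 (this ▸ hρ))
  unfold principalPart
  rw [circleIntegral.integral_fun_sum (fun j _ => hci j), Finset.sum_range_succ']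
  have hz : ∀ j, (∮ s in C(w, ρ), coeff (j + 1) * ((s - w) ^ (j + 1 + 1))⁻¹) = 0 := fun j => by
    rw [circleIntegral.integral_const_mul]
    have := circleIntegral.integral_sub_zpow_of_ne (n := -((j : ℤ) + 2)) (by omega) w w ρ
    have e : ∀ s : ℂ, (s - w) ^ (-((j : ℤ) + 2)) = ((s - w) ^ (j + 1 + 1))⁻¹ := fun s => by
      rw [zpow_neg]; congr 1
    simp only [e] at this
    rw [this, mul_zero]
  simp only [hz, Finset.sum_const_zero, zero_add, pow_one]
  rw [circleIntegral.integral_const_mul, circleIntegral.integral_sub_center_inv w hρ.ne',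
    mul_comm (coeff 0), inv_mul_cancel_left₀ Complex.two_pi_I_ne_zero]

/-! ### The residue theorem for regions with a Lipschitz left side -/

section ScreenRegion

variable {f : ℝ → ℝ} {c a b : ℝ} {K : NNReal}

lemma isCompact_screenRegion (hf : LipschitzWith K f) : IsCompact (screenRegion f c a b) := by
  refine Metric.isCompact_of_isClosed_isBounded ?_ ?_
  · exact (isClosed_le continuous_const Complex.continuous_im).inter
      ((isClosed_le Complex.continuous_im continuous_const).inter
      ((isClosed_le (hf.continuous.comp Complex.continuous_im) Complex.continuous_re).inter
      (isClosed_le Complex.continuous_re continuous_const)))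
  · obtain ⟨m, hm⟩ := (isCompact_Icc (a := a) (b := b)).bddBelow_image hf.continuous.continuousOn
    refine ((isCompact_Icc (a := m) (b := c)).reProdIm
      (isCompact_Icc (a := a) (b := b))).isBounded.subset fun s hs => ?_
    exact ⟨⟨(hm (mem_image_of_mem f ⟨hs.1, hs.2.1⟩)).trans hs.2.2.1, hs.2.2.2⟩, hs.1, hs.2.1⟩

lemma screenRegionIntegral_principalPart (hf : LipschitzWith K f) (hab : a ≤ b)
    (hfc : ∀ t, f t ≤ c) {w : ℂ} (hw : w ∈ screenRegion f c a b)
    (hwb : w ∉ screenRegionBoundary f c a b) (n : ℕ) (coeff : ℕ → ℂ) :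
    ScreenRegionIntegrable f c a b (principalPart w (n + 1) coeff) ∧
      screenRegionIntegral f c a b (principalPart w (n + 1) coeff) =
        2 * Real.pi * Complex.I * coeff 0 := by
  have h1 : w.im ≠ a := fun h => hwb ⟨hw, Or.inl h⟩
  have h2 : w.im ≠ b := fun h => hwb ⟨hw, Or.inr (Or.inl h)⟩
  have h3 : w.re ≠ c := fun h => hwb ⟨hw, Or.inr (Or.inr (Or.inl h))⟩
  have h4 : w.re ≠ f w.im := fun h => hwb ⟨hw, Or.inr (Or.inr (Or.inr h))⟩
  induction n with
  | zero =>
    obtain ⟨i, e⟩ := screenRegionIntegral_inv hf (lt_of_le_of_ne hw.1 h1.symm)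
      (lt_of_le_of_ne hw.2.1 h2) (lt_of_le_of_ne hw.2.2.1 h4.symm) (lt_of_le_of_ne hw.2.2.2 h3)
    have : principalPart w (0 + 1) coeff = fun s => coeff 0 * (s - w)⁻¹ := by
      funext s; simp [principalPart]
    rw [this, screenRegionIntegral_const_mul, e]
    exact ⟨i.const_mul _, mul_comm _ _⟩
  | succ n ih =>
    obtain ⟨i, e⟩ := screenRegionIntegral_inv_pow hf hab hfc hwb n
    have : principalPart w (n + 1 + 1) coeff =
        fun s => principalPart w (n + 1) coeff s + coeff (n + 1) * ((s - w) ^ (n + 2))⁻¹ := by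
      funext s; rw [principalPart, Finset.sum_range_succ]; rfl
    rw [this, screenRegionIntegral_add ih.1 (i.const_mul _), screenRegionIntegral_const_mul, e,
      ih.2, mul_zero, add_zero]
    exact ⟨ih.1.add (i.const_mul _), rfl⟩

/-- The residue theorem for a region with Lipschitz left side, all poles lying in its interior.
Removing the principal parts one by one reduces it to Cauchy's theorem. -/
theorem screenRegionIntegral_eq_sum_residueAt (hf : LipschitzWith K f) (hab : a ≤ b)
    (hfc : ∀ t, f t ≤ c) (S : Finset ℂ) : ∀ F : ℂ → ℂ,
    (∀ s ∈ screenRegion f c a b, MeromorphicAt F s) →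
    (∀ w ∈ S, w ∈ screenRegion f c a b ∧ w ∉ screenRegionBoundary f c a b) →
    (∀ s ∈ screenRegion f c a b, s ∉ S → 0 ≤ meromorphicOrderAt F s) →
    ScreenRegionIntegrable f c a b F ∧
      screenRegionIntegral f c a b F = 2 * Real.pi * Complex.I * ∑ w ∈ S, residueAt F w := by
  classical
  induction S using Finset.induction_on with
  | empty =>
    intro F hF _ hord
    -- Without poles `F` agrees with an analytic function off a finite set.
    have hF' : MeromorphicOn F (screenRegion f c a b) := hF
    have hH : ∀ s ∈ screenRegion f c a b,
        AnalyticAt ℂ (toMeromorphicNFOn F (screenRegion f c a b)) s := fun s hs => by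
      rw [← (meromorphicNFOn_toMeromorphicNFOn F _ hs).meromorphicOrderAt_nonneg_iff_analyticAt,
        meromorphicOrderAt_congr (hF'.toMeromorphicNFOn_eq_self_on_nhdsNE hs)]
      exact hord s hs (Finset.notMem_empty s)
    obtain ⟨i, e⟩ := screenRegionIntegral_of_analytic hf hab hfc hH
    have hfin := (isCompact_screenRegion (c := c) (a := a) (b := b)
      hf).finite_sdiff_of_mem_codiscreteWithin (toMeromorphicNFOn_eqOn_codiscrete hF')
    obtain ⟨i', e'⟩ := screenRegionIntegral_congr_finite hab hfc hfin (G := F)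
      (fun s hs hsS => by
        by_contra h
        exact hsS ⟨hs.1, fun h' => h (Eq.symm h')⟩) i
    exact ⟨i', by rw [e', e]; simp⟩
  | insert w S hwS ih =>
    intro F hF hS hord
    obtain ⟨hw, hwb⟩ := hS w (Finset.mem_insert_self _ _)
    obtain ⟨n, coeff', hn'⟩ := exists_principalPart (hF w hw)
    -- adding a zero coefficient makes the number of terms positive
    obtain ⟨coeff, hn⟩ : ∃ coeff, 0 ≤ meromorphicOrderAt
        (fun s => F s - principalPart w (n + 1) coeff s) w := by
      refine ⟨Function.update coeff' n 0, ?_⟩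
      convert hn' using 4 with s
      rw [principalPart, Finset.sum_range_succ, Function.update_self, zero_mul, add_zero,
        principalPart]
      refine Finset.sum_congr rfl fun j hj => ?_
      rw [Function.update_of_ne (Finset.mem_range.1 hj).ne]
    set p := principalPart w (n + 1) coeff with hp
    have hpm : ∀ s, MeromorphicAt p s := fun s => meromorphicAt_principalPart w s _ _
    set G : ℂ → ℂ := fun s => F s - p s with hG
    have hGm : ∀ s ∈ screenRegion f c a b, MeromorphicAt G s := fun s hs => (hF s hs).sub (hpm s)
    obtain ⟨iG, eG⟩ := ih G hGm (fun v hv => hS v (Finset.mem_insert_of_mem hv))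
      (fun s hs hsS => by
        by_cases h : s = w
        · rw [h]; exact hn
        · exact meromorphicOrderAt_sub_nonneg (hF s hs) (hpm s)
            (hord s hs (by simp [h, hsS])) (analyticAt_principalPart _ _ h).meromorphicOrderAt_nonneg)
    obtain ⟨ip, ep⟩ := screenRegionIntegral_principalPart hf hab hfc hw hwb n coeff
    have hFG : F = fun s => G s + p s := by funext s; simp [hG]
    have res : ∀ s ∈ screenRegion f c a b, residueAt F s = residueAt G s + residueAt p s :=
      fun s hs => by
        conv_lhs => rw [hFG]
        exact residueAt_add (hGm s hs) (hpm s)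
    have rw1 : residueAt F w = coeff 0 := by
      rw [res w hw, residueAt_eq_zero (hGm w hw) hn, zero_add, hp, residueAt_principalPart]
    have rw2 : ∀ v ∈ S, residueAt F v = residueAt G v := fun v hv => by
      have hvw : v ≠ w := fun h => hwS (h ▸ hv)
      rw [res v (hS v (Finset.mem_insert_of_mem hv)).1,
        residueAt_of_analyticAt (analyticAt_principalPart _ _ hvw), add_zero]
    rw [Finset.sum_insert hwS, rw1, Finset.sum_congr rfl rw2, mul_add, ← eG, ← ep, add_comm,
      ← screenRegionIntegral_add iG ip, ← hFG]
    exact ⟨by rw [hFG]; exact iG.add ip, rfl⟩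

end ScreenRegion

/-! ### The Dirichlet integral -/

/-- The Riemann-Lebesgue lemma for the sine transform. -/
lemma tendsto_integral_mul_sin {g : ℝ → ℝ} (hg : Integrable g) :
    Tendsto (fun T : ℝ => ∫ v, g v * Real.sin (T * v)) atTop (𝓝 0) := by
  have h := Real.tendsto_integral_exp_smul_cocompact (fun v => (g v : ℂ))
  have h2 : Tendsto (fun T : ℝ => -T / (2 * Real.pi)) atTop (cocompact ℝ) :=
    ((tendsto_neg_atTop_atBot (G := ℝ)).atBot_div_const (by positivity)).mono_right
      atBot_le_cocompact
  have h3 := (Complex.continuous_im.tendsto _).comp (h.comp h2)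
  simp only [Complex.zero_im] at h3
  refine h3.congr fun T => ?_
  have hb : Integrable (fun v => (Real.fourierChar (-(v * (-T / (2 * Real.pi)))) : Circle) •
      (g v : ℂ)) := by
    change Integrable (fun v => ((Real.fourierChar (-(v * (-T / (2 * Real.pi)))) : Circle) : ℂ) *
      (g v : ℂ))
    refine hg.ofReal.bdd_mul (c := 1)
      (Continuous.aestronglyMeasurable (by fun_prop))
      (Eventually.of_forall fun v => (Circle.norm_coe _).le)
  simp only [Function.comp_apply]
  rw [← Complex.imCLM_apply, ← ContinuousLinearMap.integral_comp_comm _ hb]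
  refine integral_congr_ae (Eventually.of_forall fun v => ?_)
  simp only [Circle.smul_def, Real.fourierChar_apply, smul_eq_mul, Complex.imCLM_apply]
  have : (2 * Real.pi * (-(v * (-T / (2 * Real.pi)))) : ℝ) = T * v := by
    field_simp
  rw [this, Complex.mul_im, Complex.exp_ofReal_mul_I_im]
  simp [mul_comm]

lemma tendsto_intervalIntegral_mul_sin {g : ℝ → ℝ} {a b : ℝ} (hab : a ≤ b)
    (hg : IntervalIntegrable g volume a b) :
    Tendsto (fun T : ℝ => ∫ v in a..b, g v * Real.sin (T * v)) atTop (𝓝 0) := by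
  have h := tendsto_integral_mul_sin
    (((intervalIntegrable_iff_integrableOn_Ioc_of_le hab).1 hg).integrable_indicator
      measurableSet_Ioc)
  refine h.congr fun T => ?_
  rw [intervalIntegral.integral_of_le hab, ← integral_indicator measurableSet_Ioc]
  refine integral_congr_ae (Eventually.of_forall fun v => ?_)
  by_cases hv : v ∈ Ioc a b <;> simp [hv]

lemma sin_div_two_mul_sin_half {x : ℝ} (hx : Real.sin (x / 2) ≠ 0) (n : ℕ) :
    Real.sin ((n + 1 / 2) * x) / (2 * Real.sin (x / 2)) =
      1 / 2 + ∑ k ∈ Finset.range n, Real.cos ((k + 1) * x) := by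
  induction n with
  | zero =>
    simp only [CharP.cast_eq_zero, zero_add, Finset.range_zero, Finset.sum_empty, add_zero]
    rw [show 1 / 2 * x = x / 2 by ring]
    field_simp
  | succ n ih =>
    rw [Finset.sum_range_succ, ← add_assoc, ← ih, div_add' _ _ _ (by simpa using hx)]
    congr 1
    have e1 : ((n + 1 : ℕ) + 1 / 2 : ℝ) * x = (n + 1) * x + x / 2 := by push_cast; ring
    have e2 : (n + 1 / 2 : ℝ) * x = (n + 1) * x - x / 2 := by ring
    rw [e1, e2, Real.sin_add, Real.sin_sub]
    ring

lemma integral_dirichletKernel (n : ℕ) :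
    ∫ x in (0 : ℝ)..Real.pi, Real.sin ((n + 1 / 2) * x) / (2 * Real.sin (x / 2)) = Real.pi / 2 := by
  have e : ∫ x in (0 : ℝ)..Real.pi, Real.sin ((n + 1 / 2) * x) / (2 * Real.sin (x / 2)) =
      ∫ x in (0 : ℝ)..Real.pi, (1 / 2 + ∑ k ∈ Finset.range n, Real.cos ((k + 1) * x)) := by
    refine intervalIntegral.integral_congr_ae (Eventually.of_forall fun x hx => ?_)
    rw [uIoc_of_le Real.pi_pos.le] at hx
    exact sin_div_two_mul_sin_half (Real.sin_pos_of_pos_of_lt_pi (half_pos hx.1)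
      (by linarith [hx.2, Real.pi_pos])).ne' n
  have hc : ∀ k : ℕ, IntervalIntegrable (fun x : ℝ => Real.cos ((k + 1) * x)) volume 0 Real.pi :=
    fun k => (by fun_prop : Continuous fun x : ℝ => Real.cos ((k + 1) * x)).intervalIntegrable _ _
  rw [e, intervalIntegral.integral_add intervalIntegrable_const
    ((by fun_prop : Continuous fun x : ℝ =>
      ∑ k ∈ Finset.range n, Real.cos ((k + 1) * x)).intervalIntegrable _ _),
    intervalIntegral.integral_finsetSum fun k _ => hc k, Finset.sum_eq_zero]
  · simp [div_eq_mul_inv]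
  · intro k _
    have hk : (k + 1 : ℝ) ≠ 0 := by positivity
    rw [intervalIntegral.integral_comp_mul_left (fun x => Real.cos x) hk, integral_cos]
    have : Real.sin ((k + 1) * Real.pi) = 0 := by exact_mod_cast Real.sin_nat_mul_pi (k + 1)
    simp [this]

lemma mul_sinc (x : ℝ) : x * Real.sinc x = Real.sin x := by
  rcases eq_or_ne x 0 with rfl | h
  · simp
  · rw [Real.sinc_of_ne_zero h, mul_div_cancel₀ _ h]

lemma mul_integral_sinc (T a b : ℝ) :
    ∫ v in a..b, T * Real.sinc (T * v) = ∫ u in (T * a)..(T * b), Real.sinc u := by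
  rw [intervalIntegral.integral_const_mul, ← smul_eq_mul,
    intervalIntegral.smul_integral_comp_mul_left]

/-- The Dirichlet integral along `(n + 1/2) π`: after rescaling to `[0, π]`, the kernel
`sin ((n + 1/2) x) / x` differs from the Dirichlet kernel, whose integral is known, by a bounded
function times `sin ((n + 1/2) x)`, and the Riemann-Lebesgue lemma applies to the difference. -/
lemma tendsto_integral_sinc_nat :
    Tendsto (fun n : ℕ => ∫ u in (0 : ℝ)..((n + 1 / 2) * Real.pi), Real.sinc u) atTop
      (𝓝 (Real.pi / 2)) := by
  set g : ℝ → ℝ := fun x => 1 / x - 1 / (2 * Real.sin (x / 2)) with hg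
  have hgi : IntervalIntegrable g volume 0 Real.pi := by
    rw [intervalIntegrable_iff_integrableOn_Ioc_of_le Real.pi_pos.le]
    refine Measure.integrableOn_of_bounded (M := Real.pi ^ 2) measure_Ioc_lt_top.ne
      (by fun_prop) ?_
    refine (ae_restrict_iff' measurableSet_Ioc).2 (Eventually.of_forall fun x hx => ?_)
    have hx0 := hx.1
    have hs : 2 / Real.pi * (x / 2) ≤ Real.sin (x / 2) :=
      Real.mul_le_sin (by linarith) (by linarith [hx.2])
    have hs1 := Real.sin_gt_sub_cube (half_pos hx0)
    have hs2 := Real.sin_le (half_pos hx0).le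
    have hs0 : 0 < Real.sin (x / 2) := lt_of_lt_of_le (by positivity) hs
    have e : g x = -((x / 2 - Real.sin (x / 2)) / (x * Real.sin (x / 2))) := by
      rw [hg]; field_simp; ring
    rw [e, norm_neg, Real.norm_of_nonneg (div_nonneg (by linarith) (by positivity)),
      div_le_iff₀ (by positivity)]
    have h1 : x * (x / Real.pi) ≤ x * Real.sin (x / 2) := by
      gcongr; refine le_trans (le_of_eq ?_) hs; field_simp
    calc x / 2 - Real.sin (x / 2) ≤ (x / 2) ^ 3 / 6 := by linarith
      _ ≤ Real.pi * (x * x) := by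
          have : x ^ 3 ≤ Real.pi * (x * x) := by
            rw [pow_succ, sq, mul_comm]; gcongr; exact hx.2
          nlinarith [pow_pos hx0 3]
      _ = Real.pi ^ 2 * (x * (x / Real.pi)) := by field_simp
      _ ≤ _ := by gcongr
  have h1 := (tendsto_intervalIntegral_mul_sin Real.pi_pos.le hgi).comp
    (tendsto_atTop_add_const_right atTop (1 / 2 : ℝ) tendsto_natCast_atTop_atTop)
  have h2 := h1.add_const (Real.pi / 2)
  rw [zero_add] at h2
  refine h2.congr fun n => ?_
  have hn : (0 : ℝ) < n + 1 / 2 := by positivity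
  have hi : IntervalIntegrable (fun v => g v * Real.sin ((n + 1 / 2) * v)) volume 0 Real.pi :=
    hgi.mul_continuousOn (by fun_prop)
  have hj : IntervalIntegrable (fun v : ℝ => (n + 1 / 2) * Real.sinc ((n + 1 / 2) * v))
      volume 0 Real.pi := Continuous.intervalIntegrable (by
        have := Real.continuous_sinc; fun_prop) _ _
  have key : ∀ v ∈ Ioc (0 : ℝ) Real.pi, (n + 1 / 2) * Real.sinc ((n + 1 / 2) * v) -
      g v * Real.sin ((n + 1 / 2) * v) =
        Real.sin ((n + 1 / 2) * v) / (2 * Real.sin (v / 2)) := fun v hv => by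
    have hv0 := hv.1
    rw [Real.sinc_of_ne_zero (by positivity), hg]
    field_simp
    ring
  have e := mul_integral_sinc (n + 1 / 2) 0 Real.pi
  rw [mul_zero] at e
  have hd : (∫ v in (0 : ℝ)..Real.pi, (n + 1 / 2) * Real.sinc ((n + 1 / 2) * v)) -
      ∫ v in (0 : ℝ)..Real.pi, g v * Real.sin ((n + 1 / 2) * v) = Real.pi / 2 := by
    rw [← integral_dirichletKernel n, ← intervalIntegral.integral_sub hj hi]
    refine intervalIntegral.integral_congr_ae (Eventually.of_forall fun v hv => ?_)
    rw [uIoc_of_le Real.pi_pos.le] at hv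
    exact key v hv
  rw [← e, Function.comp_apply]
  linarith

lemma tendsto_integral_sinc :
    Tendsto (fun T : ℝ => ∫ u in (0 : ℝ)..T, Real.sinc u) atTop (𝓝 (Real.pi / 2)) := by
  have hii : ∀ a b, IntervalIntegrable Real.sinc volume a b := fun a b =>
    Real.continuous_sinc.intervalIntegrable a b
  have h1 := tendsto_integral_sinc_nat.comp
    ((tendsto_nat_floor_atTop (α := ℝ)).comp (tendsto_id.atTop_div_const Real.pi_pos))
  have h2 : Tendsto (fun T : ℝ => Real.pi / 2 * (T - Real.pi / 2)⁻¹) atTop (𝓝 0) := by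
    rw [← mul_zero (Real.pi / 2)]
    exact (tendsto_inv_atTop_zero.comp
      (tendsto_atTop_add_const_right _ (-(Real.pi / 2)) tendsto_id)).const_mul _
  -- Between `T` and the nearest point of the sequence, the integrand is at most `1 / (T - π / 2)`.
  have h3 : Tendsto (fun T : ℝ => ∫ u in ((⌊T / Real.pi⌋₊ + 1 / 2) * Real.pi)..T, Real.sinc u)
      atTop (𝓝 0) := by
    refine squeeze_zero_norm' ?_ h2
    filter_upwards [eventually_gt_atTop Real.pi] with T hT
    have hpi := Real.pi_pos
    have hT0 : 0 ≤ T / Real.pi := div_nonneg (by linarith) hpi.le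
    have f1 : ⌊T / Real.pi⌋₊ * Real.pi ≤ T := by
      rw [← le_div_iff₀ hpi]; exact Nat.floor_le hT0
    have f2 : T < (⌊T / Real.pi⌋₊ + 1) * Real.pi := by
      rw [← div_lt_iff₀ hpi]; exact Nat.lt_floor_add_one _
    have hd : |T - (⌊T / Real.pi⌋₊ + 1 / 2) * Real.pi| ≤ Real.pi / 2 := by
      rw [abs_le]; constructor <;> nlinarith
    refine (intervalIntegral.norm_integral_le_of_norm_le_const
      (C := (T - Real.pi / 2)⁻¹) fun u hu => ?_).trans ?_
    · have hu' : T - Real.pi / 2 ≤ u := by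
        have hmem := uIoc_subset_uIcc hu
        rw [uIcc_comm] at hmem
        have := abs_sub_left_of_mem_uIcc hmem
        rw [abs_sub_comm] at hd
        have := (abs_le.1 (this.trans hd)).1
        linarith
      have hu0 : 0 < u := by linarith
      rw [Real.sinc_of_ne_zero hu0.ne', norm_div, Real.norm_of_nonneg hu0.le, inv_eq_one_div]
      gcongr
      · linarith
      · exact Real.abs_sin_le_one u
    · rw [mul_comm]
      gcongr
      exact inv_nonneg.2 (by linarith)
  have := h1.add h3
  rw [add_zero] at this
  refine this.congr fun T => ?_
  exact intervalIntegral.integral_add_adjacent_intervals (hii _ _) (hii _ _)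

lemma exists_abs_integral_sinc_le : ∃ B, ∀ x, |∫ u in (0 : ℝ)..x, Real.sinc u| ≤ B := by
  have hcont : Continuous fun x => ∫ u in (0 : ℝ)..x, Real.sinc u :=
    intervalIntegral.continuous_primitive
      (fun a b => Real.continuous_sinc.intervalIntegrable a b) 0
  obtain ⟨X, hX⟩ := eventually_atTop.1 (tendsto_integral_sinc.abs.eventually_le_const
    (show |Real.pi / 2| < Real.pi by rw [abs_of_pos (by positivity)]; linarith [Real.pi_pos]))
  obtain ⟨B, hB⟩ := (isCompact_Icc (a := (0 : ℝ)) (b := X)).exists_bound_of_continuousOn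
    hcont.continuousOn
  have hpos : ∀ x, 0 ≤ x → |∫ u in (0 : ℝ)..x, Real.sinc u| ≤ max B Real.pi := fun x hx => by
    rcases le_total x X with h | h
    · exact (hB x ⟨hx, h⟩).trans (le_max_left _ _)
    · exact (hX x h).trans (le_max_right _ _)
  refine ⟨max B Real.pi, fun x => ?_⟩
  rcases le_total 0 x with h | h
  · exact hpos x h
  · have : ∫ u in (0 : ℝ)..x, Real.sinc u = - ∫ u in (0 : ℝ)..(-x), Real.sinc u := by
      have := intervalIntegral.integral_comp_neg (a := 0) (b := x) Real.sinc
      simp only [Real.sinc_neg, neg_zero] at this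
      rw [this, intervalIntegral.integral_symm]
    rw [this, abs_neg]
    exact hpos _ (by linarith)

/-! ### The truncated Perron integral -/

lemma intervalIntegral_exp_mul_I (T v : ℝ) :
    ∫ t in (-T)..T, Complex.exp (v * t * Complex.I) = 2 * (T * Real.sinc (T * v) : ℝ) := by
  rcases eq_or_ne v 0 with rfl | hv
  · simp; ring
  · have h := intervalIntegral.integral_comp_mul_left (a := -T) (b := T)
      (fun u : ℝ => Complex.exp (u * Complex.I)) hv
    simp only [Complex.ofReal_mul] at h
    have hv' : (v : ℂ) ≠ 0 := by exact_mod_cast hv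
    rw [h, mul_neg, integral_exp_mul_I_eq_sinc, mul_comm v T, Complex.real_smul]
    push_cast
    field_simp

/-- The truncated Perron integral as an integral against the kernel `sin (T v) / v`. -/
lemma integral_exp_div_eq {c : ℝ} (hc : 0 < c) (T x : ℝ) :
    ∫ t in (-T)..T, Complex.exp (x * (c + t * Complex.I)) / (c + t * Complex.I) =
      2 * ((∫ v in Iic x, Real.exp (c * v) * (T * Real.sinc (T * v)) : ℝ) : ℂ) := by
  have h1 : ∀ t : ℝ, Complex.exp (x * (c + t * Complex.I)) / (c + t * Complex.I) =
      ∫ v in Iic x, Complex.exp ((c + t * Complex.I) * v) := fun t => by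
    rw [integral_exp_mul_complex_Iic (by simpa using hc), mul_comm]
  simp_rw [h1]
  rw [intervalIntegral_integral_swap]
  · rw [← integral_complex_ofReal, ← integral_const_mul]
    refine integral_congr_ae (Eventually.of_forall fun v => ?_)
    have h2 : ∀ t : ℝ, Complex.exp ((c + t * Complex.I) * v) =
        Complex.exp (c * v) * Complex.exp (v * t * Complex.I) := fun t => by
      rw [← Complex.exp_add]; ring_nf
    simp only [h2]
    rw [intervalIntegral.integral_const_mul, intervalIntegral_exp_mul_I]
    push_cast
    ring
  · have hb : Integrable (fun p : ℝ × ℝ => (1 : ℝ) * Real.exp (c * p.2))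
        ((volume.restrict (uIoc (-T) T)).prod (volume.restrict (Iic x))) := by
      have h1 : Integrable (fun _ : ℝ => (1 : ℝ)) (volume.restrict (uIoc (-T) T)) :=
        continuous_const.integrableOn_uIoc
      exact h1.mul_prod (integrableOn_exp_mul_Iic hc x)
    refine hb.mono' (Continuous.aestronglyMeasurable (by unfold Function.uncurry; fun_prop))
      (Eventually.of_forall fun p => ?_)
    rw [Function.uncurry, Complex.norm_exp]
    simp

lemma continuous_dslope_exp (c : ℝ) : Continuous (dslope (fun v : ℝ => Real.exp (c * v)) 0) := by
  rw [← continuousOn_univ, continuousOn_dslope univ_mem]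
  exact ⟨by fun_prop, by fun_prop⟩

lemma integrableOn_exp_mul_sinc {c : ℝ} (hc : 0 < c) (T x : ℝ) :
    IntegrableOn (fun v => Real.exp (c * v) * (T * Real.sinc (T * v))) (Iic x) := by
  have := Real.continuous_sinc
  refine (integrableOn_exp_mul_Iic hc x).mul_bdd (c := |T|)
    (Continuous.aestronglyMeasurable (by fun_prop)) (Eventually.of_forall fun v => ?_)
  rw [norm_mul]
  exact mul_le_of_le_one_right (norm_nonneg _) (Real.abs_sinc_le_one _)

/-- Splitting the integral at `-1` and subtracting the value of the exponential at `0` isolates the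
Dirichlet integral. -/
lemma integral_exp_mul_sinc_eq {c : ℝ} (hc : 0 < c) (T x : ℝ) :
    ∫ v in Iic x, Real.exp (c * v) * (T * Real.sinc (T * v)) =
      (∫ v in Iic (-1), Real.exp (c * v) * (T * Real.sinc (T * v))) +
      ((∫ u in (0 : ℝ)..(T * x), Real.sinc u) - ∫ u in (0 : ℝ)..(T * (-1)), Real.sinc u) +
      ∫ v in (-1)..x, dslope (fun v : ℝ => Real.exp (c * v)) 0 v * Real.sin (T * v) := by
  have hs := Real.continuous_sinc
  have hq := continuous_dslope_exp c
  rw [intervalIntegral.integral_interval_sub_left (hs.intervalIntegrable _ _)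
    (hs.intervalIntegrable _ _), ← mul_integral_sinc, add_assoc,
    ← intervalIntegral.integral_add (Continuous.intervalIntegrable (by fun_prop) _ _)
      (Continuous.intervalIntegrable (by fun_prop) _ _), ← sub_eq_iff_eq_add',
    intervalIntegral.integral_Iic_sub_Iic (integrableOn_exp_mul_sinc hc T (-1))
      (integrableOn_exp_mul_sinc hc T x)]
  refine intervalIntegral.integral_congr fun v _ => ?_
  have h := sub_smul_dslope (fun v : ℝ => Real.exp (c * v)) 0 v
  simp only [sub_zero, smul_eq_mul, mul_zero, Real.exp_zero] at h
  rw [← mul_sinc]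
  linear_combination (-(T * Real.sinc (T * v))) * h

/-- The bound is uniform in `T` and in `x ≤ X`, including the values of `x` near the discontinuity of
the limit at `0`. -/
lemma exists_integral_exp_mul_sinc_le {c : ℝ} (hc : 0 < c) (X : ℝ) :
    ∃ B, ∀ T x : ℝ, x ≤ X → |∫ v in Iic x, Real.exp (c * v) * (T * Real.sinc (T * v))| ≤ B := by
  obtain ⟨B, hB⟩ := exists_abs_integral_sinc_le
  have h1 : ∀ T x : ℝ, x ≤ -1 →
      |∫ v in Iic x, Real.exp (c * v) * (T * Real.sinc (T * v))| ≤ Real.exp (c * 0) / c := by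
    intro T x hx
    rw [← integral_exp_mul_Iic hc, ← Real.norm_eq_abs]
    refine (norm_integral_le_of_norm_le (integrableOn_exp_mul_Iic hc x) ?_).trans
      (setIntegral_mono_set (integrableOn_exp_mul_Iic hc 0)
        (Eventually.of_forall fun v => (Real.exp_pos _).le)
        (Iic_subset_Iic.2 (by linarith)).eventuallyLE)
    refine (ae_restrict_iff' measurableSet_Iic).2 (Eventually.of_forall fun v hv => ?_)
    have hv : v ≤ -1 := le_trans hv hx
    rw [norm_mul, Real.norm_of_nonneg (Real.exp_pos _).le]
    refine mul_le_of_le_one_right (Real.exp_pos _).le ?_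
    have h := mul_sinc (T * v)
    have h2 : |T * Real.sinc (T * v)| * |v| ≤ 1 := by
      rw [← abs_mul, mul_right_comm, h]; exact Real.abs_sin_le_one _
    have h3 : 1 ≤ |v| := by rw [abs_of_neg (by linarith)]; linarith
    rw [Real.norm_eq_abs]
    nlinarith [abs_nonneg (T * Real.sinc (T * v))]
  have hq := continuous_dslope_exp c
  refine ⟨Real.exp (c * 0) / c + (B + B) +
    ∫ v in (-1)..(max X (-1)), |dslope (fun v : ℝ => Real.exp (c * v)) 0 v|, fun T x hx => ?_⟩
  have hB0 : 0 ≤ B := (abs_nonneg _).trans (hB 0)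
  have hi0 : 0 ≤ ∫ v in (-1)..(max X (-1)), |dslope (fun v : ℝ => Real.exp (c * v)) 0 v| :=
    intervalIntegral.integral_nonneg (le_max_right _ _) fun _ _ => abs_nonneg _
  rcases le_total x (-1) with h | h
  · linarith [h1 T x h]
  · rw [integral_exp_mul_sinc_eq hc T x]
    refine (abs_add_le _ _).trans (add_le_add ((abs_add_le _ _).trans
      (add_le_add (h1 T (-1) le_rfl) ((abs_sub _ _).trans (add_le_add (hB _) (hB _))))) ?_)
    rw [← Real.norm_eq_abs]
    refine (intervalIntegral.norm_integral_le_of_norm_le h (Eventually.of_forall fun v _ => ?_)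
      (hq.abs.intervalIntegrable _ _)).trans
      (intervalIntegral.integral_mono_interval le_rfl h (hx.trans (le_max_left _ _))
        (Eventually.of_forall fun v => abs_nonneg _) (hq.abs.intervalIntegrable _ _))
    rw [norm_mul]
    exact mul_le_of_le_one_right (norm_nonneg _) (Real.abs_sin_le_one _)

lemma tendsto_integral_exp_mul_sinc_of_neg {c : ℝ} (hc : 0 < c) {x : ℝ} (hx : x < 0) :
    Tendsto (fun T : ℝ => ∫ v in Iic x, Real.exp (c * v) * (T * Real.sinc (T * v))) atTop
      (𝓝 0) := by
  have hi : IntegrableOn (fun v => Real.exp (c * v) * v⁻¹) (Iic x) := by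
    refine (integrableOn_exp_mul_Iic hc x).mul_bdd (c := |x|⁻¹)
      (by fun_prop) ((ae_restrict_iff' measurableSet_Iic).2 (Eventually.of_forall fun v hv => ?_))
    have hv : v ≤ x := hv
    rw [norm_inv, Real.norm_eq_abs]
    refine inv_anti₀ (abs_pos.2 hx.ne) ?_
    rw [abs_of_neg hx, abs_of_neg (by linarith)]; linarith
  refine (tendsto_integral_mul_sin (hi.integrable_indicator measurableSet_Iic)).congr fun T => ?_
  rw [← integral_indicator measurableSet_Iic]
  refine integral_congr_ae (Eventually.of_forall fun v => ?_)
  by_cases hv : v ∈ Iic x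
  · have hv0 : v ≠ 0 := (lt_of_le_of_lt hv hx).ne
    simp only [indicator_of_mem hv]
    rw [← mul_sinc (T * v)]
    field_simp
  · simp [hv]

lemma tendsto_integral_exp_mul_sinc_of_pos {c : ℝ} (hc : 0 < c) {x : ℝ} (hx : 0 < x) :
    Tendsto (fun T : ℝ => ∫ v in Iic x, Real.exp (c * v) * (T * Real.sinc (T * v))) atTop
      (𝓝 Real.pi) := by
  have h1 := tendsto_integral_exp_mul_sinc_of_neg hc (x := -1) (by norm_num)
  have h2 : Tendsto (fun T : ℝ => ∫ u in (0 : ℝ)..(T * x), Real.sinc u) atTop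
      (𝓝 (Real.pi / 2)) := tendsto_integral_sinc.comp (tendsto_id.atTop_mul_const hx)
  have h3 : ∀ T : ℝ, ∫ u in (0 : ℝ)..(T * (-1)), Real.sinc u = -∫ u in (0 : ℝ)..T, Real.sinc u := by
    intro T
    have := intervalIntegral.integral_comp_neg (a := 0) (b := T) Real.sinc
    simp only [Real.sinc_neg, neg_zero] at this
    rw [this, mul_neg_one, intervalIntegral.integral_symm]
  have h4 := tendsto_intervalIntegral_mul_sin (a := -1) (b := x) (by linarith)
    ((continuous_dslope_exp c).intervalIntegrable _ _)
  have := (h1.add (h2.sub tendsto_integral_sinc.neg)).add h4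
  rw [show 0 + (Real.pi / 2 - -(Real.pi / 2)) + 0 = Real.pi by ring] at this
  refine this.congr fun T => ?_
  rw [integral_exp_mul_sinc_eq hc T x, h3]

/-- The integrand `e^{x s} / s` of the Perron integral at the point `s = c + i t` of the line
`Re s = c`. -/
noncomputable def perronIntegrand (c x t : ℝ) : ℂ :=
  Complex.exp (x * (c + t * Complex.I)) / (c + t * Complex.I)

lemma ofReal_add_mul_I_ne_zero {c : ℝ} (hc : 0 < c) (t : ℝ) : (c + t * Complex.I : ℂ) ≠ 0 :=
  fun h => hc.ne' (by simpa using congrArg Complex.re h)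

lemma continuous_perronIntegrand {c : ℝ} (hc : 0 < c) :
    Continuous fun p : ℝ × ℝ => perronIntegrand c p.1 p.2 := by
  unfold perronIntegrand
  exact Continuous.div (by fun_prop) (by fun_prop) fun p => ofReal_add_mul_I_ne_zero hc p.2

lemma norm_perronIntegrand_le {c : ℝ} (hc : 0 < c) (x t : ℝ) :
    ‖perronIntegrand c x t‖ ≤ Real.exp (x * c) / c := by
  rw [perronIntegrand, norm_div, Complex.norm_exp]
  have : c ≤ ‖(c + t * Complex.I : ℂ)‖ := by
    simpa [abs_of_pos hc] using Complex.abs_re_le_norm (c + t * Complex.I : ℂ)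
  simp only [Complex.mul_re, Complex.ofReal_re, Complex.add_re, Complex.I_re, mul_zero,
    Complex.ofReal_im, Complex.I_im, mul_one, sub_self, add_zero, zero_mul, sub_zero]
  gcongr

/-- Replacing the lower end `-b` by a comparable one changes the integral by `O(log)` of the
ratio. -/
lemma norm_integral_perronIntegrand_le {c : ℝ} (x : ℝ) {a b : ℝ} (ha : 0 < a) (hb : 0 < b) :
    ‖∫ t in (-b)..(-a), perronIntegrand c x t‖ ≤ Real.exp (x * c) * |Real.log (b / a)| := by
  have hmono : ∀ a b : ℝ, 0 < a → a ≤ b →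
      ‖∫ t in (-b)..(-a), perronIntegrand c x t‖ ≤ Real.exp (x * c) * |Real.log (b / a)| := by
    intro a b ha hab
    have hint : IntervalIntegrable (fun t : ℝ => Real.exp (x * c) * (-t)⁻¹) volume (-b) (-a) := by
      refine ContinuousOn.intervalIntegrable (continuousOn_const.mul (ContinuousOn.inv₀
        (by fun_prop) fun t ht => ?_))
      rw [uIcc_of_le (neg_le_neg hab)] at ht
      linarith [ht.2]
    refine (intervalIntegral.norm_integral_le_of_norm_le (neg_le_neg hab)
      (Eventually.of_forall fun t ht => ?_) hint).trans (le_of_eq ?_)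
    · have ht0 : 0 < -t := by linarith [ht.2]
      rw [perronIntegrand, norm_div, Complex.norm_exp, div_eq_mul_inv]
      have : -t ≤ ‖(c + t * Complex.I : ℂ)‖ := by
        simpa [abs_of_neg (neg_pos.1 ht0)] using Complex.abs_im_le_norm (c + t * Complex.I : ℂ)
      simp only [Complex.mul_re, Complex.ofReal_re, Complex.add_re, Complex.I_re, mul_zero,
        Complex.ofReal_im, Complex.I_im, mul_one, sub_self, add_zero, zero_mul, sub_zero]
      gcongr
    · have h1 : 1 ≤ b / a := (one_le_div ha).2 hab
      rw [intervalIntegral.integral_const_mul,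
        intervalIntegral.integral_comp_neg (fun t => t⁻¹), neg_neg, neg_neg,
        integral_inv_of_pos ha (ha.trans_le hab), abs_of_nonneg (Real.log_nonneg h1)]
  rcases le_total a b with h | h
  · exact hmono a b ha h
  · rw [intervalIntegral.integral_symm, norm_neg]
    refine (hmono b a hb h).trans (le_of_eq ?_)
    rw [← inv_div, Real.log_inv, abs_neg]

section Truncated

variable {c : ℝ} {a b : ℕ → ℝ}

lemma integral_perronIntegrand_split (hc : 0 < c) (x a b : ℝ) :
    ∫ t in (-a)..b, perronIntegrand c x t =
      (∫ t in (-b)..b, perronIntegrand c x t) - ∫ t in (-b)..(-a), perronIntegrand c x t := by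
  have hi : ∀ u v, IntervalIntegrable (perronIntegrand c x) volume u v := fun u v =>
    ((continuous_perronIntegrand hc).comp (by fun_prop : Continuous fun t : ℝ => (x, t))
      ).intervalIntegrable u v
  rw [eq_sub_iff_add_eq', intervalIntegral.integral_add_adjacent_intervals (hi _ _) (hi _ _)]

/-- The Perron integrals are bounded as long as the ratio of the heights of truncation tends
to `1`. -/
lemma exists_norm_integral_perronIntegrand_le (hc : 0 < c) (X : ℝ) (ha : ∀ᶠ n in atTop, 0 < a n)
    (hb : ∀ᶠ n in atTop, 0 < b n) (hab : Tendsto (fun n => b n / a n) atTop (𝓝 1)) :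
    ∃ B, ∀ᶠ n in atTop, ∀ x ≤ X, ‖∫ t in (-(a n))..(b n), perronIntegrand c x t‖ ≤ B := by
  obtain ⟨B, hB⟩ := exists_integral_exp_mul_sinc_le hc X
  have hl : Tendsto (fun n => |Real.log (b n / a n)|) atTop (𝓝 0) := by
    simpa using ((Real.continuousAt_log one_ne_zero).tendsto.comp hab).abs
  refine ⟨2 * B + Real.exp (X * c) * 1, ?_⟩
  filter_upwards [ha, hb, hl.eventually_le_const zero_lt_one] with n han hbn hln x hx
  rw [integral_perronIntegrand_split hc]
  refine (norm_sub_le _ _).trans (add_le_add ?_ ?_)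
  · simp only [perronIntegrand]
    rw [integral_exp_div_eq hc, norm_mul, Complex.norm_real]
    simpa using hB (b n) x hx
  · refine (norm_integral_perronIntegrand_le x han hbn).trans ?_
    gcongr

/-- The truncated Perron integral, with heights of truncation that are only asymptotically
symmetric. -/
lemma tendsto_integral_perronIntegrand (hc : 0 < c) {x : ℝ} (hx : x ≠ 0)
    (ha : ∀ᶠ n in atTop, 0 < a n) (hb : Tendsto b atTop atTop)
    (hab : Tendsto (fun n => b n / a n) atTop (𝓝 1)) :
    Tendsto (fun n => ∫ t in (-(a n))..(b n), perronIntegrand c x t) atTop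
      (𝓝 (if 0 < x then 2 * Real.pi else 0)) := by
  have hl : Tendsto (fun n => Real.exp (x * c) * |Real.log (b n / a n)|) atTop (𝓝 0) := by
    simpa using (((Real.continuousAt_log one_ne_zero).tendsto.comp hab).abs).const_mul
      (Real.exp (x * c))
  have h1 : Tendsto (fun n => ∫ t in (-(b n))..(-(a n)), perronIntegrand c x t) atTop (𝓝 0) := by
    refine squeeze_zero_norm' ?_ hl
    filter_upwards [ha, hb.eventually_gt_atTop 0] with n han hbn
    exact norm_integral_perronIntegrand_le x han hbn
  have h2 : Tendsto (fun T : ℝ => ∫ v in Iic x, Real.exp (c * v) * (T * Real.sinc (T * v))) atTop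
      (𝓝 (if 0 < x then Real.pi else 0)) := by
    split_ifs with h
    · exact tendsto_integral_exp_mul_sinc_of_pos hc h
    · exact tendsto_integral_exp_mul_sinc_of_neg hc (lt_of_le_of_ne (not_lt.1 h) hx)
  have h3 := ((Complex.continuous_ofReal.tendsto _).comp (h2.comp hb)).const_mul (2 : ℂ)
  have h4 := h3.sub h1
  have e : (2 * ((if 0 < x then Real.pi else 0 : ℝ) : ℂ) - 0) =
      (if 0 < x then 2 * Real.pi else 0 : ℂ) := by split_ifs <;> simp
  rw [e] at h4
  refine h4.congr fun n => ?_
  rw [integral_perronIntegrand_split hc x (a n) (b n)]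
  simp only [perronIntegrand, Function.comp_apply]
  rw [integral_exp_div_eq hc]

end Truncated

/-! ### The distance to the boundary of a bounded open set -/

section Distance

variable {d : ℕ} {A G T : Set (EuclideanSpace ℝ (Fin d))}

lemma nontrivial_euclideanSpace (hd : 1 ≤ d) : Nontrivial (EuclideanSpace ℝ (Fin d)) := by
  have : Nonempty (Fin d) := Fin.pos_iff_nonempty.1 hd
  infer_instance

lemma ne_univ_of_isBounded (hd : 1 ≤ d) (hA : Bornology.IsBounded A) : A ≠ univ := by
  have := nontrivial_euclideanSpace hd
  rintro rfl
  exact NormedSpace.unbounded_univ ℝ _ hA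

lemma exists_mem_frontier_dist_eq (hA : IsOpen A) (hne : A ≠ univ) {x : EuclideanSpace ℝ (Fin d)}
    (hx : x ∈ A) : ∃ y ∈ frontier A, Metric.infDist x (frontier A) = dist x y ∧
      Metric.infDist x Aᶜ = dist x y := by
  obtain ⟨y, hy, hxy⟩ := exists_mem_frontier_infDist_compl_eq_dist hx hne
  refine ⟨y, hy, le_antisymm (Metric.infDist_le_dist_of_mem hy) ?_, hxy⟩
  rw [← hxy]
  refine Metric.infDist_le_infDist_of_subset ?_ ⟨y, hy⟩
  rw [hA.frontier_eq]
  exact fun z hz => hz.2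

lemma infDist_frontier_eq_infDist_compl (hA : IsOpen A) (hne : A ≠ univ)
    {x : EuclideanSpace ℝ (Fin d)} (hx : x ∈ A) :
    Metric.infDist x (frontier A) = Metric.infDist x Aᶜ := by
  obtain ⟨y, -, h1, h2⟩ := exists_mem_frontier_dist_eq hA hne hx
  rw [h1, h2]

lemma infDist_frontier_pos (hA : IsOpen A) (hne : A ≠ univ) {x : EuclideanSpace ℝ (Fin d)}
    (hx : x ∈ A) : 0 < Metric.infDist x (frontier A) := by
  rw [infDist_frontier_eq_infDist_compl hA hne hx]
  exact (hA.isClosed_compl.notMem_iff_infDist_pos (nonempty_compl.2 hne)).1 (fun h => h hx)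

lemma bddAbove_inradius (hd : 1 ≤ d) (hA : Bornology.IsBounded A) :
    BddAbove {ε : ℝ | 0 < ε ∧ ∃ x, Metric.ball x ε ⊆ A} := by
  have := nontrivial_euclideanSpace hd
  refine ⟨2 * Metric.diam A, ?_⟩
  rintro ε ⟨hε, x, hx⟩
  obtain ⟨v, hv⟩ := exists_norm_eq (EuclideanSpace ℝ (Fin d)) (half_pos hε).le
  have h1 : x ∈ A := hx (Metric.mem_ball_self hε)
  have h2 : x + v ∈ A := hx (by
    rw [Metric.mem_ball, dist_eq_norm, add_sub_cancel_left, hv]; linarith)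
  have := Metric.dist_le_diam_of_mem hA h2 h1
  rw [dist_eq_norm, add_sub_cancel_left, hv] at this
  linarith

lemma infDist_frontier_le_inradius (hd : 1 ≤ d) (hA : IsOpen A) (hb : Bornology.IsBounded A)
    {x : EuclideanSpace ℝ (Fin d)} (hx : x ∈ A) :
    Metric.infDist x (frontier A) ≤ inradius A := by
  have hne := ne_univ_of_isBounded hd hb
  refine le_csSup (bddAbove_inradius hd hb) ⟨infDist_frontier_pos hA hne hx, x, ?_⟩
  rw [infDist_frontier_eq_infDist_compl hA hne hx]
  exact Metric.ball_infDist_compl_subset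

/-- Level sets of the distance function are porous: near a point `x` at distance `ε` from `y ∈ C`
there is a ball of half the radius on the segment from `x` to `y`, all of whose points are closer
to `C`. Hence they have no density points. -/
lemma volume_infDist_eq (hd : 1 ≤ d) {C : Set (EuclideanSpace ℝ (Fin d))} (hC : IsClosed C)
    (hne : C.Nonempty) {ε : ℝ} (hε : 0 < ε) :
    volume {x : EuclideanSpace ℝ (Fin d) | Metric.infDist x C = ε} = 0 := by
  have := nontrivial_euclideanSpace hd
  set S := {x : EuclideanSpace ℝ (Fin d) | Metric.infDist x C = ε} with hS
  have hSm : MeasurableSet S :=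
    (isClosed_eq (Metric.continuous_infDist_pt C) continuous_const).measurableSet
  have hae := Besicovitch.ae_tendsto_measure_inter_div
    (volume : Measure (EuclideanSpace ℝ (Fin d))) S
  suffices h : ∀ᵐ x ∂((volume : Measure (EuclideanSpace ℝ (Fin d))).restrict S), False by
    have := (ae_restrict_iff' hSm).1 h
    rw [ae_iff] at this
    simpa using this
  filter_upwards [hae, ae_restrict_mem hSm] with x hx hxS
  obtain ⟨y, hy, hxy⟩ := hC.exists_infDist_eq_dist hne x
  rw [show Metric.infDist x C = ε from hxS] at hxy
  set k : ENNReal := ENNReal.ofReal ((1 / 2 : ℝ) ^ Module.finrank ℝ (EuclideanSpace ℝ (Fin d)))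
    with hk
  have hkpos : 0 < k := ENNReal.ofReal_pos.2 (by positivity)
  have hle : ∀ᶠ ρ in 𝓝[>] (0 : ℝ),
      volume (S ∩ Metric.closedBall x ρ) / volume (Metric.closedBall x ρ) + k ≤ 1 := by
    filter_upwards [Ioo_mem_nhdsGT hε] with ρ hρ
    have hρ0 := hρ.1
    set z := x + (ρ / 2 / ε) • (y - x) with hz
    have hnorm : ‖y - x‖ = ε := by rw [← dist_eq_norm, dist_comm, ← hxy]
    have hzx : dist z x = ρ / 2 := by
      rw [hz, dist_eq_norm, add_sub_cancel_left, norm_smul, hnorm,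
        Real.norm_of_nonneg (by positivity)]
      field_simp
    have hzy : dist z y = ε - ρ / 2 := by
      have : z - y = (ρ / 2 / ε - 1) • (y - x) := by rw [hz, sub_smul, one_smul]; abel
      have h1 : ρ / 2 / ε ≤ 1 := by rw [div_le_one hε]; linarith [hρ.2]
      rw [dist_eq_norm, this, norm_smul, hnorm, Real.norm_of_nonpos (by linarith)]
      field_simp
      ring
    have hdisj : Disjoint (S ∩ Metric.closedBall x ρ) (Metric.ball z (ρ / 2)) := by
      rw [Set.disjoint_left]
      rintro p ⟨hpS, -⟩ hpz
      have h1 : Metric.infDist p C ≤ dist p y := Metric.infDist_le_dist_of_mem hy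
      have h2 := dist_triangle p z y
      rw [Metric.mem_ball] at hpz
      rw [show Metric.infDist p C = ε from hpS] at h1
      linarith
    have hsub : S ∩ Metric.closedBall x ρ ∪ Metric.ball z (ρ / 2) ⊆ Metric.closedBall x ρ := by
      refine union_subset inter_subset_right fun p hp => ?_
      rw [Metric.mem_ball] at hp
      rw [Metric.mem_closedBall]
      linarith [dist_triangle p z x]
    have hm := measure_mono (μ := volume) hsub
    rw [measure_union hdisj Metric.isOpen_ball.measurableSet] at hm
    have hball : volume (Metric.ball z (ρ / 2)) = k * volume (Metric.closedBall x ρ) := by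
      have := Measure.addHaar_ball_mul_of_pos (volume : Measure (EuclideanSpace ℝ (Fin d))) z
        (r := 1 / 2) (by norm_num) ρ
      rw [show 1 / 2 * ρ = ρ / 2 by ring] at this
      rw [this, ← hk, Measure.addHaar_closedBall_eq_addHaar_ball,
        Measure.addHaar_ball_center volume x]
    rw [hball] at hm
    have h0 : volume (Metric.closedBall x ρ) ≠ 0 := (Metric.measure_closedBall_pos _ _ hρ0).ne'
    have ht : volume (Metric.closedBall x ρ) ≠ ⊤ := measure_closedBall_lt_top.ne
    rw [← ENNReal.div_self h0 ht]
    calc _ = (volume (S ∩ Metric.closedBall x ρ) + k * volume (Metric.closedBall x ρ)) /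
          volume (Metric.closedBall x ρ) := by
          rw [ENNReal.add_div, ENNReal.mul_div_cancel_right h0 ht]
      _ ≤ _ := ENNReal.div_le_div_right hm _
  have := le_of_tendsto (hx.add_const k) hle
  exact absurd this (not_le.2 (ENNReal.lt_add_right ENNReal.one_ne_top hkpos.ne'))

lemma volume_level_set_eq_zero (hd : 1 ≤ d) (hA : IsOpen A) (hb : Bornology.IsBounded A) {ε : ℝ}
    (hε : 0 < ε) : volume {x | x ∈ A ∧ Metric.infDist x (frontier A) = ε} = 0 := by
  have hne := ne_univ_of_isBounded hd hb
  refine measure_mono_null (fun x hx => ?_)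
    (volume_infDist_eq hd hA.isClosed_compl (nonempty_compl.2 hne) hε)
  rw [mem_ofPred, ← infDist_frontier_eq_infDist_compl hA hne hx.1]
  exact hx.2

/-! ### Distance zeta functions -/

/-- The distance zeta function `∫_A dist(x, ∂A)^u dx`, a shifted Mellin transform of the tube
volume. -/
noncomputable def distanceZeta (A : Set (EuclideanSpace ℝ (Fin d))) (u : ℂ) : ℂ :=
  ∫ x in A, (Metric.infDist x (frontier A) : ℂ) ^ u

lemma measurable_infDist_cpow (B : Set (EuclideanSpace ℝ (Fin d))) (u : ℂ) :
    Measurable fun x : EuclideanSpace ℝ (Fin d) => (Metric.infDist x B : ℂ) ^ u :=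
  (Complex.measurable_ofReal.comp (Metric.continuous_infDist_pt B).measurable).pow_const u

lemma norm_infDist_cpow_le (hd : 1 ≤ d) (hA : IsOpen A) (hb : Bornology.IsBounded A) {u : ℂ}
    (hu : 0 ≤ u.re) {x : EuclideanSpace ℝ (Fin d)} (hx : x ∈ A) :
    ‖(Metric.infDist x (frontier A) : ℂ) ^ u‖ ≤ inradius A ^ u.re := by
  have h0 := infDist_frontier_pos hA (ne_univ_of_isBounded hd hb) hx
  rw [Complex.norm_cpow_eq_rpow_re_of_pos h0]
  exact Real.rpow_le_rpow h0.le (infDist_frontier_le_inradius hd hA hb hx) hu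

lemma integrableOn_infDist_cpow (hd : 1 ≤ d) (hA : IsOpen A) (hb : Bornology.IsBounded A) {u : ℂ}
    (hu : 0 ≤ u.re) : IntegrableOn (fun x => (Metric.infDist x (frontier A) : ℂ) ^ u) A :=
  Measure.integrableOn_of_bounded (M := inradius A ^ u.re) hb.measure_lt_top.ne
    (measurable_infDist_cpow _ u).aestronglyMeasurable
    ((ae_restrict_iff' hA.measurableSet).2
      (Eventually.of_forall fun _ hx => norm_infDist_cpow_le hd hA hb hu hx))

lemma norm_distanceZeta_le (hd : 1 ≤ d) (hA : IsOpen A) (hb : Bornology.IsBounded A) {u : ℂ}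
    (hu : 0 ≤ u.re) : ‖distanceZeta A u‖ ≤ inradius A ^ u.re * volume.real A :=
  norm_setIntegral_le_of_norm_le_const hb.measure_lt_top
    fun _ hx => norm_infDist_cpow_le hd hA hb hu hx

lemma tendsto_distanceZeta (hd : 1 ≤ d) (hA : IsOpen A) (hb : Bornology.IsBounded A) :
    Tendsto (fun t : ℝ => distanceZeta A t) (𝓝[>] 0) (𝓝 (volume.real A)) := by
  have h1 : (volume.real A : ℂ) = ∫ x in A, (1 : ℂ) := by simp
  rw [h1]
  refine tendsto_integral_filter_of_dominated_convergence (fun _ => max 1 (inradius A))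
    (Eventually.of_forall fun t => (measurable_infDist_cpow _ _).aestronglyMeasurable) ?_ ?_ ?_
  · filter_upwards [Ioo_mem_nhdsGT (zero_lt_one' ℝ)] with t ht
    refine (ae_restrict_iff' hA.measurableSet).2 (Eventually.of_forall fun x hx => ?_)
    refine (norm_infDist_cpow_le hd hA hb (by simpa using ht.1.le) hx).trans ?_
    have h0 : 0 < inradius A := (infDist_frontier_pos hA (ne_univ_of_isBounded hd hb) hx).trans_le
      (infDist_frontier_le_inradius hd hA hb hx)
    rw [Complex.ofReal_re]
    rcases le_total (inradius A) 1 with h | h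
    · exact (Real.rpow_le_one h0.le h ht.1.le).trans (le_max_left _ _)
    · exact (Real.rpow_le_self_of_one_le h ht.2.le).trans (le_max_right _ _)
  · exact integrableOn_const hb.measure_lt_top.ne
  · refine (ae_restrict_iff' hA.measurableSet).2 (Eventually.of_forall fun x hx => ?_)
    have h0 := infDist_frontier_pos hA (ne_univ_of_isBounded hd hb) hx
    have h2 : Tendsto (fun t : ℝ => (Metric.infDist x (frontier A) : ℂ) ^ (t : ℂ)) (𝓝 0)
        (𝓝 ((Metric.infDist x (frontier A) : ℂ) ^ ((0 : ℝ) : ℂ))) :=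
      ((Complex.continuous_ofReal).const_cpow
        (Or.inl (by exact_mod_cast h0.ne'))).tendsto 0
    simp only [Complex.ofReal_zero, Complex.cpow_zero] at h2
    exact h2.mono_left nhdsWithin_le_nhds

lemma distanceZeta_ofReal_ne_zero (hd : 1 ≤ d) (hA : IsOpen A) (hb : Bornology.IsBounded A)
    (hne : A.Nonempty) {t : ℝ} (ht : 0 ≤ t) : distanceZeta A t ≠ 0 := by
  have hi := integrableOn_infDist_cpow hd hA hb (u := t) (by simpa using ht)
  have e : (fun x => (Metric.infDist x (frontier A) : ℂ) ^ (t : ℂ)) =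
      fun x => ((Metric.infDist x (frontier A) ^ t : ℝ) : ℂ) := by
    funext x; rw [Complex.ofReal_cpow Metric.infDist_nonneg]
  rw [e] at hi
  have hi' : IntegrableOn (fun x => Metric.infDist x (frontier A) ^ t) A := hi.re
  rw [distanceZeta, e, integral_complex_ofReal, Complex.ofReal_ne_zero]
  refine ((setIntegral_pos_iff_support_of_nonneg_ae (Eventually.of_forall fun x =>
    Real.rpow_nonneg Metric.infDist_nonneg _) hi').2 ?_).ne'
  refine (hA.measure_pos volume hne).trans_le (measure_mono fun x hx => ⟨?_, hx⟩)
  exact (Real.rpow_pos_of_pos (infDist_frontier_pos hA (ne_univ_of_isBounded hd hb) hx) t).ne'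

/-- Layer-cake representation of the distance zeta function in terms of the tube volume. -/
lemma distanceZeta_eq_integral_tubeVolume (hd : 1 ≤ d) (hA : IsOpen A)
    (hb : Bornology.IsBounded A) (hg : 0 < inradius A) {u : ℂ} (hu : 0 < u.re) :
    distanceZeta A u = volume.real A * (inradius A : ℂ) ^ u -
      u * ∫ t in (0 : ℝ)..inradius A, (tubeVolume A t : ℂ) * (t : ℂ) ^ (u - 1) := by
  set g := inradius A with hgdef
  have hu0 : u ≠ 0 := fun h => by simp [h] at hu
  have : IsFiniteMeasure (volume.restrict A) := ⟨by simpa using hb.measure_lt_top⟩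
  have hδm : Measurable fun x : EuclideanSpace ℝ (Fin d) => Metric.infDist x (frontier A) :=
    (Metric.continuous_infDist_pt _).measurable
  have hint : IntegrableOn (fun t : ℝ => (t : ℂ) ^ (u - 1)) (Ioc 0 g) := by
    rw [← intervalIntegrable_iff_integrableOn_Ioc_of_le hg.le]
    exact intervalIntegral.intervalIntegrable_cpow' (by simpa using hu)
  set F : EuclideanSpace ℝ (Fin d) → ℝ → ℂ := fun x =>
    (Ici (Metric.infDist x (frontier A))).indicator fun t : ℝ => (t : ℂ) ^ (u - 1) with hF
  have hFle : ∀ x t, ‖F x t‖ ≤ ‖(t : ℂ) ^ (u - 1)‖ := fun x t => norm_indicator_le_norm_self _ _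
  have hFint : Integrable (Function.uncurry F)
      ((volume.restrict A).prod (volume.restrict (Ioc 0 g))) := by
    have hb : Integrable (fun p : EuclideanSpace ℝ (Fin d) × ℝ => (1 : ℝ) * ‖(p.2 : ℂ) ^ (u - 1)‖)
        ((volume.restrict A).prod (volume.restrict (Ioc 0 g))) :=
      Integrable.mul_prod (f := fun _ : EuclideanSpace ℝ (Fin d) => (1 : ℝ))
        (integrable_const _) hint.norm
    refine hb.mono' ?_ (Eventually.of_forall fun p => ?_)
    · have hm : Measurable fun p : EuclideanSpace ℝ (Fin d) × ℝ => (p.2 : ℂ) ^ (u - 1) :=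
        (Complex.measurable_ofReal.comp measurable_snd).pow_const _
      have hs : MeasurableSet {p : EuclideanSpace ℝ (Fin d) × ℝ |
          Metric.infDist p.1 (frontier A) ≤ p.2} :=
        measurableSet_le (hδm.comp measurable_fst) measurable_snd
      exact (hm.indicator hs).aestronglyMeasurable
    · rw [one_mul]; exact hFle p.1 p.2
  have h1 : ∀ x ∈ A, ∫ t in Ioc 0 g, F x t =
      ((g : ℂ) ^ u - (Metric.infDist x (frontier A) : ℂ) ^ u) / u := by
    intro x hx
    have h0 := infDist_frontier_pos hA (ne_univ_of_isBounded hd hb) hx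
    have hle := infDist_frontier_le_inradius hd hA hb hx
    rw [setIntegral_indicator measurableSet_Ici]
    have : Ioc 0 g ∩ Ici (Metric.infDist x (frontier A)) =
        Icc (Metric.infDist x (frontier A)) g := by
      ext t
      simp only [mem_inter_iff, mem_Ioc, mem_Ici, mem_Icc]
      constructor
      · rintro ⟨⟨_, h⟩, h'⟩; exact ⟨h', h⟩
      · rintro ⟨h, h'⟩; exact ⟨⟨h0.trans_le h, h'⟩, h⟩
    rw [this, integral_Icc_eq_integral_Ioc, ← intervalIntegral.integral_of_le hle,
      integral_cpow (Or.inl (by simpa using hu)), sub_add_cancel]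
  have h2 : ∀ t ∈ Ioc 0 g, ∫ x in A, F x t = (tubeVolume A t : ℂ) * (t : ℂ) ^ (u - 1) := by
    intro t ht
    have e : ∀ x, F x t = {x | Metric.infDist x (frontier A) ≤ t}.indicator
        (fun _ => (t : ℂ) ^ (u - 1)) x := fun x => by
      simp only [hF, indicator, mem_Ici, mem_ofPred_eq]
    simp only [e]
    rw [setIntegral_indicator (measurableSet_le hδm measurable_const), setIntegral_const,
      Complex.real_smul, tubeVolume, innerNhd]
    rfl
  have h3 := integral_integral_swap hFint
  rw [setIntegral_congr_fun hA.measurableSet h1, setIntegral_congr_fun measurableSet_Ioc h2,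
    integral_div, integral_sub (integrable_const _)
      (integrableOn_infDist_cpow hd hA hb hu.le), setIntegral_const, Complex.real_smul,
    div_eq_iff hu0, ← intervalIntegral.integral_of_le hg.le] at h3
  rw [distanceZeta]
  linear_combination -h3

/-- In the half-plane `Re s > d`, the zeta function of a Steiner-like generator is given by its
distance zeta function. -/
lemma generatorZeta_eq (hd : 1 ≤ d) {κ : ℕ → ℝ → ℝ} (hG : IsSteinerLike G κ)
    (hg : 0 < inradius G) {s : ℂ} (hs : (d : ℝ) < s.re) :
    generatorZeta G κ s = -(distanceZeta G (s - d) / (s - d)) := by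
  have hu : 0 < (s - d).re := by simpa using hs
  have hu0 : s - d ≠ 0 := fun h => by simp [h] at hu
  have hint : ∀ k ∈ Finset.range d, IntervalIntegrable
      (fun t : ℝ => (κ k t : ℂ) * (t : ℂ) ^ (s - k - 1)) volume 0 (inradius G) := by
    intro k hk
    have hkd := Finset.mem_range.1 hk
    have hk1 : IntegrableOn (κ k) (Icc 0 (inradius G)) :=
      (hG.locallyIntegrable k hkd).integrableOn_isCompact isCompact_Icc
    have hk2 : IntervalIntegrable (fun t => (κ k t : ℂ)) volume 0 (inradius G) := by
      rw [intervalIntegrable_iff_integrableOn_Ioc_of_le hg.le]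
      exact (hk1.mono_set Ioc_subset_Icc_self).ofReal
    have hre : 0 < (s - k - 1).re := by
      have : (k : ℝ) + 1 ≤ d := by exact_mod_cast hkd
      simp only [Complex.sub_re, Complex.natCast_re, Complex.one_re]
      linarith
    refine hk2.mul_continuousOn (Continuous.continuousOn ?_)
    exact Complex.continuous_ofReal_cpow_const hre
  have h1 : ∫ t in (0 : ℝ)..inradius G, (tubeVolume G t : ℂ) * (t : ℂ) ^ (s - d - 1) =
      ∑ k ∈ Finset.range d, ∫ t in (0 : ℝ)..inradius G, (κ k t : ℂ) * (t : ℂ) ^ (s - k - 1) := by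
    rw [← intervalIntegral.integral_finsetSum hint]
    refine intervalIntegral.integral_congr_ae (Eventually.of_forall fun t ht => ?_)
    rw [uIoc_of_le hg.le] at ht
    have ht0 : (t : ℂ) ≠ 0 := by exact_mod_cast ht.1.ne'
    rw [hG.tube t ⟨ht.1.le, ht.2⟩, Complex.ofReal_sum, Finset.sum_mul]
    refine Finset.sum_congr rfl fun k hk => ?_
    have hkd := (Finset.mem_range.1 hk).le
    rw [Complex.ofReal_mul, mul_assoc, Complex.ofReal_pow, ← Complex.cpow_natCast,
      ← Complex.cpow_add _ _ ht0, Nat.cast_sub hkd]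
    congr 2
    ring
  rw [distanceZeta_eq_integral_tubeVolume hd hG.isOpen hG.isBounded hg hu, h1, generatorZeta]
  field_simp
  ring

/-! ### Fractal sprays -/

lemma measurePreserving_isometryEquiv
    (φ : EuclideanSpace ℝ (Fin d) ≃ᵢ EuclideanSpace ℝ (Fin d)) :
    MeasurePreserving φ := by
  have e : (φ : EuclideanSpace ℝ (Fin d) → EuclideanSpace ℝ (Fin d)) =
      (fun x => x + φ 0) ∘ φ.toRealLinearIsometryEquiv := by
    funext x; simp
  rw [e]
  exact (measurePreserving_add_right volume (φ 0)).comp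
    φ.toRealLinearIsometryEquiv.measurePreserving

/-- Scaling and congruence multiply the distance zeta function by `ρ^{d+u}`. -/
lemma distanceZeta_tile {ρ : ℝ} (hρ : 0 < ρ)
    (φ : EuclideanSpace ℝ (Fin d) ≃ᵢ EuclideanSpace ℝ (Fin d)) (u : ℂ) :
    distanceZeta (φ '' (ρ • A)) u = (ρ : ℂ) ^ (d + u) * distanceZeta A u := by
  have h1 : frontier (φ '' (ρ • A)) = φ '' (ρ • frontier A) := by
    have e1 := φ.toHomeomorph.image_frontier (ρ • A)
    have e2 := (Homeomorph.smulOfNeZero ρ hρ.ne').image_frontier A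
    rw [IsometryEquiv.coe_toHomeomorph] at e1
    rw [← e1]
    congr 1
    exact e2.symm
  rw [distanceZeta, h1, (measurePreserving_isometryEquiv φ).setIntegral_image_emb
    φ.toHomeomorph.measurableEmbedding]
  simp only [Metric.infDist_image φ.isometry]
  have h2 := Measure.setIntegral_comp_smul_of_pos volume
    (fun x : EuclideanSpace ℝ (Fin d) => (Metric.infDist x (ρ • frontier A) : ℂ) ^ u) A hρ
  have h3 : ∀ x : EuclideanSpace ℝ (Fin d),
      (Metric.infDist (ρ • x) (ρ • frontier A) : ℂ) ^ u =
        (ρ : ℂ) ^ u * (Metric.infDist x (frontier A) : ℂ) ^ u := fun x => by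
    rw [infDist_smul₀ hρ.ne', Real.norm_of_nonneg hρ.le, Complex.ofReal_mul,
      Complex.mul_cpow_ofReal_nonneg hρ.le Metric.infDist_nonneg]
  rw [finrank_euclideanSpace_fin, eq_inv_smul_iff₀ (by positivity)] at h2
  simp only [h3, integral_const_mul] at h2
  rw [← h2, Complex.real_smul, Complex.ofReal_pow, distanceZeta,
    Complex.cpow_add _ _ (by exact_mod_cast hρ.ne'), Complex.cpow_natCast, mul_assoc]

/-- The boundary of a disjoint union of open sets is, seen from inside one of them, as far away as
the boundary of that set. -/
lemma infDist_frontier_iUnion (hd : 1 ≤ d) {ι : Type*}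
    {tile : ι → Set (EuclideanSpace ℝ (Fin d))} (ho : ∀ n, IsOpen (tile n))
    (hb : Bornology.IsBounded (⋃ n, tile n)) (hdisj : Pairwise (Function.onFun Disjoint tile))
    {n : ι} {x : EuclideanSpace ℝ (Fin d)} (hx : x ∈ tile n) :
    Metric.infDist x (frontier (⋃ n, tile n)) = Metric.infDist x (frontier (tile n)) := by
  have hsub := subset_iUnion tile n
  have hne := ne_univ_of_isBounded hd hb
  have hne' := ne_univ_of_isBounded hd (hb.subset hsub)
  obtain ⟨y, hy, h1, h2⟩ := exists_mem_frontier_dist_eq (ho n) hne' hx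
  have hyU : y ∈ (⋃ n, tile n)ᶜ := by
    intro hyU
    obtain ⟨m, hm⟩ := mem_iUnion.1 hyU
    rw [(ho n).frontier_eq] at hy
    have hmn : m ≠ n := fun h => hy.2 (h ▸ hm)
    obtain ⟨z, hz1, hz2⟩ := mem_closure_iff.1 hy.1 _ (ho m) hm
    exact Set.disjoint_left.1 (hdisj hmn) hz1 hz2
  rw [infDist_frontier_eq_infDist_compl (isOpen_iUnion ho) hne (hsub hx)]
  refine le_antisymm ?_ ?_
  · rw [h1]; exact Metric.infDist_le_dist_of_mem hyU
  · rw [h1, ← h2]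
    exact Metric.infDist_le_infDist_of_subset (compl_subset_compl.2 hsub) ⟨y, hyU⟩

variable {ι : Type*} {r : ι → ℝ}

/-- The distance zeta function of a spray is the sum of those of its tiles. -/
lemma hasSum_distanceZeta [Countable ι] (hd : 1 ≤ d) (hG : IsOpen G) (hT : IsFractalSpray G r T)
    {u : ℂ} (hu : 0 ≤ u.re) :
    HasSum (fun n => (r n : ℂ) ^ (d + u) * distanceZeta G u) (distanceZeta T u) := by
  obtain ⟨tile, hTt, hdisj, htile⟩ := hT.tiles
  have ho : ∀ n, IsOpen (tile n) := fun n => by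
    obtain ⟨φ, hφ⟩ := htile n
    rw [hφ]
    exact φ.toHomeomorph.isOpenMap _ (hG.smul₀ (hT.ratio_pos n).ne')
  have h := hasSum_integral_iUnion (fun n => (ho n).measurableSet) hdisj
    (hTt ▸ integrableOn_infDist_cpow hd hT.isOpen hT.isBounded hu)
  rw [← hTt] at h
  have e : (fun n => (r n : ℂ) ^ (d + u) * distanceZeta G u) =
      fun n => ∫ x in tile n, (Metric.infDist x (frontier T) : ℂ) ^ u := by
    funext n
    obtain ⟨φ, hφ⟩ := htile n
    rw [← distanceZeta_tile (hT.ratio_pos n) φ, ← hφ, distanceZeta]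
    refine setIntegral_congr_fun (ho n).measurableSet fun x hx => ?_
    have hx' := infDist_frontier_iUnion hd ho (hTt ▸ hT.isBounded) hdisj hx
    rw [← hTt] at hx'
    simp only [hx']
  rw [e]
  exact h

/-- The scaling zeta function converges for real `x ≥ d`, as the distance zeta function of the whole
spray does; at `x = d` this says that the tiles have finite total volume. -/
lemma summable_rpow [Countable ι] (hd : 1 ≤ d) (hG : IsOpen G) (hGb : Bornology.IsBounded G)
    (hGn : G.Nonempty) (hT : IsFractalSpray G r T) {x : ℝ} (hx : d ≤ x) :
    Summable fun n => r n ^ x := by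
  have h := hasSum_distanceZeta hd hG hT (u := (x - d : ℝ)) (by simpa using hx)
  have h1 := (summable_mul_right_iff (distanceZeta_ofReal_ne_zero hd hG hGb hGn
    (sub_nonneg.2 hx))).1 h.summable
  refine h1.norm.congr fun n => ?_
  rw [Complex.norm_cpow_eq_rpow_re_of_pos (hT.ratio_pos n)]
  simp

lemma hasSum_scalingZeta [Countable ι] (hr : ∀ n, 0 < r n) {s : ℂ}
    (hsum : Summable fun n => r n ^ s.re) :
    HasSum (fun n => (r n : ℂ) ^ s) (scalingZeta r s) := by
  have hpow : ∀ n, (((r n)⁻¹ : ℝ) : ℂ) ^ (-s) = (r n : ℂ) ^ s := fun n => by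
    rw [Complex.ofReal_inv, Complex.inv_cpow _ _ (by
      rw [Complex.arg_ofReal_of_nonneg (hr n).le]; exact Real.pi_pos.ne), Complex.cpow_neg, inv_inv]
  have h := hasSum_integral_sum_dirac (f := fun x : ℝ => (x : ℂ) ^ (-s))
    (x := fun n => (r n)⁻¹) (c := fun _ => 1) (fun _ => ENNReal.one_ne_top) (by
      refine hsum.congr fun n => ?_
      rw [hpow, Complex.norm_cpow_eq_rpow_re_of_pos (hr n)]
      simp)
  have hrestr : (stringMeasure r).restrict (Ioi 0) =
      Measure.sum fun n => (1 : ENNReal) • Measure.dirac (r n)⁻¹ := by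
    rw [stringMeasure, Measure.restrict_sum _ measurableSet_Ioi]
    congr 1
    funext n
    rw [restrict_dirac' measurableSet_Ioi, if_pos (show (r n)⁻¹ ∈ Ioi 0 from inv_pos.2 (hr n)),
      one_smul]
  rw [scalingZeta, hrestr]
  simpa only [ENNReal.toReal_one, one_smul, hpow] using h

/-- The scaling zeta function is bounded on vertical strips in `Re s ≥ d`; in particular, none of its
continuations has a pole on the line `Re s = d`. -/
lemma exists_norm_scalingZeta_le [Countable ι] (hr : ∀ n, 0 < r n)
    (hsum : ∀ x : ℝ, (d : ℝ) ≤ x → Summable fun n => r n ^ x) (X : ℝ) :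
    ∃ B, ∀ s : ℂ, (d : ℝ) ≤ s.re → s.re ≤ X → ‖scalingZeta r s‖ ≤ B := by
  refine ⟨(∑' n, r n ^ (d : ℝ)) + ∑' n, r n ^ (max X d), fun s h1 h2 => ?_⟩
  have hs1 := hsum d le_rfl
  have hs2 := hsum (max X d) (le_max_right _ _)
  rw [← (hasSum_scalingZeta hr (hsum s.re h1)).tsum_eq, ← hs1.tsum_add hs2]
  refine tsum_of_norm_bounded (hs1.add hs2).hasSum fun n => ?_
  rw [Complex.norm_cpow_eq_rpow_re_of_pos (hr n)]
  rcases le_total (r n) 1 with h | h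
  · exact (Real.rpow_le_rpow_of_exponent_ge (hr n) h h1).trans
      (le_add_of_nonneg_right (Real.rpow_nonneg (hr n).le _))
  · exact (Real.rpow_le_rpow_of_exponent_le h (h2.trans (le_max_left _ _))).trans
      (le_add_of_nonneg_left (Real.rpow_nonneg (hr n).le _))

/-- The geometric zeta function of a spray is the distance zeta function of the whole spray, divided
by `-(s - d)`. -/
lemma scalingZeta_mul_generatorZeta [Countable ι] (hd : 1 ≤ d) {κ : ℕ → ℝ → ℝ}
    (hG : IsSteinerLike G κ) (hg : 0 < inradius G) (hT : IsFractalSpray G r T)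
    (hsum : ∀ x : ℝ, (d : ℝ) ≤ x → Summable fun n => r n ^ x) {s : ℂ} (hs : (d : ℝ) < s.re) :
    scalingZeta r s * generatorZeta G κ s = -(distanceZeta T (s - d) / (s - d)) := by
  have h1 := hasSum_distanceZeta hd hG.isOpen hT (u := s - d) (by simpa using hs.le)
  simp only [add_sub_cancel] at h1
  have h2 := (hasSum_scalingZeta hT.ratio_pos (hsum s.re hs.le)).mul_right (distanceZeta G (s - d))
  rw [generatorZeta_eq hd hG hg hs, ← h2.unique h1]
  ring

end Distance

/-! ### Pairing powers with test functions -/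

section TestFunctions

variable {d : ℕ} {φ : ℝ → ℂ}

/-- The pairing of `ε ↦ ε^{d-s}` with a test function, that is, the Mellin transform of the test
function at `d + 1 - s`. -/
noncomputable def powerPairing (d : ℕ) (φ : ℝ → ℂ) (s : ℂ) : ℂ :=
  pairing (fun ε => (ε : ℂ) ^ ((d : ℂ) - s)) φ

lemma pairing_geometricZeta (Zη M : ℂ → ℂ) (φ : ℝ → ℂ) (s : ℂ) :
    pairing (fun ε => geometricZeta d Zη M ε s) φ = powerPairing d φ s * (Zη s * M s) := by
  rw [powerPairing, pairing, pairing, ← integral_mul_const]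
  refine integral_congr_ae (Eventually.of_forall fun ε => ?_)
  simp only [geometricZeta]
  ring

lemma IsTestFunction.exists_tsupport_subset (hφ : IsTestFunction φ) :
    ∃ p q : ℝ, 0 < p ∧ p < q ∧ tsupport φ ⊆ Ioo p q := by
  rcases (tsupport φ).eq_empty_or_nonempty with h | h
  · exact ⟨1, 2, one_pos, one_lt_two, by simp [h]⟩
  · obtain ⟨a, ha⟩ := IsCompact.exists_isLeast hφ.compact.isCompact h
    obtain ⟨b, hb⟩ := IsCompact.exists_isGreatest hφ.compact.isCompact h
    have ha0 : 0 < a := hφ.support ha.1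
    have hab : a ≤ b := ha.2 hb.1
    refine ⟨a / 2, b + 1, by linarith, by linarith, fun x hx => ⟨?_, ?_⟩⟩
    · linarith [ha.2 hx]
    · linarith [hb.2 hx]

lemma IsTestFunction.continuous (hφ : IsTestFunction φ) : Continuous φ := hφ.smooth.continuous

lemma IsTestFunction.integrable (hφ : IsTestFunction φ) : Integrable φ :=
  hφ.continuous.integrable_of_hasCompactSupport hφ.compact

lemma exists_norm_cpow_le {p q : ℝ} (hp : 0 < p) (a b : ℝ) :
    ∃ C, 0 ≤ C ∧ ∀ ε ∈ Icc p q, ∀ s : ℂ, a ≤ s.re → s.re ≤ b → ‖(ε : ℂ) ^ s‖ ≤ C := by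
  have hk : IsCompact (Icc p q ×ˢ Icc a b) := isCompact_Icc.prod isCompact_Icc
  obtain ⟨C, hC⟩ := hk.exists_bound_of_continuousOn (f := fun z : ℝ × ℝ => z.1 ^ z.2) (by
    refine ContinuousOn.rpow continuous_fst.continuousOn continuous_snd.continuousOn ?_
    exact fun z hz => Or.inl (hp.trans_le hz.1.1).ne')
  refine ⟨max C 0, le_max_right _ _, fun ε hε s h1 h2 => ?_⟩
  have h := hC (ε, s.re) ⟨hε, h1, h2⟩
  have hε0 : 0 < ε := hp.trans_le hε.1
  rw [Complex.norm_cpow_eq_rpow_re_of_pos hε0]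
  exact ((le_abs_self _).trans h).trans (le_max_left _ _)

lemma pairing_eq_intervalIntegral {p q : ℝ} (hp : 0 < p) (hpq : p < q)
    (hs : tsupport φ ⊆ Ioo p q) (u : ℝ → ℂ) :
    pairing u φ = ∫ ε in p..q, u ε * φ ε := by
  rw [intervalIntegral.integral_of_le hpq.le, pairing]
  refine setIntegral_eq_of_subset_of_forall_sdiff_eq_zero measurableSet_Ioi
    (fun x hx => hp.trans hx.1) fun x hx => ?_
  rw [image_eq_zero_of_notMem_tsupport fun h => hx.2 (Ioo_subset_Ioc_self (hs h)), mul_zero]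

lemma powerPairing_eq_mellin (s : ℂ) : powerPairing d φ s = mellin φ (d + 1 - s) := by
  rw [powerPairing, pairing, mellin]
  refine integral_congr_ae (Eventually.of_forall fun ε => ?_)
  simp only [smul_eq_mul]
  congr 2
  ring

lemma differentiable_powerPairing (hφ : IsTestFunction φ) :
    Differentiable ℂ (powerPairing d φ) := by
  obtain ⟨p, q, hp, hpq, hs⟩ := hφ.exists_tsupport_subset
  have h0 : ∀ x, x ∉ Ioo p q → φ x = 0 := fun x hx =>
    image_eq_zero_of_notMem_tsupport fun h => hx (hs h)
  intro s
  have h1 : DifferentiableAt ℂ (mellin φ) (d + 1 - s) := by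
    refine mellin_differentiableAt_of_isBigO_rpow (a := ((d : ℂ) + 1 - s).re + 1)
      (b := ((d : ℂ) + 1 - s).re - 1) (hφ.continuous.locallyIntegrable.locallyIntegrableOn _)
      ?_ (by linarith) ?_ (by linarith)
    · refine EventuallyEq.trans_isBigO ?_ (Asymptotics.isBigO_zero _ _)
      filter_upwards [eventually_ge_atTop q] with x hx using h0 x fun h => h.2.not_ge hx
    · refine EventuallyEq.trans_isBigO ?_ (Asymptotics.isBigO_zero _ _)
      filter_upwards [mem_nhdsWithin_of_mem_nhds (Iio_mem_nhds hp)] with x hx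
        using h0 x fun h => h.1.not_ge (le_of_lt hx)
  have h2 : powerPairing d φ = fun s => mellin φ (d + 1 - s) := funext powerPairing_eq_mellin
  rw [h2]
  exact DifferentiableAt.comp (g := mellin φ) s h1 (by fun_prop)

lemma exists_norm_powerPairing_le (hφ : IsTestFunction φ) (a b : ℝ) :
    ∃ C, 0 ≤ C ∧ ∀ s : ℂ, a ≤ s.re → s.re ≤ b → ‖powerPairing d φ s‖ ≤ C := by
  obtain ⟨p, q, hp, hpq, hs⟩ := hφ.exists_tsupport_subset
  obtain ⟨C, hC0, hC⟩ := exists_norm_cpow_le (q := q) hp (d - b) (d - a)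
  refine ⟨C * ∫ ε, ‖φ ε‖, mul_nonneg hC0 (integral_nonneg fun _ => norm_nonneg _),
    fun s h1 h2 => ?_⟩
  rw [powerPairing, pairing]
  refine (norm_integral_le_of_norm_le (g := fun ε => C * ‖φ ε‖)
    (hφ.integrable.norm.const_mul C).integrableOn (Eventually.of_forall fun ε => ?_)).trans ?_
  · by_cases hε : ε ∈ Ioo p q
    · rw [norm_mul]
      exact mul_le_mul_of_nonneg_right (hC ε (Ioo_subset_Icc_self hε) _ (by
        simp only [Complex.sub_re, Complex.natCast_re]; linarith) (by
        simp only [Complex.sub_re, Complex.natCast_re]; linarith)) (norm_nonneg _)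
    · rw [image_eq_zero_of_notMem_tsupport fun h => hε (hs h)]
      simp
  · rw [integral_const_mul]
    exact mul_le_mul_of_nonneg_left (setIntegral_le_integral hφ.integrable.norm
      (Eventually.of_forall fun _ => norm_nonneg _)) hC0

lemma IsTestFunction.neg_mul_deriv (hφ : IsTestFunction φ) :
    IsTestFunction fun ε => -((ε : ℂ) * deriv φ ε) := by
  have hsub : tsupport (fun ε : ℝ => -((ε : ℂ) * deriv φ ε)) ⊆ tsupport φ := by
    refine closure_minimal (fun x hx => ?_) (isClosed_tsupport φ)
    refine support_deriv_subset fun h => hx ?_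
    simp [h]
  refine ⟨?_, hφ.compact.of_isClosed_subset (isClosed_tsupport _) hsub, hsub.trans hφ.support⟩
  exact (Complex.ofRealCLM.contDiff.mul (contDiff_infty_iff_deriv.1 hφ.smooth).2).neg

/-- Integration by parts. -/
lemma powerPairing_neg_mul_deriv (hφ : IsTestFunction φ) (s : ℂ) :
    powerPairing d (fun ε => -((ε : ℂ) * deriv φ ε)) s = (d + 1 - s) * powerPairing d φ s := by
  obtain ⟨p, q, hp, hpq, hs⟩ := hφ.exists_tsupport_subset
  have hs' : tsupport (fun ε : ℝ => -((ε : ℂ) * deriv φ ε)) ⊆ Ioo p q := by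
    refine (closure_minimal (fun x hx => ?_) (isClosed_tsupport φ)).trans hs
    refine support_deriv_subset fun h => hx ?_
    simp [h]
  have hpos : ∀ x ∈ uIcc p q, 0 < x := fun x hx => by
    rw [uIcc_of_le hpq.le] at hx
    exact hp.trans_le hx.1
  have hcont : ∀ z : ℂ, ContinuousOn (fun x : ℝ => (x : ℂ) ^ z) (uIcc p q) := fun z x hx =>
    (Complex.continuousAt_ofReal_cpow_const x z (Or.inr (hpos x hx).ne')).continuousWithinAt
  have hφ' : Continuous (deriv φ) := (contDiff_infty_iff_deriv.1 hφ.smooth).2.continuous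
  have h0 : ∀ x, x ∉ Ioo p q → φ x = 0 := fun x hx =>
    image_eq_zero_of_notMem_tsupport fun h => hx (hs h)
  have hderiv : ∀ x ∈ uIcc p q, HasDerivAt (fun y : ℝ => (y : ℂ) ^ (d + 1 - s))
      ((d + 1 - s) * (x : ℂ) ^ (d - s)) x := fun x hx => by
    have hx0 : (x : ℂ) ∈ Complex.slitPlane := Or.inl (by simpa using hpos x hx)
    have h1 := ((hasDerivAt_id (x : ℂ)).cpow_const (c := d + 1 - s) hx0).comp_ofReal
    have e : (d : ℂ) + 1 - s - 1 = d - s := by ring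
    simpa [e] using h1
  rw [powerPairing, powerPairing, pairing_eq_intervalIntegral hp hpq hs,
    pairing_eq_intervalIntegral hp hpq hs']
  have key := intervalIntegral.integral_mul_deriv_eq_deriv_mul hderiv
    (v := φ) (v' := deriv φ)
    (fun x _ => ((contDiff_infty_iff_deriv.1 hφ.smooth).1 x).hasDerivAt)
    (((hcont _).const_smul ((d : ℂ) + 1 - s)).intervalIntegrable)
    (hφ'.intervalIntegrable _ _)
  rw [h0 q fun h => h.2.false, h0 p fun h => h.1.false, mul_zero, mul_zero, sub_zero,
    zero_sub] at key
  simp only [mul_assoc, intervalIntegral.integral_const_mul] at key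
  rw [← neg_eq_iff_eq_neg.2 key, ← intervalIntegral.integral_neg]
  refine intervalIntegral.integral_congr fun x hx => ?_
  have hx0 : (x : ℂ) ≠ 0 := by exact_mod_cast (hpos x hx).ne'
  have e : (d : ℂ) + 1 - s = (d - s) + 1 := by ring
  simp only [e, Complex.cpow_add _ _ hx0, Complex.cpow_one]
  ring

lemma exists_norm_pow_mul_powerPairing_le (N : ℕ) (a b : ℝ) : ∀ {φ : ℝ → ℂ}, IsTestFunction φ →
    ∃ C, 0 ≤ C ∧ ∀ s : ℂ, a ≤ s.re → s.re ≤ b → |s.im| ^ N * ‖powerPairing d φ s‖ ≤ C := by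
  induction N with
  | zero =>
    intro φ hφ
    simpa using exists_norm_powerPairing_le hφ a b
  | succ N ih =>
    intro φ hφ
    obtain ⟨C, hC0, hC⟩ := ih hφ.neg_mul_deriv
    refine ⟨C, hC0, fun s h1 h2 => le_trans ?_ (hC s h1 h2)⟩
    rw [powerPairing_neg_mul_deriv hφ, norm_mul, pow_succ, mul_assoc]
    refine mul_le_mul_of_nonneg_left (mul_le_mul_of_nonneg_right ?_ (norm_nonneg _)) (by positivity)
    simpa using Complex.abs_im_le_norm ((d : ℂ) + 1 - s)

/-- The pairings of a test function with powers decay rapidly on vertical strips. -/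
lemma exists_norm_powerPairing_le_rpow (hφ : IsTestFunction φ) (N : ℕ) (a b : ℝ) :
    ∃ C, 0 ≤ C ∧ ∀ s : ℂ, a ≤ s.re → s.re ≤ b →
      ‖powerPairing d φ s‖ ≤ C * (1 + |s.im|) ^ (-(N : ℝ)) := by
  obtain ⟨C, hC0, hC⟩ := exists_norm_powerPairing_le (d := d) hφ a b
  obtain ⟨C', hC0', hC'⟩ := exists_norm_pow_mul_powerPairing_le (d := d) N a b hφ
  refine ⟨2 ^ N * (C + C'), by positivity, fun s h1 h2 => ?_⟩
  rw [Real.rpow_neg (by positivity), Real.rpow_natCast, ← div_eq_mul_inv,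
    le_div_iff₀ (by positivity)]
  have h3 : (1 + |s.im|) ^ N ≤ 2 ^ N * (1 + |s.im| ^ N) := by
    rcases le_total 1 |s.im| with h | h
    · calc (1 + |s.im|) ^ N ≤ (2 * |s.im|) ^ N := by gcongr; linarith
        _ = 2 ^ N * |s.im| ^ N := mul_pow _ _ _
        _ ≤ _ := by gcongr; linarith
    · calc (1 + |s.im|) ^ N ≤ 2 ^ N := by gcongr; linarith
        _ ≤ _ := le_mul_of_one_le_right (by positivity)
            (by linarith [pow_nonneg (abs_nonneg s.im) N])
  calc ‖powerPairing d φ s‖ * (1 + |s.im|) ^ N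
      ≤ ‖powerPairing d φ s‖ * (2 ^ N * (1 + |s.im| ^ N)) := by gcongr
    _ = 2 ^ N * (‖powerPairing d φ s‖ + |s.im| ^ N * ‖powerPairing d φ s‖) := by ring
    _ ≤ 2 ^ N * (C + C') := by gcongr; exacts [hC s h1 h2, hC' s h1 h2]

/-- Rescaling the test function multiplies its pairing with `ε^{d-s}` by `a^{d-s}`. -/
lemma powerPairing_rescale (φ : ℝ → ℂ) {a : ℝ} (ha : 0 < a) (s : ℂ) :
    powerPairing d (fun ε => (a : ℂ)⁻¹ * φ (ε / a)) s = (a : ℂ) ^ (d - s) * powerPairing d φ s := by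
  rw [powerPairing_eq_mellin, powerPairing_eq_mellin]
  have h := mellin_comp_mul_left (fun ε => (a : ℂ)⁻¹ * φ ε) (d + 1 - s) (inv_pos.2 ha)
  have h2 := mellin_const_smul φ (d + 1 - s) (a : ℂ)⁻¹
  simp only [smul_eq_mul] at h h2
  have e : (fun ε => (a : ℂ)⁻¹ * φ (ε / a)) = fun t => (a : ℂ)⁻¹ * φ (a⁻¹ * t) := by
    funext ε
    rw [div_eq_inv_mul]
  have ha' : (a : ℂ) ≠ 0 := by exact_mod_cast ha.ne'
  rw [e, h, h2, Complex.ofReal_inv, Complex.inv_cpow _ _ (by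
    rw [Complex.arg_ofReal_of_nonneg ha.le]; exact Real.pi_pos.ne), Complex.cpow_neg, inv_inv,
    show (d : ℂ) + 1 - s = (d - s) + 1 by ring, Complex.cpow_add _ _ ha', Complex.cpow_one]
  field_simp

/-- Pairing with a test function commutes with integration along a path. -/
lemma pairing_intervalIntegral (hφ : IsTestFunction φ) {γ g : ℝ → ℂ} (hγ : Continuous γ) {a b : ℝ}
    (hg : IntervalIntegrable g volume a b) :
    pairing (fun ε => ∫ t in a..b, (ε : ℂ) ^ (d - γ t) * g t) φ =
      ∫ t in a..b, powerPairing d φ (γ t) * g t := by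
  obtain ⟨p, q, hp, hpq, hs⟩ := hφ.exists_tsupport_subset
  obtain ⟨B, hB⟩ := (isCompact_uIcc (a := a) (b := b)).exists_bound_of_continuousOn
    hγ.continuousOn
  obtain ⟨C, hC0, hC⟩ := exists_norm_cpow_le (q := q) hp (d - B) (d + B)
  have hint : Integrable (Function.uncurry fun (t ε : ℝ) => (ε : ℂ) ^ (d - γ t) * (g t * φ ε))
      ((volume.restrict (uIoc a b)).prod (volume.restrict (Ioi 0))) := by
    have h1 := Integrable.mul_prod (μ := volume.restrict (uIoc a b))
      (ν := volume.restrict (Ioi (0 : ℝ))) (intervalIntegrable_iff.1 hg) hφ.integrable.integrableOn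
    refine (h1.norm.const_mul C).mono' (AEStronglyMeasurable.mul ?_ h1.aestronglyMeasurable) ?_
    · have : Measurable fun z : ℝ × ℝ => (z.2 : ℂ) ^ ((d : ℂ) - γ z.1) :=
        (Complex.measurable_ofReal.comp measurable_snd).pow
          (measurable_const.sub (hγ.measurable.comp measurable_fst))
      exact this.aestronglyMeasurable
    · rw [Measure.prod_restrict]
      filter_upwards [ae_restrict_mem (measurableSet_uIoc.prod measurableSet_Ioi)] with z hz
      by_cases hε : z.2 ∈ Ioo p q
      · rw [Function.uncurry_def, norm_mul]
        refine mul_le_mul_of_nonneg_right (hC _ (Ioo_subset_Icc_self hε) _ ?_ ?_) (norm_nonneg _)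
        all_goals
          have := (Complex.abs_re_le_norm _).trans (hB z.1 (uIoc_subset_uIcc hz.1))
          rw [abs_le] at this
          simp only [Complex.sub_re, Complex.natCast_re]
          linarith
      · have h0 : φ z.2 = 0 := image_eq_zero_of_notMem_tsupport fun h => hε (hs h)
        simp [Function.uncurry_def, h0]
  have h := intervalIntegral_integral_swap hint
  rw [pairing]
  calc ∫ ε in Ioi (0 : ℝ), (∫ t in a..b, (ε : ℂ) ^ (d - γ t) * g t) * φ ε
      = ∫ ε in Ioi (0 : ℝ), ∫ t in a..b, (ε : ℂ) ^ (d - γ t) * (g t * φ ε) := by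
        refine integral_congr_ae (Eventually.of_forall fun ε => ?_)
        simp only [← mul_assoc]
        rw [intervalIntegral.integral_mul_const]
    _ = ∫ t in a..b, ∫ ε in Ioi (0 : ℝ), (ε : ℂ) ^ (d - γ t) * (g t * φ ε) := h.symm
    _ = _ := by
        refine intervalIntegral.integral_congr fun t _ => ?_
        simp only [powerPairing, pairing]
        rw [← integral_mul_const]
        refine integral_congr_ae (Eventually.of_forall fun ε => ?_)
        simp only
        ring

/-- Taking residues commutes with pairing with a test function. -/
lemma pairing_residueAt (hφ : IsTestFunction φ) {Z : ℂ → ℂ} {w : ℂ} (hZ : MeromorphicAt Z w) :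
    pairing (fun ε => residueAt (fun s => (ε : ℂ) ^ (d - s) * Z s) w) φ =
      residueAt (fun s => powerPairing d φ s * Z s) w := by
  obtain ⟨R, hR, hRZ⟩ := exists_punctured_analytic hZ
  have h1 : ∀ ε ∈ Ioi (0 : ℝ), residueAt (fun s => (ε : ℂ) ^ (d - s) * Z s) w =
      (2 * Real.pi * Complex.I)⁻¹ * ∫ θ in (0 : ℝ)..2 * Real.pi,
        (ε : ℂ) ^ (d - circleMap w R θ) * (deriv (circleMap w R) θ * Z (circleMap w R θ)) := by
    intro ε hε
    have hε' : (ε : ℂ) ≠ 0 := by exact_mod_cast (ne_of_gt hε)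
    rw [residueAt_eq_circleIntegral hR fun s hs hsR => DifferentiableAt.fun_mul
      (DifferentiableAt.const_cpow (by fun_prop) (Or.inl hε'))
      (hRZ s hs hsR).differentiableAt, circleIntegral]
    congr 1
    refine intervalIntegral.integral_congr fun θ _ => ?_
    simp only [smul_eq_mul]
    ring
  rw [residueAt_eq_circleIntegral hR fun s hs hsR => DifferentiableAt.fun_mul
      (differentiable_powerPairing hφ s) (hRZ s hs hsR).differentiableAt, circleIntegral]
  have h2 := pairing_intervalIntegral (d := d) hφ (γ := circleMap w R)
    (g := fun θ => deriv (circleMap w R) θ * Z (circleMap w R θ)) (a := 0) (b := 2 * Real.pi)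
    (continuous_circleMap w R) (by
      refine Continuous.intervalIntegrable ?_ _ _
      refine continuous_iff_continuousAt.2 fun θ => ContinuousAt.mul ?_ ?_
      · rw [show deriv (circleMap w R) = fun θ => circleMap 0 R θ * Complex.I from
          funext fun θ => deriv_circleMap w R θ]
        exact ((continuous_circleMap 0 R).mul continuous_const).continuousAt
      · exact ContinuousAt.comp (f := circleMap w R) (g := Z)
          (hRZ _ (circleMap_ne_center hR.ne') (by simp [abs_of_pos hR])).continuousAt
          (continuous_circleMap w R).continuousAt)
  have h3 : pairing (fun ε => residueAt (fun s => (ε : ℂ) ^ (d - s) * Z s) w) φ =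
      (2 * Real.pi * Complex.I)⁻¹ * pairing (fun ε => ∫ θ in (0 : ℝ)..2 * Real.pi,
        (ε : ℂ) ^ (d - circleMap w R θ) * (deriv (circleMap w R) θ * Z (circleMap w R θ))) φ := by
    rw [pairing, pairing, ← integral_const_mul]
    refine setIntegral_congr_fun measurableSet_Ioi fun ε hε => ?_
    simp only [h1 ε hε, mul_assoc]
  rw [h3, h2]
  congr 1
  refine intervalIntegral.integral_congr fun θ _ => ?_
  simp only [smul_eq_mul]
  ring

end TestFunctions

/-! ### Tube volumes as truncated inverse Mellin transforms -/

section Perron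

variable {d : ℕ} {A : Set (EuclideanSpace ℝ (Fin d))} {c : ℝ}

lemma perronIntegrand_log {x ε : ℝ} (hx : 0 < x) (hε : 0 < ε) (t : ℝ) :
    perronIntegrand c (Real.log (x / ε)) t =
      (ε : ℂ) ^ (-(c + t * Complex.I) : ℂ) * ((x : ℂ) ^ (c + t * Complex.I : ℂ) /
        (c + t * Complex.I)) := by
  have hx' : (x : ℂ) ≠ 0 := by exact_mod_cast hx.ne'
  have hε' : (ε : ℂ) ≠ 0 := by exact_mod_cast hε.ne'
  rw [perronIntegrand, Complex.cpow_def_of_ne_zero hx', Complex.cpow_def_of_ne_zero hε',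
    ← mul_div_assoc, ← Complex.exp_add, Real.log_div hx.ne' hε.ne', Complex.ofReal_sub,
    Complex.ofReal_log hx.le, Complex.ofReal_log hε.le]
  congr 2
  ring

/-- Fubini: the truncated inverse Mellin transform of the distance zeta function is an average of
truncated Perron integrals. -/
lemma integral_distanceZeta_div (hd : 1 ≤ d) (hA : IsOpen A) (hb : Bornology.IsBounded A)
    (hc : 0 < c) {ε : ℝ} (hε : 0 < ε) (p q : ℝ) :
    ∫ t in p..q, (ε : ℂ) ^ (-(c + t * Complex.I) : ℂ) *
        (-(distanceZeta A (c + t * Complex.I) / (c + t * Complex.I))) =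
      -∫ x in A, ∫ t in p..q, perronIntegrand c
        (Real.log (Metric.infDist x (frontier A) / ε)) t := by
  have hne := ne_univ_of_isBounded hd hb
  have : IsFiniteMeasure (volume.restrict A) :=
    isFiniteMeasure_restrict.2 hb.measure_lt_top.ne
  have : IsFiniteMeasure (volume.restrict (uIoc p q)) :=
    inferInstanceAs (IsFiniteMeasure (volume.restrict (Ioc _ _)))
  have hint : Integrable (Function.uncurry fun (t : ℝ) (x : EuclideanSpace ℝ (Fin d)) =>
      perronIntegrand c (Real.log (Metric.infDist x (frontier A) / ε)) t)
      ((volume.restrict (uIoc p q)).prod (volume.restrict A)) := by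
    refine Integrable.of_bound (C := Real.exp (Real.log (inradius A / ε) * c) / c) ?_ ?_
    · refine ((continuous_perronIntegrand hc).measurable.comp
        (g := fun z : ℝ × ℝ => perronIntegrand c z.1 z.2) (f := fun z : ℝ × EuclideanSpace ℝ (Fin d)
          => (Real.log (Metric.infDist z.2 (frontier A) / ε), z.1)) ?_).aestronglyMeasurable
      exact (Real.measurable_log.comp (((Metric.continuous_infDist_pt _).measurable.comp
        measurable_snd).div_const ε)).prodMk measurable_fst
    · rw [Measure.prod_restrict]
      filter_upwards [ae_restrict_mem (measurableSet_uIoc.prod hA.measurableSet)] with z hz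
      refine (norm_perronIntegrand_le hc _ _).trans ?_
      have h0 := infDist_frontier_pos hA hne hz.2
      have h1 := infDist_frontier_le_inradius hd hA hb hz.2
      gcongr
  rw [← intervalIntegral_integral_swap hint, ← intervalIntegral.integral_neg]
  refine intervalIntegral.integral_congr fun t _ => ?_
  rw [mul_neg, neg_inj, distanceZeta, ← integral_div, ← integral_const_mul]
  refine setIntegral_congr_fun hA.measurableSet fun x hx => ?_
  exact (perronIntegrand_log (infDist_frontier_pos hA hne hx) hε t).symm

variable {a b : ℕ → ℝ}

/-- The bound that allows dominated convergence after pairing with a test function supported in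
`[p, ∞)`. -/
lemma exists_norm_integral_distanceZeta_div_le (hd : 1 ≤ d) (hA : IsOpen A)
    (hb : Bornology.IsBounded A) (hc : 0 < c) {p : ℝ} (hp : 0 < p) (ha : ∀ᶠ n in atTop, 0 < a n)
    (hb' : ∀ᶠ n in atTop, 0 < b n) (hab : Tendsto (fun n => b n / a n) atTop (𝓝 1)) :
    ∃ B, ∀ᶠ n in atTop, ∀ ε, p ≤ ε → ‖∫ t in (-(a n))..(b n),
      (ε : ℂ) ^ (-(c + t * Complex.I) : ℂ) *
        (-(distanceZeta A (c + t * Complex.I) / (c + t * Complex.I)))‖ ≤ B := by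
  obtain ⟨B, hB⟩ := exists_norm_integral_perronIntegrand_le hc (Real.log (inradius A / p))
    ha hb' hab
  refine ⟨B * volume.real A, hB.mono fun n hn ε hε => ?_⟩
  rw [integral_distanceZeta_div hd hA hb hc (hp.trans_le hε), norm_neg]
  refine norm_setIntegral_le_of_norm_le_const hb.measure_lt_top fun x hx => hn _ ?_
  have h0 := infDist_frontier_pos hA (ne_univ_of_isBounded hd hb) hx
  have h1 := infDist_frontier_le_inradius hd hA hb hx
  have : 0 < ε := hp.trans_le hε
  gcongr
  exact h0.le.trans h1

/-- Perron's formula for the tube volume: the level sets of the distance function, where the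
truncated integrals do not converge to the right value, are null sets. -/
lemma tendsto_integral_distanceZeta_div (hd : 1 ≤ d) (hA : IsOpen A)
    (hb : Bornology.IsBounded A) (hc : 0 < c) {ε : ℝ} (hε : 0 < ε) (ha : ∀ᶠ n in atTop, 0 < a n)
    (hb' : Tendsto b atTop atTop) (hab : Tendsto (fun n => b n / a n) atTop (𝓝 1)) :
    Tendsto (fun n => ∫ t in (-(a n))..(b n), (ε : ℂ) ^ (-(c + t * Complex.I) : ℂ) *
        (-(distanceZeta A (c + t * Complex.I) / (c + t * Complex.I)))) atTop
      (𝓝 (2 * Real.pi * (tubeVolume A ε - volume.real A))) := by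
  have hne := ne_univ_of_isBounded hd hb
  obtain ⟨B, hB⟩ := exists_norm_integral_perronIntegrand_le hc (Real.log (inradius A / ε)) ha
    (hb'.eventually_gt_atTop 0) hab
  have hmδ : Measurable fun x : EuclideanSpace ℝ (Fin d) => Metric.infDist x (frontier A) :=
    (Metric.continuous_infDist_pt _).measurable
  have hmeas : MeasurableSet {x : EuclideanSpace ℝ (Fin d) | ε < Metric.infDist x (frontier A)} :=
    measurableSet_lt measurable_const hmδ
  have hlim : Tendsto (fun n => ∫ x in A, ∫ t in (-(a n))..(b n), perronIntegrand c
      (Real.log (Metric.infDist x (frontier A) / ε)) t) atTop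
      (𝓝 (∫ x in A, {x : EuclideanSpace ℝ (Fin d) | ε < Metric.infDist x (frontier A)}.indicator
        (fun _ => (2 * Real.pi : ℂ)) x)) := by
    refine tendsto_integral_filter_of_dominated_convergence (fun _ => B) ?_ ?_
      (integrableOn_const hb.measure_lt_top.ne) ?_
    · refine Eventually.of_forall fun n => ?_
      refine (Continuous.measurable (f := fun y : ℝ => ∫ t in (-(a n))..(b n),
        perronIntegrand c y t) ?_).comp (Real.measurable_log.comp (hmδ.div_const ε))
        |>.aestronglyMeasurable
      exact intervalIntegral.continuous_parametric_intervalIntegral_of_continuous'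
        (continuous_perronIntegrand hc) _ _
    · refine hB.mono fun n hn => (ae_restrict_iff' hA.measurableSet).2
        (Eventually.of_forall fun x hx => hn _ ?_)
      have h0 := infDist_frontier_pos hA hne hx
      have h1 := infDist_frontier_le_inradius hd hA hb hx
      gcongr
    · have hnull : ∀ᵐ x ∂volume, ¬ (x ∈ A ∧ Metric.infDist x (frontier A) = ε) :=
        measure_eq_zero_iff_ae_notMem.1 (volume_level_set_eq_zero hd hA hb hε)
      rw [ae_restrict_iff' hA.measurableSet]
      filter_upwards [hnull] with x hx hxA
      have h0 := infDist_frontier_pos hA hne hxA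
      have hxε : Metric.infDist x (frontier A) ≠ ε := fun h => hx ⟨hxA, h⟩
      have hlog : Real.log (Metric.infDist x (frontier A) / ε) ≠ 0 := by
        refine Real.log_ne_zero_of_pos_of_ne_one (by positivity) fun h => hxε ?_
        rwa [div_eq_one_iff_eq hε.ne'] at h
      have h := tendsto_integral_perronIntegrand hc hlog ha hb' hab
      have hiff : 0 < Real.log (Metric.infDist x (frontier A) / ε) ↔
          ε < Metric.infDist x (frontier A) := by
        rw [Real.log_pos_iff (by positivity), one_lt_div hε]
      simpa only [indicator_apply, mem_ofPred_eq, hiff] using h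
  have hval : ∫ x in A, {x : EuclideanSpace ℝ (Fin d) | ε < Metric.infDist x (frontier A)}.indicator
      (fun _ => (2 * Real.pi : ℂ)) x = -(2 * Real.pi * (tubeVolume A ε - volume.real A)) := by
    rw [integral_indicator hmeas, Measure.restrict_restrict hmeas, setIntegral_const]
    have h1 : volume.real A = tubeVolume A ε +
        volume.real ({x : EuclideanSpace ℝ (Fin d) | ε < Metric.infDist x (frontier A)} ∩ A) := by
      have h := measureReal_inter_add_sdiff (μ := volume) (s := A) hmeas
        hb.measure_lt_top.ne
      rw [← h, add_comm, tubeVolume, inter_comm]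
      congr 2
      ext x
      simp [innerNhd]
    rw [h1, Complex.real_smul]
    push_cast
    ring
  have hfun : (fun n => ∫ t in (-(a n))..(b n), (ε : ℂ) ^ (-(c + t * Complex.I) : ℂ) *
      (-(distanceZeta A (c + t * Complex.I) / (c + t * Complex.I)))) = fun n => -∫ x in A,
        ∫ t in (-(a n))..(b n), perronIntegrand c
          (Real.log (Metric.infDist x (frontier A) / ε)) t :=
    funext fun n => integral_distanceZeta_div hd hA hb hc hε _ _
  rw [hfun, ← neg_neg ((2 : ℂ) * Real.pi * _), ← hval]
  exact hlim.neg

lemma continuous_distanceZeta_div (hd : 1 ≤ d) (hA : IsOpen A) (hb : Bornology.IsBounded A)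
    (hc : 0 < c) : Continuous fun t : ℝ =>
      -(distanceZeta A (c + t * Complex.I) / (c + t * Complex.I)) := by
  have hne := ne_univ_of_isBounded hd hb
  refine (Continuous.div ?_ (by fun_prop) (ofReal_add_mul_I_ne_zero hc)).neg
  refine continuous_of_dominated (bound := fun _ => inradius A ^ c)
    (fun t => (measurable_infDist_cpow _ _).aestronglyMeasurable) (fun t => ?_)
    (integrableOn_const hb.measure_lt_top.ne) ?_
  · refine (ae_restrict_iff' hA.measurableSet).2 (Eventually.of_forall fun x hx => ?_)
    simpa using norm_infDist_cpow_le hd hA hb (u := c + t * Complex.I) (by simpa using hc.le) hx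
  · refine (ae_restrict_iff' hA.measurableSet).2 (Eventually.of_forall fun x hx => ?_)
    have h0 := infDist_frontier_pos hA hne hx
    exact Continuous.const_cpow (by fun_prop) (Or.inl (by exact_mod_cast h0.ne'))

lemma tubeVolume_le (hb : Bornology.IsBounded A) (ε : ℝ) : tubeVolume A ε ≤ volume.real A :=
  measureReal_mono (fun _ hx => hx.1) hb.measure_lt_top.ne

/-- Perron's formula for the tube volume, paired with a test function. -/
lemma tendsto_integral_powerPairing_mul (hd : 1 ≤ d) (hA : IsOpen A)
    (hb : Bornology.IsBounded A) (hc : 0 < c) {φ : ℝ → ℂ} (hφ : IsTestFunction φ)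
    (ha : ∀ᶠ n in atTop, 0 < a n)
    (hb' : Tendsto b atTop atTop) (hab : Tendsto (fun n => b n / a n) atTop (𝓝 1)) :
    Tendsto (fun n => ∫ t in (-(a n))..(b n), powerPairing d φ (d + (c + t * Complex.I)) *
        (-(distanceZeta A (c + t * Complex.I) / (c + t * Complex.I)))) atTop
      (𝓝 (2 * Real.pi * (pairing (fun ε => (tubeVolume A ε : ℂ)) φ -
        volume.real A * powerPairing d φ d))) := by
  obtain ⟨p, q, hp, hpq, hs⟩ := hφ.exists_tsupport_subset
  obtain ⟨B, hB⟩ := exists_norm_integral_distanceZeta_div_le hd hA hb hc hp ha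
    (hb'.eventually_gt_atTop 0) hab
  have hcont := continuous_distanceZeta_div hd hA hb hc
  set g : ℝ → ℂ := fun t => -(distanceZeta A (c + t * Complex.I) / (c + t * Complex.I)) with hg
  have h1 : ∀ n, ∫ t in (-(a n))..(b n), powerPairing d φ (d + (c + t * Complex.I)) * g t =
      ∫ ε in Ioi (0 : ℝ), (∫ t in (-(a n))..(b n),
        (ε : ℂ) ^ (-(c + t * Complex.I) : ℂ) * g t) * φ ε := fun n => by
    rw [← pairing_intervalIntegral (d := d) hφ (γ := fun t : ℝ => d + (c + t * Complex.I))
      (by fun_prop) (hcont.intervalIntegrable _ _), pairing]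
    simp only [sub_add_cancel_left]
  rw [funext h1]
  have hlim : Tendsto (fun n => ∫ ε in Ioi (0 : ℝ), (∫ t in (-(a n))..(b n),
      (ε : ℂ) ^ (-(c + t * Complex.I) : ℂ) * g t) * φ ε) atTop
      (𝓝 (∫ ε in Ioi (0 : ℝ), (2 * Real.pi * (tubeVolume A ε - volume.real A)) * φ ε)) := by
    refine tendsto_integral_filter_of_dominated_convergence (fun ε => B * ‖φ ε‖) ?_ ?_
      (hφ.integrable.norm.const_mul B).integrableOn ?_
    · refine Eventually.of_forall fun n => ContinuousOn.aestronglyMeasurable (fun ε hε => ?_)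
        measurableSet_Ioi
      refine ContinuousAt.continuousWithinAt (ContinuousAt.mul ?_ hφ.continuous.continuousAt)
      have hε' : Ioo (ε / 2) (2 * ε) ∈ 𝓝 ε := Ioo_mem_nhds (half_lt_self hε) (by
        have : 0 < ε := hε
        linarith)
      have hε0 : 0 < ε / 2 := half_pos hε
      obtain ⟨C, hC0, hC⟩ := exists_norm_cpow_le (q := 2 * ε) hε0 (-c) (-c)
      refine intervalIntegral.continuousAt_of_dominated_interval
        (bound := fun t => C * ‖g t‖) ?_ ?_ ?_ ?_
      · refine Eventually.of_forall fun x => ?_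
        refine AEStronglyMeasurable.mul (Measurable.aestronglyMeasurable ?_)
          hcont.aestronglyMeasurable
        exact measurable_const.pow (by fun_prop)
      · filter_upwards [hε'] with x hx
        refine Eventually.of_forall fun t _ => ?_
        rw [norm_mul]
        exact mul_le_mul_of_nonneg_right (hC x (Ioo_subset_Icc_self hx) _ (by simp) (by simp))
          (norm_nonneg _)
      · exact (hcont.norm.const_mul C).intervalIntegrable _ _
      · refine Eventually.of_forall fun t _ => ContinuousAt.mul ?_ continuousAt_const
        exact Complex.continuousAt_ofReal_cpow_const _ _ (Or.inr (ne_of_gt hε))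
    · refine hB.mono fun n hn => Eventually.of_forall fun ε => ?_
      by_cases hε : ε ∈ Ioo p q
      · rw [norm_mul]
        exact mul_le_mul_of_nonneg_right (hn ε hε.1.le) (norm_nonneg _)
      · rw [image_eq_zero_of_notMem_tsupport fun h => hε (hs h)]
        simp
    · refine (ae_restrict_iff' measurableSet_Ioi).2 (Eventually.of_forall fun ε hε => ?_)
      exact (tendsto_integral_distanceZeta_div hd hA hb hc hε ha hb' hab).mul_const _
  convert hlim using 2
  have hone : powerPairing d φ d = ∫ ε in Ioi (0 : ℝ), φ ε := by
    simp [powerPairing, pairing]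
  have hV : IntegrableOn (fun ε => (tubeVolume A ε : ℂ) * φ ε) (Ioi 0) := by
    refine Integrable.bdd_mul (c := volume.real A) hφ.integrable.integrableOn ?_ ?_
    · refine (Complex.measurable_ofReal.comp (Monotone.measurable ?_)).aestronglyMeasurable
      exact fun x y hxy => measureReal_mono (fun z hz => ⟨hz.1, hz.2.trans hxy⟩)
        ((measure_mono fun z hz => hz.1).trans_lt hb.measure_lt_top).ne
    · refine Eventually.of_forall fun ε => ?_
      rw [Complex.norm_real]
      exact (Real.norm_of_nonneg measureReal_nonneg).le.trans (tubeVolume_le hb ε)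
  rw [hone, pairing, ← integral_const_mul, ← integral_sub hV
    (hφ.integrable.integrableOn.const_mul _), ← integral_const_mul]
  refine integral_congr_ae (Eventually.of_forall fun ε => ?_)
  simp only
  ring

end Perron

/-! ### Residues and screen integrals of weighted zeta functions -/

section Residue

variable {d : ℕ} {A : Set (EuclideanSpace ℝ (Fin d))}

lemma map_add_ofReal_le_nhdsNE (w : ℂ) : map (fun t : ℝ => w + t) (𝓝[>] 0) ≤ 𝓝[≠] w := by
  refine tendsto_nhdsWithin_iff.2 ⟨?_, ?_⟩
  · have h : Continuous fun t : ℝ => w + t := by fun_prop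
    have h' := h.tendsto 0
    simp only [Complex.ofReal_zero, add_zero] at h'
    exact h'.mono_left nhdsWithin_le_nhds
  · filter_upwards [self_mem_nhdsWithin] with t ht h
    have ht' : 0 < t := ht
    exact ht'.ne' (by simpa using h)

/-- A meromorphic function bounded on a short horizontal segment starting at `w` has no pole there. -/
lemma meromorphicOrderAt_nonneg_of_ray {F : ℂ → ℂ} {w : ℂ} (hF : MeromorphicAt F w) {δ B : ℝ}
    (hδ : 0 < δ) (hB : ∀ t : ℝ, 0 < t → t < δ → ‖F (w + t)‖ ≤ B) :
    0 ≤ meromorphicOrderAt F w := by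
  refine meromorphicOrderAt_nonneg_of_bounded hF (map_add_ofReal_le_nhdsNE w) (B := B) ?_
  rw [eventually_map]
  filter_upwards [Ioo_mem_nhdsGT hδ] with t ht using hB t ht.1 ht.2

lemma exists_norm_distanceZeta_le (hd : 1 ≤ d) (hA : IsOpen A) (hb : Bornology.IsBounded A)
    (X : ℝ) : ∃ B, 0 ≤ B ∧ ∀ u : ℂ, 0 ≤ u.re → u.re ≤ X → ‖distanceZeta A u‖ ≤ B := by
  refine ⟨max 1 (inradius A) ^ X * volume.real A, by positivity, fun u h1 h2 =>
    (norm_distanceZeta_le hd hA hb h1).trans ?_⟩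
  have h0 : 0 ≤ inradius A := Real.sSup_nonneg fun x hx => hx.1.le
  gcongr
  exact (Real.rpow_le_rpow h0 (le_max_right _ _) h1).trans
    (Real.rpow_le_rpow_of_exponent_le (le_max_left _ _) h2)

lemma norm_le_norm_add_ofReal {z : ℂ} (hz : 0 ≤ z.re) {t : ℝ} (ht : 0 ≤ t) : ‖z‖ ≤ ‖z + t‖ := by
  rw [Complex.norm_def, Complex.norm_def]
  refine Real.sqrt_le_sqrt ?_
  simp only [Complex.normSq_apply, Complex.add_re, Complex.ofReal_re, Complex.add_im,
    Complex.ofReal_im, add_zero]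
  nlinarith [mul_nonneg hz ht]

lemma meromorphicOrderAt_nonneg_of_eq_distanceZeta (hd : 1 ≤ d) (hA : IsOpen A)
    (hb : Bornology.IsBounded A) {F : ℂ → ℂ} {w : ℂ} (hF : MeromorphicAt F w) (hw : (d : ℝ) ≤ w.re)
    (hne : w ≠ d)
    (h : ∀ t : ℝ, 0 < t → F (w + t) = -(distanceZeta A (w + t - d) / (w + t - d))) :
    0 ≤ meromorphicOrderAt F w := by
  obtain ⟨B, hB0, hB⟩ := exists_norm_distanceZeta_le hd hA hb (w.re + 1 - d)
  have hpos : 0 < ‖w - d‖ := norm_pos_iff.2 (sub_ne_zero.2 hne)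
  refine meromorphicOrderAt_nonneg_of_ray hF one_pos (B := B / ‖w - d‖) fun t h0 h1 => ?_
  rw [h t h0, norm_neg, norm_div]
  have h2 : ‖w - d‖ ≤ ‖w + t - d‖ := by
    rw [add_sub_right_comm]
    exact norm_le_norm_add_ofReal (by simpa using hw) h0.le
  gcongr
  refine hB _ ?_ ?_ <;> simp <;> linarith

/-- The residue at `d`, where the zeta function has a simple pole with residue `-vol A`. -/
lemma residueAt_mul_of_eq_distanceZeta (hd : 1 ≤ d) (hA : IsOpen A)
    (hb : Bornology.IsBounded A) {E Z : ℂ → ℂ} (hE : Differentiable ℂ E) (hZ : MeromorphicAt Z d)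
    (h : ∀ t : ℝ, 0 < t → Z (d + t) = -(distanceZeta A t / t)) :
    residueAt (fun s => E s * Z s) d = -(E d * volume.real A) := by
  have hl := map_add_ofReal_le_nhdsNE (d : ℂ)
  have hH : MeromorphicAt (fun s => (s - d) * Z s) (d : ℂ) :=
    MeromorphicAt.mul (by fun_prop) hZ
  have hray : Tendsto (fun s => (s - d) * Z s) (map (fun t : ℝ => (d : ℂ) + t) (𝓝[>] 0))
      (𝓝 (-(volume.real A : ℂ))) := by
    rw [tendsto_map'_iff]
    refine (tendsto_distanceZeta hd hA hb).neg.congr' ?_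
    filter_upwards [self_mem_nhdsWithin] with t ht
    have ht' : (t : ℂ) ≠ 0 := by exact_mod_cast (ne_of_gt ht)
    simp only [Function.comp_apply, h t ht, add_sub_cancel_left]
    field_simp
  have hord : 0 ≤ meromorphicOrderAt (fun s => (s - d) * Z s) (d : ℂ) :=
    meromorphicOrderAt_nonneg_of_bounded hH hl
      ((hray.norm).eventually_le_const (lt_add_one _))
  obtain ⟨g, hg, hHg⟩ := exists_analyticAt_of_meromorphicOrderAt_nonneg hH hord
  have hgd : g d = -(volume.real A : ℂ) := by
    refine tendsto_nhds_unique ?_ (hray.congr' (hl hHg))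
    exact hg.continuousAt.tendsto.mono_left (hl.trans nhdsWithin_le_nhds)
  have hEg : AnalyticAt ℂ (fun s => E s * g s) d := (hE.analyticAt d).mul hg
  have hcongr : (fun s => E s * Z s) =ᶠ[𝓝[≠] (d : ℂ)] fun s => (s - d)⁻¹ • (E s * g s) := by
    filter_upwards [hHg, self_mem_nhdsWithin] with s h1 h2
    have : s - d ≠ 0 := sub_ne_zero.2 h2
    rw [← h1, smul_eq_mul]
    field_simp
  rw [residueAt_congr hcongr]
  refine residueAt_eq_of_eventually ?_
  obtain ⟨R, hR, hRa⟩ := Metric.eventually_nhds_iff.1 hEg.eventually_analyticAt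
  filter_upwards [Ioo_mem_nhdsGT hR] with ρ hρ
  have hdc : DiffContOnCl ℂ (fun s => E s * g s) (Metric.ball (d : ℂ) ρ) := by
    refine DifferentiableOn.diffContOnCl_ball (U := Metric.ball (d : ℂ) R) (fun s hs =>
      (hRa hs).differentiableAt.differentiableWithinAt) ?_
    exact Metric.closedBall_subset_ball hρ.2
  rw [hdc.circleIntegral_sub_inv_smul (Metric.mem_ball_self hρ.1), hgd, smul_eq_mul]
  have : (2 * Real.pi * Complex.I : ℂ) ≠ 0 := Complex.two_pi_I_ne_zero
  field_simp

/-- A function `Z` on the window of `f` with the properties, shared by all geometric zeta functions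
of fractal sprays with union `A`, that enter the residue argument: off the real point `d`, its
poles belong to `D` and have real part less than `d`, none is on the screen, and it continues
`s ↦ -(s - d)⁻¹ ∫_A dist(x, ∂A)^{s-d} dx`. -/
structure IsTubeZeta (A : Set (EuclideanSpace ℝ (Fin d))) (Z : ℂ → ℂ) (D : Set ℂ) (f : ℝ → ℝ)
    (β : ℝ) (τ : ℤ → ℝ) : Prop where
  meromorphicAt : ∀ s ∈ window f, MeromorphicAt Z s
  eq_distanceZeta : ∀ s ∈ window f, (d : ℝ) < s.re → Z s = -(distanceZeta A (s - d) / (s - d))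
  dim_mem : (d : ℂ) ∈ window f
  mem_dims : ∀ s ∈ window f, meromorphicOrderAt Z s < 0 → s ≠ d → s ∈ D
  dims : ∀ w ∈ D, w ∈ window f ∧ w.re < d
  screen : ∀ t, 0 ≤ meromorphicOrderAt Z (screenPoint f t)
  languid : IsLanguid Z f d β τ
  finite : ∀ n, (truncDims D τ n).Finite

namespace IsTubeZeta

variable {Z E : ℂ → ℂ} {D : Set ℂ} {f : ℝ → ℝ} {β : ℝ} {τ : ℤ → ℝ}

lemma add_ofReal_mem_window {w : ℂ} (hw : w ∈ window f) {t : ℝ} (ht : 0 ≤ t) :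
    w + t ∈ window f := by
  have : f w.im ≤ w.re := hw
  simpa [window] using this.trans (le_add_of_nonneg_right ht)

lemma order_nonneg_of_le_re (h : IsTubeZeta A Z D f β τ) (hd : 1 ≤ d) (hA : IsOpen A)
    (hb : Bornology.IsBounded A) {w : ℂ} (hw : w ∈ window f) (hre : (d : ℝ) ≤ w.re)
    (hne : w ≠ d) : 0 ≤ meromorphicOrderAt Z w :=
  meromorphicOrderAt_nonneg_of_eq_distanceZeta hd hA hb (h.meromorphicAt w hw) hre hne
    fun t ht => h.eq_distanceZeta _ (add_ofReal_mem_window hw ht.le) (by simp; linarith)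

/-- There are no poles at the heights of languidity: to the left of `d` the function is bounded along
the horizontal line, and from `d` on it is given by the distance zeta function. -/
lemma order_nonneg_of_im_eq (h : IsTubeZeta A Z D f β τ) (hd : 1 ≤ d) (hA : IsOpen A)
    (hb : Bornology.IsBounded A) {n : ℤ} (hn : τ n ≠ 0) {w : ℂ} (hw : w ∈ window f)
    (him : w.im = τ n) : 0 ≤ meromorphicOrderAt Z w := by
  rcases le_or_gt (d : ℝ) w.re with hre | hre
  · refine h.order_nonneg_of_le_re hd hA hb hw hre fun hwd => hn ?_
    rw [← him, hwd, Complex.natCast_im]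
  · obtain ⟨C, -, hC, -⟩ := h.languid.growth
    refine meromorphicOrderAt_nonneg_of_ray (h.meromorphicAt w hw) (sub_pos.2 hre)
      (B := C * (|τ n| + 1) ^ β) fun t h0 h1 => ?_
    have e : w + t = ((w.re + t : ℝ) : ℂ) + τ n * Complex.I := by
      apply Complex.ext <;> simp [him]
    rw [e]
    have hw' : f w.im ≤ w.re := hw
    exact hC n _ (by rw [← him]; linarith) (by linarith)

lemma tau_pos (h : IsTubeZeta A Z D f β τ) {n : ℕ} (hn : 1 ≤ n) : 0 < τ n :=
  h.languid.pos n (by exact_mod_cast hn)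

lemma tau_neg (h : IsTubeZeta A Z D f β τ) {n : ℕ} (hn : 1 ≤ n) : τ (-n) < 0 :=
  h.languid.neg (-n) (by have : (1 : ℤ) ≤ n := by exact_mod_cast hn
                         omega)

lemma meromorphicAt_mul (h : IsTubeZeta A Z D f β τ) (hE : Differentiable ℂ E) {s : ℂ}
    (hs : s ∈ window f) : MeromorphicAt (fun s => E s * Z s) s :=
  (hE.analyticAt s).meromorphicAt.mul (h.meromorphicAt s hs)

lemma order_mul_nonneg (h : IsTubeZeta A Z D f β τ) (hE : Differentiable ℂ E) {s : ℂ}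
    (hs : s ∈ window f) (h0 : 0 ≤ meromorphicOrderAt Z s) :
    0 ≤ meromorphicOrderAt (fun s => E s * Z s) s :=
  meromorphicOrderAt_mul_nonneg (hE.analyticAt s).meromorphicAt (h.meromorphicAt s hs)
    (hE.analyticAt s).meromorphicOrderAt_nonneg h0

/-- The residue theorem on the part of the window between two of the languidity heights. -/
lemma screenRegionIntegral_eq (h : IsTubeZeta A Z D f β τ) (hd : 1 ≤ d) (hA : IsOpen A)
    (hb : Bornology.IsBounded A) {K : NNReal} (hf : LipschitzWith K f)
    (hE : Differentiable ℂ E) {c : ℝ} (hfc : ∀ t, f t ≤ c) (hc : (d : ℝ) < c) {n : ℕ}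
    (hn : 1 ≤ n) :
    ScreenRegionIntegrable f c (τ (-n)) (τ n) (fun s => E s * Z s) ∧
      screenRegionIntegral f c (τ (-n)) (τ n) (fun s => E s * Z s) = 2 * Real.pi * Complex.I *
        ((∑ᶠ w ∈ truncDims D τ n, residueAt (fun s => E s * Z s) w) - E d * volume.real A) := by
  classical
  have hpos := h.tau_pos hn
  have hneg := h.tau_neg hn
  have hdD : (d : ℂ) ∉ truncDims D τ n := fun hD => by
    simpa using (h.dims _ hD.1).2
  have hres : residueAt (fun s => E s * Z s) d = -(E d * volume.real A) :=
    residueAt_mul_of_eq_distanceZeta hd hA hb hE (h.meromorphicAt _ h.dim_mem) fun t ht => by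
      simpa using h.eq_distanceZeta _ (add_ofReal_mem_window h.dim_mem ht.le) (by simpa using ht)
  -- Elements of `D` that are not poles contribute residue `0`, and so does `d` if it is not a pole.
  set S0 : Finset ℂ := insert (d : ℂ) (h.finite n).toFinset with hS0
  have hS0w : ∀ w ∈ S0, w ∈ screenRegion f c (τ (-n)) (τ n) ∧ w ∈ window f ∧ w.re < c := by
    intro w hw
    rw [hS0, Finset.mem_insert, Finite.mem_toFinset] at hw
    rcases hw with rfl | hw
    · have : f 0 ≤ (d : ℝ) := by simpa [window] using h.dim_mem
      refine ⟨⟨?_, ?_, ?_, ?_⟩, h.dim_mem, by simpa using hc⟩ <;> simp <;> linarith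
    · have h1 := h.dims w hw.1
      exact ⟨⟨hw.2.1, hw.2.2, h1.1, (h1.2.trans hc).le⟩, h1.1, h1.2.trans hc⟩
  have key := screenRegionIntegral_eq_sum_residueAt hf (hneg.trans hpos).le hfc
    (S0.filter fun w => meromorphicOrderAt Z w < 0) (fun s => E s * Z s)
    (fun s hs => h.meromorphicAt_mul hE hs.2.2.1) ?_ ?_
  · refine ⟨key.1, key.2.trans ?_⟩
    congr 1
    rw [Finset.sum_filter_of_ne, hS0, Finset.sum_insert (by simpa using hdD), hres,
      finsum_mem_eq_finite_toFinset_sum _ (h.finite n)]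
    · ring
    · intro w hw hne
      by_contra h0
      have hw' := (hS0w w hw).2.1
      exact hne (residueAt_eq_zero (h.meromorphicAt_mul hE hw')
        (h.order_mul_nonneg hE hw' (not_lt.1 h0)))
  · intro w hw
    rw [Finset.mem_filter] at hw
    obtain ⟨h1, h2, h3⟩ := hS0w w hw.1
    refine ⟨h1, fun hbd => absurd hw.2 (not_lt.2 ?_)⟩
    rcases hbd.2 with h4 | h4 | h4 | h4
    · exact h.order_nonneg_of_im_eq hd hA hb hneg.ne h2 h4
    · exact h.order_nonneg_of_im_eq hd hA hb hpos.ne' h2 h4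
    · exact absurd h4 h3.ne
    · have : w = screenPoint f w.im := Complex.ext (by rw [screenPoint_re, h4])
        (by rw [screenPoint_im])
      rw [this]
      exact h.screen _
  · intro s hs hsS
    refine h.order_mul_nonneg hE hs.2.2.1 (not_lt.1 fun h0 => hsS ?_)
    rw [Finset.mem_filter, hS0, Finset.mem_insert, Finite.mem_toFinset]
    refine ⟨or_iff_not_imp_left.2 fun hsd => ?_, h0⟩
    exact ⟨h.mem_dims s hs.2.2.1 h0 hsd, hs.1, hs.2.1⟩

end IsTubeZeta

end Residue

/-! ### Pushing the contour to the screen -/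

section Contour

lemma abs_rpow_le {t β : ℝ} (ht : 1 ≤ |t|) : |t| ^ β ≤ 2 ^ |β| * (1 + |t|) ^ β := by
  rcases le_total 0 β with h | h
  · calc |t| ^ β ≤ (1 + |t|) ^ β := by gcongr; linarith
      _ ≤ _ := le_mul_of_one_le_left (by positivity)
        (Real.one_le_rpow one_le_two (abs_nonneg _))
  · rw [abs_of_nonpos h, Real.rpow_neg two_pos.le, ← div_eq_inv_mul,
      ← Real.div_rpow (by positivity) two_pos.le]
    exact Real.rpow_le_rpow_of_nonpos (by positivity) (by linarith) h

variable {d : ℕ} {A : Set (EuclideanSpace ℝ (Fin d))}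

namespace IsTubeZeta

variable {Z E : ℂ → ℂ} {D : Set ℂ} {f : ℝ → ℝ} {β γ B m c : ℝ} {τ : ℤ → ℝ}

/-- The horizontal sides do not contribute in the limit: up to `Re s = d` by languidity, and beyond by
the factor `1 / (s - d)`. -/
lemma tendsto_horizontal (h : IsTubeZeta A Z D f β τ) (hd : 1 ≤ d) (hA : IsOpen A)
    (hb : Bornology.IsBounded A) (hE : ∀ s : ℂ, m ≤ s.re → s.re ≤ c →
      ‖E s‖ ≤ B * (1 + |s.im|) ^ γ) (hγ : γ ≤ 0) (hβγ : β + γ < -1)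
    (hm : ∀ t, m ≤ f t) (hfc : ∀ t, f t ≤ c) {k : ℕ → ℤ}
    (hk : Tendsto (fun n => |τ (k n)|) atTop atTop) :
    Tendsto (fun n => ∫ σ in (f (τ (k n)))..c, E (σ + τ (k n) * Complex.I) *
      Z (σ + τ (k n) * Complex.I)) atTop (𝓝 0) := by
  obtain ⟨C, hC0, hC, -⟩ := h.languid.growth
  obtain ⟨B', hB0', hB'⟩ := exists_norm_distanceZeta_le hd hA hb (c - d)
  have hB0 : 0 ≤ B := by
    have h1 := (norm_nonneg _).trans (hE c ((hm 0).trans (hfc 0)) le_rfl)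
    simpa using h1
  have hlim : Tendsto (fun n => B * (C * (1 + |τ (k n)|) ^ (β + γ) + B' / |τ (k n)|) * (c - m))
      atTop (𝓝 (B * (C * 0 + 0) * (c - m))) := by
    have h1 : Tendsto (fun n => (1 + |τ (k n)|) ^ (β + γ)) atTop (𝓝 0) := by
      have := (tendsto_rpow_neg_atTop (y := -(β + γ)) (by linarith)).comp
        (tendsto_atTop_add_const_left _ 1 hk)
      simpa [Function.comp_def] using this
    exact (((h1.const_mul C).add (hk.const_div_atTop B')).const_mul B).mul_const _
  simp only [mul_zero, add_zero, zero_mul] at hlim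
  refine squeeze_zero_norm' ?_ hlim
  filter_upwards [hk.eventually_ge_atTop 1] with n hn
  set x := τ (k n) with hx
  refine (intervalIntegral.norm_integral_le_of_norm_le_const (C := B * (C * (1 + |x|) ^ (β + γ) +
    B' / |x|)) fun σ hσ => ?_).trans ?_
  · rw [uIoc_of_le (hfc x)] at hσ
    have h1 : ‖E (σ + x * Complex.I)‖ ≤ B * (1 + |x|) ^ γ := by
      simpa using hE (σ + x * Complex.I) (by simpa using (hm x).trans hσ.1.le) (by simpa using hσ.2)
    have h2 : (1 + |x|) ^ γ ≤ 1 := Real.rpow_le_one_of_one_le_of_nonpos (by linarith) hγ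
    rw [norm_mul]
    have h4 : 0 ≤ B' / |x| := by positivity
    have h5 : 0 ≤ C * (1 + |x|) ^ (β + γ) := by positivity
    rcases le_or_gt σ d with hσd | hσd
    · have h3 := hC (k n) σ hσ.1.le hσd
      rw [add_comm |τ (k n)|] at h3
      calc ‖E (σ + x * Complex.I)‖ * ‖Z (σ + x * Complex.I)‖
          ≤ (B * (1 + |x|) ^ γ) * (C * (1 + |x|) ^ β) := by gcongr
        _ = B * (C * (1 + |x|) ^ (β + γ)) := by
            rw [Real.rpow_add (by positivity)]; ring
        _ ≤ _ := by gcongr; linarith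
    · have h3 : ‖Z (σ + x * Complex.I)‖ ≤ B' / |x| := by
        rw [h.eq_distanceZeta _ (by simpa [window] using hσ.1.le) (by simpa using hσd), norm_neg,
          norm_div]
        gcongr
        · exact hB' _ (by simpa using hσd.le) (by simpa using hσ.2)
        · simpa using Complex.abs_im_le_norm ((σ : ℂ) + x * Complex.I - d)
      calc ‖E (σ + x * Complex.I)‖ * ‖Z (σ + x * Complex.I)‖
          ≤ (B * (1 + |x|) ^ γ) * (B' / |x|) := by gcongr
        _ ≤ (B * 1) * (B' / |x|) := by gcongr
        _ ≤ _ := by rw [mul_one]; gcongr; linarith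
  · have h1 : 0 ≤ c - f x := sub_nonneg.2 (hfc x)
    rw [abs_of_nonneg h1]
    gcongr
    exact hm x

/-- The integral along the screen converges absolutely: the zeta function has no poles there, and
far out the languidity bound applies. -/
lemma integrable_screenIntegrand (h : IsTubeZeta A Z D f β τ) (hd : 1 ≤ d) (hA : IsOpen A)
    (hb : Bornology.IsBounded A) {K : NNReal} (hf : LipschitzWith K f)
    (hEd : Differentiable ℂ E) (hE : ∀ s : ℂ, m ≤ s.re → s.re ≤ c →
      ‖E s‖ ≤ B * (1 + |s.im|) ^ γ) (hβγ : β + γ < -1)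
    (hm : ∀ t, m ≤ f t) (hfc : ∀ t, f t ≤ c) (hc : (d : ℝ) < c) :
    Integrable (screenIntegrand f fun s => E s * Z s) := by
  obtain ⟨C, hC0, -, hC⟩ := h.languid.growth
  have hloc : LocallyIntegrable (screenIntegrand f fun s => E s * Z s) := by
    intro x
    obtain ⟨n, hn1, hn2, hn3⟩ := ((eventually_ge_atTop 1).and
      ((h.languid.top.eventually_gt_atTop x).and (h.languid.bot.eventually_lt_atBot x))).exists
    have hint := (h.screenRegionIntegral_eq hd hA hb hf hEd hfc hc hn1).1.left
    refine ⟨Ioo (τ (-n)) (τ n), Ioo_mem_nhds hn3 hn2, ?_⟩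
    exact ((intervalIntegrable_iff_integrableOn_Ioc_of_le
      ((h.tau_neg hn1).trans (h.tau_pos hn1)).le).1 hint).mono_set Ioo_subset_Ioc_self
  have hdecay : Integrable fun t : ℝ => (1 + ‖t‖) ^ (β + γ) := by
    have := integrable_one_add_norm (E := ℝ) (μ := volume) (r := -(β + γ)) (by
      simp only [Module.finrank_self, Nat.cast_one]
      linarith)
    simpa using this
  have hbound : ∀ t : ℝ, 1 ≤ |t| → ‖screenIntegrand f (fun s => E s * Z s) t‖ ≤
      (B * (C * 2 ^ |β|) * (K + 1)) * ‖(1 + ‖t‖) ^ (β + γ)‖ := by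
    intro t ht
    have hB0 : 0 ≤ B := by
      have h1 := (norm_nonneg _).trans (hE c ((hm 0).trans (hfc 0)) le_rfl)
      simpa using h1
    have h1 : ‖E (screenPoint f t)‖ ≤ B * (1 + |t|) ^ γ := by
      have := hE (screenPoint f t) (by rw [screenPoint_re]; exact hm t)
        (by rw [screenPoint_re]; exact hfc t)
      rwa [screenPoint_im] at this
    have h2 : ‖Z (screenPoint f t)‖ ≤ C * (2 ^ |β| * (1 + |t|) ^ β) :=
      (hC t ht).trans (mul_le_mul_of_nonneg_left (abs_rpow_le ht) hC0.le)
    have h3 : ‖((deriv f t : ℝ) : ℂ) + Complex.I‖ ≤ K + 1 := by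
      refine (norm_add_le _ _).trans ?_
      rw [Complex.norm_real, Complex.norm_I]
      gcongr
      exact norm_deriv_le_of_lipschitz hf
    rw [screenIntegrand, norm_mul, norm_mul, Real.norm_eq_abs t,
      Real.norm_of_nonneg (by positivity),
      Real.rpow_add (by positivity)]
    calc _ ≤ (B * (1 + |t|) ^ γ) * (C * (2 ^ |β| * (1 + |t|) ^ β)) * (K + 1) := by gcongr
      _ = _ := by ring
  refine hloc.integrable_of_isBigO_atBot_atTop (g := fun t : ℝ => (1 + ‖t‖) ^ (β + γ))
    (g' := fun t : ℝ => (1 + ‖t‖) ^ (β + γ)) ?_ (hdecay.integrableAtFilter _) ?_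
    (hdecay.integrableAtFilter _)
  · refine Asymptotics.IsBigO.of_bound (B * (C * 2 ^ |β|) * (K + 1)) ?_
    filter_upwards [eventually_le_atBot (-1)] with t ht
    exact hbound t (by rw [abs_of_nonpos (by linarith)]; linarith)
  · refine Asymptotics.IsBigO.of_bound (B * (C * 2 ^ |β|) * (K + 1)) ?_
    filter_upwards [eventually_ge_atTop 1] with t ht
    exact hbound t (by rwa [abs_of_nonneg (by linarith)])

/-- Pushing the truncated integrals over the line `Re s = c` to the screen. -/
theorem tendsto_sum_residueAt (h : IsTubeZeta A Z D f β τ) (hd : 1 ≤ d) (hA : IsOpen A)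
    (hb : Bornology.IsBounded A) {K : NNReal} (hf : LipschitzWith K f)
    (hEd : Differentiable ℂ E) (hE : ∀ s : ℂ, m ≤ s.re → s.re ≤ c →
      ‖E s‖ ≤ B * (1 + |s.im|) ^ γ) (hγ : γ ≤ 0) (hβγ : β + γ < -1)
    (hm : ∀ t, m ≤ f t) (hfc : ∀ t, f t ≤ c) (hc : (d : ℝ) < c) {L : ℂ}
    (hL : Tendsto (fun n : ℕ => ∫ t in (τ (-n))..(τ n), E (c + t * Complex.I) *
      Z (c + t * Complex.I)) atTop (𝓝 (2 * Real.pi * L))) :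
    Tendsto (fun n : ℕ => (∑ᶠ w ∈ truncDims D τ n, residueAt (fun s => E s * Z s) w) +
      screenIntegral f fun s => E s * Z s) atTop (𝓝 (L + E d * volume.real A)) := by
  have hint := h.integrable_screenIntegrand hd hA hb hf hEd hE hβγ hm hfc hc
  have hscr := intervalIntegral_tendsto_integral hint h.languid.bot h.languid.top
  have htop := h.tendsto_horizontal hd hA hb hE hγ hβγ hm hfc (k := fun n => (n : ℤ))
    (tendsto_abs_atTop_atTop.comp h.languid.top)
  have hbot := h.tendsto_horizontal hd hA hb hE hγ hβγ hm hfc (k := fun n => -(n : ℤ))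
    (tendsto_abs_atBot_atTop.comp h.languid.bot)
  have hpi : (2 * Real.pi * Complex.I : ℂ) ≠ 0 := Complex.two_pi_I_ne_zero
  have hall := (((((hbot.add (hL.const_mul Complex.I)).sub htop).sub hscr).const_mul
    (2 * Real.pi * Complex.I)⁻¹).add_const (E d * volume.real A)).add_const
      (screenIntegral f fun s => E s * Z s)
  have hlim : (2 * Real.pi * Complex.I : ℂ)⁻¹ * (0 + Complex.I * (2 * Real.pi * L) - 0 -
      ∫ t, screenIntegrand f (fun s => E s * Z s) t) + E d * volume.real A +
      screenIntegral f (fun s => E s * Z s) = L + E d * volume.real A := by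
    rw [screenIntegral]
    field_simp
    ring
  rw [hlim] at hall
  refine hall.congr' ?_
  filter_upwards [eventually_ge_atTop 1] with n hn
  have key := (h.screenRegionIntegral_eq hd hA hb hf hEd hfc hc hn).2
  rw [screenRegionIntegral] at key
  rw [key, inv_mul_cancel_left₀ hpi]
  ring

end IsTubeZeta

end Contour

/-! ### Generators with piecewise constant coefficients -/

section Pluriphase

variable {d : ℕ} {G : Set (EuclideanSpace ℝ (Fin d))} {κ : ℕ → ℝ → ℝ}

lemma differentiable_intervalIntegral_mul_cpow {h : ℝ → ℂ} {p q : ℝ} (hp : 0 < p) (hpq : p ≤ q)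
    (hh : IntegrableOn h (Ioc p q)) :
    Differentiable ℂ fun z : ℂ => ∫ t in p..q, h t * (t : ℂ) ^ (z - 1) := by
  have e : (fun z : ℂ => ∫ t in p..q, h t * (t : ℂ) ^ (z - 1)) =
      mellin ((Ioc p q).indicator h) := by
    funext z
    rw [intervalIntegral.integral_of_le hpq, mellin,
      ← integral_indicator measurableSet_Ioc, ← integral_indicator measurableSet_Ioi]
    congr 1
    funext t
    by_cases ht : t ∈ Ioc p q
    · have h0 : t ∈ Ioi (0 : ℝ) := hp.trans ht.1
      simp [indicator_of_mem ht, indicator_of_mem h0, mul_comm]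
    · simp only [indicator_apply, if_neg ht, smul_zero, ite_self]
  rw [e]
  have hzero : ∀ x, x ∉ Ioc p q → (Ioc p q).indicator h x = 0 := fun x hx =>
    indicator_of_notMem hx h
  intro z
  refine mellin_differentiableAt_of_isBigO_rpow (a := z.re + 1) (b := z.re - 1)
    ((hh.integrable_indicator measurableSet_Ioc).locallyIntegrable.locallyIntegrableOn _)
    ?_ (by linarith) ?_ (by linarith)
  · refine EventuallyEq.trans_isBigO ?_ (Asymptotics.isBigO_zero _ _)
    filter_upwards [eventually_gt_atTop q] with x hx using hzero x fun h => h.2.not_gt hx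
  · refine EventuallyEq.trans_isBigO ?_ (Asymptotics.isBigO_zero _ _)
    filter_upwards [mem_nhdsWithin_of_mem_nhds (Iio_mem_nhds hp)] with x hx
      using hzero x fun h => h.1.not_gt hx

lemma IsPluriphase.exists_eq_const (h : IsPluriphase G κ) (hg : 0 < inradius G) :
    ∃ δ, 0 < δ ∧ δ ≤ inradius G ∧ ∀ k < d, ∀ t ∈ Ioc 0 δ, κ k t = κ k δ := by
  obtain ⟨P, hP⟩ := h
  have hev : ∀ᶠ δ in 𝓝[>] (0 : ℝ), ∀ p ∈ P, p ∉ Ioc 0 δ := by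
    rw [Filter.eventually_all_finset]
    intro p _
    rcases le_or_gt p 0 with hp | hp
    · exact Eventually.of_forall fun δ h => hp.not_gt h.1
    · filter_upwards [Ioo_mem_nhdsGT hp] with δ hδ h using hδ.2.not_ge h.2
  obtain ⟨δ, h1, h2⟩ := (hev.and (Ioc_mem_nhdsGT hg)).exists
  refine ⟨δ, h2.1, h2.2, fun k hk t ht => hP k hk t δ ht.1.le ht.2 h2.2 fun p hp hpI => ?_⟩
  exact h1 p hp ⟨ht.1.trans_le hpI.1, hpI.2⟩

/-- If the coefficients are constant near `0`, the factor of the generator continues to a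
meromorphic function on the plane, with poles only at `0, …, d`. -/
lemma IsPluriphase.exists_continuation (h : IsPluriphase G κ) (hG : IsSteinerLike G κ)
    (hg : 0 < inradius G) : ∃ N : ℂ → ℂ, (∀ s, MeromorphicAt N s) ∧
      (∀ s, (∀ k ≤ d, s ≠ (k : ℂ)) → AnalyticAt ℂ N s) ∧
      ∀ s : ℂ, (d : ℝ) < s.re → generatorZeta G κ s = N s := by
  obtain ⟨δ, hδ, hδg, hconst⟩ := h.exists_eq_const hg
  set H : ℕ → ℂ → ℂ := fun k s => ∫ t in δ..inradius G, (κ k t : ℂ) * (t : ℂ) ^ (s - k - 1) with hH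
  have hκ : ∀ k < d, IntegrableOn (fun t => (κ k t : ℂ)) (Ioc δ (inradius G)) := fun k hk =>
    (((hG.locallyIntegrable k hk).integrableOn_isCompact isCompact_Icc).mono_set
      fun t ht => ⟨hδ.le.trans ht.1.le, ht.2⟩).ofReal
  have hHd : ∀ k < d, Differentiable ℂ (H k) := fun k hk =>
    (differentiable_intervalIntegral_mul_cpow hδ hδg (hκ k hk)).comp
      (g := fun z : ℂ => ∫ t in δ..inradius G, (κ k t : ℂ) * (t : ℂ) ^ (z - 1))
      (differentiable_id.sub_const (k : ℂ))
  have hpow : ∀ (x : ℝ) (k : ℕ), 0 < x → Differentiable ℂ fun s : ℂ => (x : ℂ) ^ (s - k) :=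
    fun x k hx => by
      have hx' : (x : ℂ) ≠ 0 := by exact_mod_cast hx.ne'
      exact fun s => DifferentiableAt.const_cpow (by fun_prop) (Or.inl hx')
  refine ⟨fun s => (∑ k ∈ Finset.range d, ((κ k δ : ℂ) * ((δ : ℂ) ^ (s - k) / (s - k)) + H k s)) +
    (-(volume.real G : ℂ)) * (inradius G : ℂ) ^ (s - d) / (s - d), fun s => ?_, fun s hs => ?_,
    fun s hs => ?_⟩
  · refine MeromorphicAt.fun_add (MeromorphicAt.fun_sum fun k hk => MeromorphicAt.fun_add
      (MeromorphicAt.fun_mul (by fun_prop) (MeromorphicAt.fun_div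
        ((hpow δ k hδ).analyticAt s).meromorphicAt (by fun_prop)))
      ((hHd k (Finset.mem_range.1 hk)).analyticAt s).meromorphicAt)
      (MeromorphicAt.fun_div (MeromorphicAt.fun_mul (by fun_prop)
        ((hpow _ d hg).analyticAt s).meromorphicAt) (by fun_prop))
  · have hne : ∀ k ≤ d, s - (k : ℂ) ≠ 0 := fun k hk => sub_ne_zero.2 (hs k hk)
    refine AnalyticAt.fun_add (Finset.analyticAt_fun_sum _ fun k hk => AnalyticAt.fun_add
      (AnalyticAt.fun_mul analyticAt_const (AnalyticAt.fun_div ((hpow δ k hδ).analyticAt s)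
        (by fun_prop) (hne k (Finset.mem_range.1 hk).le)))
      ((hHd k (Finset.mem_range.1 hk)).analyticAt s))
      (AnalyticAt.fun_div (AnalyticAt.fun_mul analyticAt_const ((hpow _ d hg).analyticAt s))
        (by fun_prop) (hne d le_rfl))
  · rw [generatorZeta]
    congr 1
    refine Finset.sum_congr rfl fun k hk => ?_
    have hkd := Finset.mem_range.1 hk
    have hre : -1 < (s - k - 1).re := by
      have : (k : ℝ) < d := by exact_mod_cast hkd
      simp only [Complex.sub_re, Complex.natCast_re, Complex.one_re]
      linarith
    have hcongr : ∀ t ∈ uIoc 0 δ, (κ k δ : ℂ) * (t : ℂ) ^ (s - k - 1) =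
        (κ k t : ℂ) * (t : ℂ) ^ (s - k - 1) := fun t ht => by
      rw [uIoc_of_le hδ.le] at ht
      rw [hconst k hkd t ht]
    have hi1 : IntervalIntegrable (fun t : ℝ => (κ k t : ℂ) * (t : ℂ) ^ (s - k - 1)) volume 0 δ :=
      ((intervalIntegral.intervalIntegrable_cpow' hre).const_mul (κ k δ : ℂ)).congr
        (fun t ht => hcongr t ht)
    have hi2 : IntervalIntegrable (fun t : ℝ => (κ k t : ℂ) * (t : ℂ) ^ (s - k - 1)) volume δ
        (inradius G) := by
      refine IntervalIntegrable.mul_continuousOn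
        ((intervalIntegrable_iff_integrableOn_Ioc_of_le hδg).2 (hκ k hkd)) fun t ht => ?_
      rw [uIcc_of_le hδg] at ht
      exact (Complex.continuousAt_ofReal_cpow_const t _
        (Or.inr (hδ.trans_le ht.1).ne')).continuousWithinAt
    rw [← intervalIntegral.integral_add_adjacent_intervals hi1 hi2]
    congr 1
    rw [← intervalIntegral.integral_congr_ae (Eventually.of_forall hcongr),
      intervalIntegral.integral_const_mul, integral_cpow (Or.inl hre), sub_add_cancel,
      Complex.ofReal_zero, Complex.zero_cpow, sub_zero]
    intro h0
    rw [h0] at hre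
    simp only [zero_sub, Complex.neg_re, Complex.one_re, lt_self_iff_false] at hre

lemma isPreconnected_window {f : ℝ → ℝ} (hf : Continuous f) : IsPreconnected (window f) := by
  have e : window f = (fun p : ℝ × ℝ => ((f p.1 + p.2 : ℝ) : ℂ) + p.1 * Complex.I) ''
      (univ ×ˢ Ici 0) := by
    ext s
    constructor
    · intro hs
      exact ⟨(s.im, s.re - f s.im), ⟨mem_univ _, mem_Ici.2 (sub_nonneg.2 hs)⟩,
        Complex.ext (by simp) (by simp)⟩
    · rintro ⟨p, hp, rfl⟩
      have : 0 ≤ p.2 := hp.2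
      simpa [window] using this
  rw [e]
  exact (isPreconnected_univ.prod isPreconnected_Ici).image _ (by fun_prop)

/-- By the identity theorem on the connected window, every continuation of the generator factor has
its poles there among `0, …, d`. -/
lemma IsPluriphase.pole_eq_natCast (h : IsPluriphase G κ) (hG : IsSteinerLike G κ)
    (hg : 0 < inradius G) {f : ℝ → ℝ} (hf : Continuous f) {M : ℂ → ℂ}
    (hM : ∀ s ∈ window f, MeromorphicAt M s)
    (heq : ∀ s ∈ window f, (d : ℝ) < s.re → M s = generatorZeta G κ s) {w : ℂ}
    (hw : w ∈ window f) (hpole : HasPole M w) : ∃ k ≤ d, w = (k : ℂ) := by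
  obtain ⟨N, hN, hNa, hNeq⟩ := h.exists_continuation hG hg
  by_contra! hne
  have hD : MeromorphicOn (fun s => M s - N s) (window f) := fun s hs => (hM s hs).fun_sub (hN s)
  set x : ℝ := max (f 0) d + 1 with hx
  have hx1 : f 0 < x := (le_max_left _ _).trans_lt (lt_add_one _)
  have hx2 : (d : ℝ) < x := (le_max_right _ _).trans_lt (lt_add_one _)
  have hxw : (x : ℂ) ∈ window f := by simpa [window] using hx1.le
  have htop : meromorphicOrderAt (fun s => M s - N s) (x : ℂ) = ⊤ := by
    rw [meromorphicOrderAt_eq_top_iff]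
    refine eventually_nhdsWithin_of_eventually_nhds ?_
    have h1 : ∀ᶠ s : ℂ in 𝓝 (x : ℂ), f s.im < s.re :=
      (hf.comp Complex.continuous_im).continuousAt.eventually_lt
        Complex.continuous_re.continuousAt (by simpa using hx1)
    have h2 : ∀ᶠ s : ℂ in 𝓝 (x : ℂ), (d : ℝ) < s.re :=
      Complex.continuous_re.continuousAt.eventually_const_lt (by simpa using hx2)
    filter_upwards [h1, h2] with s hs1 hs2
    rw [heq s hs1.le hs2, hNeq s hs2, sub_self]
  have htopw : meromorphicOrderAt (fun s => M s - N s) w = ⊤ := by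
    by_contra hnt
    exact hD.meromorphicOrderAt_ne_top_of_isPreconnected (isPreconnected_window hf) hw hxw hnt htop
  have hMN : M =ᶠ[𝓝[≠] w] N := by
    filter_upwards [meromorphicOrderAt_eq_top_iff.1 htopw] with s hs using sub_eq_zero.1 hs
  rw [hasPole_iff_meromorphicOrderAt_neg (hM w hw), meromorphicOrderAt_congr hMN] at hpole
  exact absurd (hNa w hne).meromorphicOrderAt_nonneg (not_le.2 hpole)

end Pluriphase

/-! ### Tube formulas -/

section TubeFormula

variable {d : ℕ} {A : Set (EuclideanSpace ℝ (Fin d))} {Zη M : ℂ → ℂ} {D : Set ℂ} {f : ℝ → ℝ}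
  {β : ℝ} {τ : ℤ → ℝ}

lemma geometricZeta_one : geometricZeta d Zη M 1 = fun s => Zη s * M s := by
  funext s
  simp [geometricZeta]

/-- An integral over the screen whose integrand scales like `a^{d-s}` is `O(a^{d - sup f})`. -/
lemma isBigO_screenIntegral {F : ℝ → ℂ → ℂ} {H : ℂ → ℂ} (hH : Integrable (screenIntegrand f H))
    (hF : ∀ a, 0 < a → ∀ s, F a s = (a : ℂ) ^ (d - s) * H s) (hf : BddAbove (range f)) :
    (fun a : ℝ => screenIntegral f (F a)) =O[𝓝[>] 0] fun a : ℝ => a ^ ((d : ℝ) - ⨆ t, f t) := by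
  refine Asymptotics.IsBigO.of_bound
    (‖(2 * Real.pi * Complex.I : ℂ)⁻¹‖ * ∫ t, ‖screenIntegrand f H t‖) ?_
  filter_upwards [Ioo_mem_nhdsGT (zero_lt_one' ℝ)] with a ha
  have ha0 : 0 < a := ha.1
  rw [screenIntegral, norm_mul, mul_assoc ‖(_ : ℂ)‖]
  refine mul_le_mul_of_nonneg_left ?_ (by positivity)
  rw [← integral_mul_const]
  refine norm_integral_le_of_norm_le (hH.norm.mul_const _) (Eventually.of_forall fun t => ?_)
  rw [screenIntegrand, hF a ha0, mul_assoc, norm_mul, mul_comm,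
    Complex.norm_cpow_eq_rpow_re_of_pos ha0, Real.norm_of_nonneg (Real.rpow_nonneg ha0.le _)]
  refine mul_le_mul_of_nonneg_left ?_ (norm_nonneg _)
  refine Real.rpow_le_rpow_of_exponent_ge ha0 ha.2.le ?_
  rw [Complex.sub_re, Complex.natCast_re, screenPoint_re]
  linarith [le_ciSup hf t]

lemma IsScreen.exists_bounds (hf : IsScreen f) (x : ℝ) :
    ∃ m c : ℝ, x < c ∧ (∀ t, m ≤ f t) ∧ ∀ t, f t ≤ c := by
  obtain ⟨B, hB⟩ := hf.bounded
  exact ⟨-B, max B x + 1, (le_max_right _ _).trans_lt (lt_add_one _), fun t => (abs_le.1 (hB t)).1,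
    fun t => ((abs_le.1 (hB t)).2.trans (le_max_left _ _)).trans (lt_add_one _).le⟩

lemma IsScreen.bddAbove (hf : IsScreen f) : BddAbove (range f) := by
  obtain ⟨B, hB⟩ := hf.bounded
  exact ⟨B, by rintro _ ⟨t, rfl⟩; exact (abs_le.1 (hB t)).2⟩

namespace IsTubeZeta

lemma tendsto_ratio {Z : ℂ → ℂ} (h : IsTubeZeta A Z D f β τ) :
    Tendsto (fun n : ℕ => τ n / -τ (-n)) atTop (𝓝 1) := by
  refine h.languid.ratio.congr' ?_
  filter_upwards [eventually_ge_atTop 1] with n hn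
  rw [abs_of_neg (h.tau_neg hn)]

lemma mul_vertical_eq {Z E : ℂ → ℂ} (h : IsTubeZeta A Z D f β τ) {c : ℝ} (hfc : ∀ t, f t ≤ c)
    (hc : (d : ℝ) < c) (t : ℝ) :
    E (c + t * Complex.I) * Z (c + t * Complex.I) =
      E (d + ((c - d : ℝ) + t * Complex.I)) *
        (-(distanceZeta A ((c - d : ℝ) + t * Complex.I) / ((c - d : ℝ) + t * Complex.I))) := by
  rw [h.eq_distanceZeta (c + t * Complex.I) (by simpa [window] using hfc t) (by simpa using hc)]
  have e1 : (c + t * Complex.I - d : ℂ) = (c - d : ℝ) + t * Complex.I := by push_cast; ring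
  have e2 : (d + ((c - d : ℝ) + t * Complex.I) : ℂ) = c + t * Complex.I := by push_cast; ring
  rw [e1, e2]

theorem pointwiseTubeFormula (h : IsTubeZeta A (fun s => Zη s * M s) D f β τ) (hd : 1 ≤ d)
    (hA : IsOpen A) (hb : Bornology.IsBounded A) (hf : IsScreen f) (hβ : β < -1) :
    PointwiseTubeFormula d (tubeVolume A) (geometricZeta d Zη M) D f τ := by
  obtain ⟨m, c, hc, hm, hfc⟩ := hf.exists_bounds d
  obtain ⟨K, hK⟩ := hf.lipschitz
  have hEd : ∀ ε : ℝ, 0 < ε → Differentiable ℂ fun s : ℂ => (ε : ℂ) ^ ((d : ℂ) - s) :=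
    fun ε hε s => DifferentiableAt.const_cpow (by fun_prop)
      (Or.inl (by exact_mod_cast hε.ne'))
  have hE : ∀ ε : ℝ, 0 < ε → ∃ B, ∀ s : ℂ, m ≤ s.re → s.re ≤ c →
      ‖(ε : ℂ) ^ ((d : ℂ) - s)‖ ≤ B * (1 + |s.im|) ^ (0 : ℝ) := fun ε hε => by
    obtain ⟨B, -, hB⟩ := exists_norm_cpow_le (q := ε) hε (d - c) (d - m)
    refine ⟨B, fun s h1 h2 => ?_⟩
    rw [Real.rpow_zero, mul_one]
    refine hB ε ⟨le_rfl, le_rfl⟩ _ ?_ ?_ <;> simp only [Complex.sub_re, Complex.natCast_re] <;>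
      linarith
  have hint : ∀ ε : ℝ, 0 < ε → Integrable (screenIntegrand f (geometricZeta d Zη M ε)) := by
    intro ε hε
    obtain ⟨B, hB⟩ := hE ε hε
    exact h.integrable_screenIntegrand hd hA hb hK (hEd ε hε) hB (by linarith) hm hfc hc
  refine ⟨h.finite, hint, fun ε hε => ?_, ?_⟩
  · obtain ⟨B, hB⟩ := hE ε hε
    have hL := tendsto_integral_distanceZeta_div hd hA hb (sub_pos.2 hc) hε
      (a := fun n => -τ (-n)) (b := fun n => τ n)
      ((eventually_ge_atTop 1).mono fun n hn => neg_pos.2 (h.tau_neg hn)) h.languid.top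
      h.tendsto_ratio
    have key := h.tendsto_sum_residueAt hd hA hb hK (hEd ε hε) hB le_rfl (by linarith) hm hfc hc
      (L := tubeVolume A ε - volume.real A) (by
        refine hL.congr fun n => ?_
        rw [neg_neg]
        refine intervalIntegral.integral_congr fun t _ => ?_
        rw [h.mul_vertical_eq (E := fun s => (ε : ℂ) ^ ((d : ℂ) - s)) hfc hc, sub_add_cancel_left])
    simp only [sub_self, Complex.cpow_zero, one_mul, sub_add_cancel] at key
    exact key
  · refine isBigO_screenIntegral (hint 1 one_pos) (fun a _ s => ?_) hf.bddAbove
    rw [geometricZeta_one, geometricZeta]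

theorem distributionalTubeFormula (h : IsTubeZeta A (fun s => Zη s * M s) D f β τ) (hd : 1 ≤ d)
    (hA : IsOpen A) (hb : Bornology.IsBounded A) (hf : IsScreen f) :
    DistributionalTubeFormula d (tubeVolume A) (geometricZeta d Zη M) D f τ := by
  obtain ⟨m, c, hc, hm, hfc⟩ := hf.exists_bounds d
  obtain ⟨K, hK⟩ := hf.lipschitz
  -- Decay of order `N` of the weight brings the exponent of growth `β - N` below `-1`.
  obtain ⟨N, hN⟩ := exists_nat_gt (β + 1)
  have hE : ∀ φ, IsTestFunction φ → ∃ B, ∀ s : ℂ, m ≤ s.re → s.re ≤ c →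
      ‖powerPairing d φ s‖ ≤ B * (1 + |s.im|) ^ (-(N : ℝ)) := fun φ hφ => by
    obtain ⟨B, -, hB⟩ := exists_norm_powerPairing_le_rpow (d := d) hφ N m c
    exact ⟨B, hB⟩
  have hpair : ∀ φ, (fun s => pairing (fun ε => geometricZeta d Zη M ε s) φ) =
      fun s => powerPairing d φ s * (Zη s * M s) := fun φ => funext (pairing_geometricZeta Zη M φ)
  have hint : ∀ φ, IsTestFunction φ →
      Integrable (screenIntegrand f fun s => powerPairing d φ s * (Zη s * M s)) := by
    intro φ hφ
    obtain ⟨B, hB⟩ := hE φ hφ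
    exact h.integrable_screenIntegrand hd hA hb hK (differentiable_powerPairing hφ) hB
      (by linarith) hm hfc hc
  refine ⟨h.finite, fun φ hφ => by rw [hpair]; exact hint φ hφ, fun φ hφ => ?_, fun φ hφ => ?_⟩
  · obtain ⟨B, hB⟩ := hE φ hφ
    have hL := tendsto_integral_powerPairing_mul hd hA hb (sub_pos.2 hc) hφ
      (a := fun n => -τ (-n)) (b := fun n => τ n)
      ((eventually_ge_atTop 1).mono fun n hn => neg_pos.2 (h.tau_neg hn)) h.languid.top
      h.tendsto_ratio
    have key := h.tendsto_sum_residueAt hd hA hb hK (differentiable_powerPairing hφ) hB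
      (by simp) (by linarith) hm hfc hc (L := pairing (fun ε => (tubeVolume A ε : ℂ)) φ -
        volume.real A * powerPairing d φ d) (by
        refine hL.congr fun n => ?_
        rw [neg_neg]
        refine intervalIntegral.integral_congr fun t _ => ?_
        rw [h.mul_vertical_eq (E := powerPairing d φ) hfc hc])
    rw [mul_comm (volume.real A : ℂ), sub_add_cancel] at key
    refine key.congr fun n => ?_
    rw [distError, hpair]
    congr 1
    refine finsum_mem_congr rfl fun w hw => ?_
    exact (pairing_residueAt hφ (h.meromorphicAt w (h.dims w hw.1).1)).symm
  · refine isBigO_screenIntegral (hint φ hφ) (fun a ha s => ?_) hf.bddAbove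
    rw [pairing_geometricZeta, powerPairing_rescale φ ha, mul_assoc]

end IsTubeZeta

lemma nonempty_of_inradius_pos (hg : 0 < inradius A) : A.Nonempty := by
  by_contra h
  rw [not_nonempty_iff_eq_empty] at h
  have : {ε : ℝ | 0 < ε ∧ ∃ x, Metric.ball x ε ⊆ A} = ∅ := by
    refine eq_empty_of_forall_notMem ?_
    rintro ε ⟨hε, x, hx⟩
    have := hx (Metric.mem_ball_self hε)
    rwa [h] at this
  rw [inradius, this, Real.sSup_empty] at hg
  exact hg.false

/-- The geometric zeta function of a fractal spray satisfies the hypotheses of the residue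
argument. -/
theorem IsFractalSpray.isTubeZeta (hd : 1 ≤ d) {ι : Type*} [Countable ι]
    {G : Set (EuclideanSpace ℝ (Fin d))} {κ : ℕ → ℝ → ℝ} (hG : IsSteinerLike G κ)
    (hg : 0 < inradius G) {r : ι → ℝ} (hT : IsFractalSpray G r A) (hf : IsScreen f)
    (hdW : (d : ℂ) ∈ window f) {U : Set ℂ} (hWU : window f ⊆ U)
    (hZη : IsMeromorphicContinuation (scalingZeta r) Zη d U)
    (hM : IsMeromorphicContinuation (generatorZeta G κ) M d U)
    (hS : ∀ t : ℝ, ¬ HasPole (geometricZeta d Zη M 1) (screenPoint f t))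
    (hL : IsLanguid (geometricZeta d Zη M 1) f d β τ) :
    IsTubeZeta A (fun s => Zη s * M s) (visibleDims d f Zη M) f β τ := by
  obtain ⟨K, hK⟩ := hf.lipschitz
  rw [geometricZeta_one] at hS hL
  have hsum : ∀ x : ℝ, (d : ℝ) ≤ x → Summable fun n => r n ^ x := fun x hx =>
    summable_rpow hd hG.isOpen hG.isBounded (nonempty_of_inradius_pos hg) hT hx
  have hmZ : ∀ s ∈ window f, MeromorphicAt Zη s := fun s hs => hZη.meromorphicOn s (hWU hs)
  have hmM : ∀ s ∈ window f, MeromorphicAt M s := fun s hs => hM.meromorphicOn s (hWU hs)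
  have hmem : ∀ t, screenPoint f t ∈ window f := fun t => by
    simp [window, screenPoint]
  have hordZ : ∀ w ∈ window f, (d : ℝ) ≤ w.re → 0 ≤ meromorphicOrderAt Zη w := by
    intro w hw hre
    obtain ⟨B, hB⟩ := exists_norm_scalingZeta_le hT.ratio_pos hsum (w.re + 1)
    refine meromorphicOrderAt_nonneg_of_ray (hmZ w hw) one_pos (B := B) fun t h0 h1 => ?_
    rw [hZη.eq _ (hWU (IsTubeZeta.add_ofReal_mem_window hw h0.le)) (by simp; linarith)]
    refine hB _ ?_ ?_ <;> simp <;> linarith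
  have hordM : ∀ w ∈ window f, (d : ℝ) ≤ w.re → w ≠ d → 0 ≤ meromorphicOrderAt M w := by
    intro w hw hre hne
    refine meromorphicOrderAt_nonneg_of_eq_distanceZeta hd hG.isOpen hG.isBounded (hmM w hw) hre
      hne fun t ht => ?_
    have hre' : (d : ℝ) < (w + t).re := by simp; linarith
    rw [hM.eq _ (hWU (IsTubeZeta.add_ofReal_mem_window hw ht.le)) hre',
      generatorZeta_eq hd hG hg hre']
  have hdims : ∀ w ∈ visibleDims d f Zη M, w ∈ window f ∧ w.re < d := by
    rintro w (⟨hw, hp | ⟨k, hk, rfl⟩⟩ | ⟨hw, hp, hne⟩)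
    · rw [hasPole_iff_meromorphicOrderAt_neg (hmZ w hw)] at hp
      exact ⟨hw, not_le.1 fun hre => absurd hp (not_lt.2 (hordZ w hw hre))⟩
    · exact ⟨hw, by simpa using hk⟩
    · rw [hasPole_iff_meromorphicOrderAt_neg (hmM w hw)] at hp
      exact ⟨hw, not_le.1 fun hre => absurd hp (not_lt.2 (hordM w hw hre hne))⟩
  refine ⟨fun s hs => (hmZ s hs).fun_mul (hmM s hs), fun s hs hre => ?_, hdW,
    fun s hs hneg hne => ?_, hdims, fun t => ?_, hL, fun n => ?_⟩
  · rw [hZη.eq s (hWU hs) hre, hM.eq s (hWU hs) hre,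
      scalingZeta_mul_generatorZeta hd hG hg hT hsum hre]
  · by_contra hD
    have h1 : 0 ≤ meromorphicOrderAt Zη s := not_lt.1 fun h =>
      hD (Or.inl ⟨hs, Or.inl ((hasPole_iff_meromorphicOrderAt_neg (hmZ s hs)).2 h)⟩)
    have h2 : 0 ≤ meromorphicOrderAt M s := not_lt.1 fun h =>
      hD (Or.inr ⟨hs, (hasPole_iff_meromorphicOrderAt_neg (hmM s hs)).2 h, hne⟩)
    exact absurd hneg (not_lt.2 (meromorphicOrderAt_mul_nonneg (hmZ s hs) (hmM s hs) h1 h2))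
  · have h := hS t
    rwa [hasPole_iff_meromorphicOrderAt_neg ((hmZ _ (hmem t)).fun_mul (hmM _ (hmem t))),
      not_lt] at h
  · have hk := isCompact_screenRegion (c := d) (a := τ (-n)) (b := τ n) hK
    refine (((finite_poles_of_isCompact hk fun s hs => hmZ s hs.2.2.1).union
      (finite_poles_of_isCompact hk fun s hs => hmM s hs.2.2.1)).union
      ((Finset.range d).finite_toSet.image fun k : ℕ => (k : ℂ))).subset ?_
    rintro w ⟨hwD, h1, h2⟩
    have hw := hdims w hwD
    have hwR : w ∈ screenRegion f d (τ (-n)) (τ n) := ⟨h1, h2, hw.1, hw.2.le⟩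
    rcases hwD with ⟨-, hp | ⟨k, hk, rfl⟩⟩ | ⟨-, hp, -⟩
    · exact Or.inl (Or.inl ⟨hwR, (hasPole_iff_meromorphicOrderAt_neg (hmZ w hw.1)).1 hp⟩)
    · exact Or.inr ⟨k, by simpa using hk, rfl⟩
    · exact Or.inl (Or.inr ⟨hwR, (hasPole_iff_meromorphicOrderAt_neg (hmM w hw.1)).1 hp⟩)

end TubeFormula

theorem theorem3p1 {d : ℕ} (hd : 1 ≤ d) {ι : Type*} [Countable ι]
    (G : Set (EuclideanSpace ℝ (Fin d))) (κ : ℕ → ℝ → ℝ) (hG : IsSteinerLike G κ)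
    (hg : 0 < inradius G)
    (r : ι → ℝ) (T : Set (EuclideanSpace ℝ (Fin d))) (hT : IsFractalSpray G r T)
    (f : ℝ → ℝ) (hf : IsScreen f) (hdW : (d : ℂ) ∈ window f)
    (U : Set ℂ) (hU : IsOpen U) (hWU : window f ⊆ U)
    (Zη M : ℂ → ℂ)
    (hZη : IsMeromorphicContinuation (scalingZeta r) Zη d U)
    (hM : IsMeromorphicContinuation (generatorZeta G κ) M d U)
    (hS : ∀ t : ℝ, ¬ HasPole (geometricZeta d Zη M 1) (screenPoint f t))
    (β : ℝ) (τ : ℤ → ℝ) (hL : IsLanguid (geometricZeta d Zη M 1) f d β τ) :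
    (IsPluriphase G κ → visibleDims d f Zη M = scalingAndIntegerDims d f Zη) ∧
    DistributionalTubeFormula d (tubeVolume T) (geometricZeta d Zη M)
      (visibleDims d f Zη M) f τ ∧
    (β < -1 → PointwiseTubeFormula d (tubeVolume T) (geometricZeta d Zη M)
      (visibleDims d f Zη M) f τ) := by
  have h := hT.isTubeZeta hd hG hg hf hdW hWU hZη hM hS hL
  refine ⟨fun hP => ?_, h.distributionalTubeFormula hd hT.isOpen hT.isBounded hf,
    h.pointwiseTubeFormula hd hT.isOpen hT.isBounded hf⟩
  obtain ⟨K, hK⟩ := hf.lipschitz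
  refine union_eq_left.2 ?_
  rintro w ⟨hw, hp, hne⟩
  obtain ⟨k, hk, rfl⟩ := hP.pole_eq_natCast hG hg hK.continuous
    (fun s hs => hM.meromorphicOn s (hWU hs)) (fun s hs => hM.eq s (hWU hs)) hw hp
  exact ⟨hw, Or.inr ⟨k, hk.lt_of_ne fun h => hne (by rw [h]), rfl⟩⟩
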